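/- Let $\mathbf F$ be a finite field of odd characteristic, $\chi$ a non-trivial additive character $\mathbf F\to\mathbf C^\times$ and $n\ge 0$. Let $V=\mathbf F^{2n}$ be the standard symplectic space, $G=Sp_{2n}=Sp(V)$. Let $a$ be an anisotropic inner product (symmetric bilinear form without non-zero isotropic vectors) on a finite-dimensional $\mathbf F$-space $V_a$, and for $\ell\ge 0$ let $V'_\ell$ be the orthogonal direct sum of $(V_a,a)$ and $\ell$ hyperbolic planes (the $\ell$-th member of the Witt tower of $a$). Then $V\otimes V'_\ell$ is a symplectic space, and $G$ and $G'=O(V'_\ell)$ act on it as commuting subgroups of $Sp(V\otimes V'_\ell)$. Let $\omega_\ell$ be the oscillator representation of $Sp(V\otimes V'_\ell)$ with central character $\chi$, that is, the representation on the space of the irreducible representation $\rho_\chi$ of the Heisenberg group $H(V\otimes V'_\ell)$ with central character $\chi$ that satisfies $\omega_\ell(g)\rho_\chi(h)\omega_\ell(g)^{-1}=\rho_\chi(g(h))$, normalized so that unipotent elements $\begin{pmatrix}1&S\\0&1\end{pmatrix}$ of the Siegel parabolic act in the Schrödinger model by multiplication by $y\mapsto\chi\left(\tfrac12 B_S(y,y)\right)$.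 (As a representation of $G$, $\omega_\ell\simeq\omega_a\otimes\omega_{1,1}^{\otimes\ell}$, where $\omega_a=\omega_0$ and $\omega_{1,1}$ is the representation of $G$ attached in the same way to one hyperbolic plane.) Let $\widehat{Sp}_{2n}(a,\ell)$ be the set of classes of irreducible representations of $G$ that appear in $\omega_\ell|_G$. The new spectrum is $N_\ell=\widehat{Sp}_{2n}(a,\ell)\smallsetminus\widehat{Sp}_{2n}(a,\ell-1)$, where $\widehat{Sp}_{2n}(a,-1)=\emptyset$. Let $(\omega_\ell)^{new}_G$ be the sum of the $G$-isotypic components of $\omega_\ell$ for the classes in $N_\ell$; it is invariant under $G\times G'$. Then the operators $\omega_\ell(g')$, $g'\in G'$, restricted to $(\omega_\ell)^{new}_G$, generate the commutant of $G$ in $\mathrm{End}_{\mathbf C}\left((\omega_\ell)^{new}_G\right)$. In particular, the action of $G\times G'$ on $(\omega_\ell)^{new}_G$ defines a bijection $\eta$ of some subset $S\subset\widehat{G'}$ onto $N_\ell$: for irreducible representations $\sigma$ of $G$ and $\tau$ of $G'$, the representation $\sigma\boxtimes\tau$ of $G\times G'$ occurs in $(\omega_\ell)^{new}_G$ with multiplicity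 one if $\tau\in S$ and $\eta(\tau)=\sigma$, and does not occur otherwise. -/

import Mathlib

noncomputable section

/-! ### Forms, symplectic spaces and isometry groups -/

/-- The isometry group of a bilinear form: `Sp(W)` for a symplectic form, `O(V')` for an inner
product. -/
def isometryGroup {F M : Type*} [Field F] [AddCommGroup M] [Module F M]
    (B : LinearMap.BilinForm F M) : Subgroup (M ≃ₗ[F] M) where
  carrier := {g | ∀ x y, B (g x) (g y) = B x y}
  one_mem' := fun _ _ => rfl
  mul_mem' := by
    intro a b ha hb x y
    rw [LinearEquiv.mul_apply, LinearEquiv.mul_apply, ha, hb]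
  inv_mem' := by
    intro a ha x y
    have h := ha (a⁻¹ x) (a⁻¹ y)
    have e : ∀ z, a (a⁻¹ z) = z := fun z => by
      rw [← LinearEquiv.mul_apply, mul_inv_cancel]; rfl
    rw [e, e] at h
    exact h.symm

/-- An inner product: a non-degenerate symmetric bilinear form. -/
structure IsInnerProduct {F M : Type*} [Field F] [AddCommGroup M] [Module F M]
    (B : LinearMap.BilinForm F M) : Prop where
  symm : ∀ x y, B x y = B y x
  nondeg : ∀ x, (∀ y, B x y = 0) → x = 0

/-- For `M = V'`, the space `W = V ⊗ V'` with `V = F ^ (2n)` the standard symplectic space: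
a vector `w` has the `n` coordinates `x i = w (Sum.inl i)` and the `n` coordinates
`y i = w (Sum.inr i)`, all of them in `V'`. For `M = F` it is `V` itself. -/
abbrev SympSpace (n : ℕ) (M : Type*) : Type _ := Fin n ⊕ Fin n → M

/-- The tensor product of the standard symplectic form of `F ^ (2n)` with the form `B`:
`⟨w, w'⟩ = ∑ i, (B (x i) (y' i) - B (y i) (x' i))`. -/
def sympForm {F M : Type*} [Field F] [AddCommGroup M] [Module F M] (n : ℕ)
    (B : LinearMap.BilinForm F M) : LinearMap.BilinForm F (SympSpace n M) :=
  ∑ i : Fin n, (B.compl₁₂ (LinearMap.proj (Sum.inl i)) (LinearMap.proj (Sum.inr i)) -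
    B.compl₁₂ (LinearMap.proj (Sum.inr i)) (LinearMap.proj (Sum.inl i)))

theorem sympForm_apply {F M : Type*} [Field F] [AddCommGroup M] [Module F M] (n : ℕ)
    (B : LinearMap.BilinForm F M) (w w' : SympSpace n M) :
    sympForm n B w w' =
      ∑ i, (B (w (Sum.inl i)) (w' (Sum.inr i)) - B (w (Sum.inr i)) (w' (Sum.inl i))) := by
  simp [sympForm, LinearMap.sum_apply]

theorem sympForm_self {F M : Type*} [Field F] [AddCommGroup M] [Module F M] (n : ℕ)
    {B : LinearMap.BilinForm F M} (hB : IsInnerProduct B) (w : SympSpace n M) :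
    sympForm n B w w = 0 := by
  rw [sympForm_apply]
  exact Finset.sum_eq_zero fun i _ => by rw [hB.symm]; exact sub_self _

/-! ### The Heisenberg group and its irreducible representation -/

/-- The Heisenberg group `H(W) = W ⊕ F`. -/
@[ext]
structure Heisenberg {F M : Type*} [Field F] [AddCommGroup M] [Module F M] (n : ℕ)
    (B : LinearMap.BilinForm F M) where
  vec : SympSpace n M
  cen : F

/-- The group law `(w, t) (w', t') = (w + w', t + t' + ⟨w, w'⟩ / 2)`. (The correction term in the
inverse is zero for a symplectic form.) -/
instance Heisenberg.instGroup {F M : Type*} [Field F] [AddCommGroup M] [Module F M] (n : ℕ)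
    (B : LinearMap.BilinForm F M) : Group (Heisenberg n B) where
  mul a b := ⟨a.vec + b.vec, a.cen + b.cen + 2⁻¹ * sympForm n B a.vec b.vec⟩
  one := ⟨0, 0⟩
  inv a := ⟨-a.vec, -a.cen + 2⁻¹ * sympForm n B a.vec a.vec⟩
  mul_assoc a b c := by
    apply Heisenberg.ext
    · exact add_assoc _ _ _
    · change a.cen + b.cen + 2⁻¹ * sympForm n B a.vec b.vec + c.cen +
        2⁻¹ * sympForm n B (a.vec + b.vec) c.vec = a.cen + (b.cen + c.cen +
        2⁻¹ * sympForm n B b.vec c.vec) + 2⁻¹ * sympForm n B a.vec (b.vec + c.vec)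
      simp only [map_add, LinearMap.add_apply]
      ring
  one_mul a := by
    apply Heisenberg.ext
    · exact zero_add _
    · change (0 : F) + a.cen + 2⁻¹ * sympForm n B 0 a.vec = a.cen
      simp
  mul_one a := by
    apply Heisenberg.ext
    · exact add_zero _
    · change a.cen + (0 : F) + 2⁻¹ * sympForm n B a.vec 0 = a.cen
      simp
  inv_mul_cancel a := by
    apply Heisenberg.ext
    · exact neg_add_cancel _
    · change -a.cen + 2⁻¹ * sympForm n B a.vec a.vec + a.cen +
        2⁻¹ * sympForm n B (-a.vec) a.vec = 0
      simp only [map_neg, LinearMap.neg_apply]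
      ring

/-- The space `L²(Y)` of the Schrödinger model, where `Y = {w | x = 0} = (V') ^ n`. -/
abbrev Schrodinger (n : ℕ) (M : Type*) : Type _ := (Fin n → M) → ℂ

/-- The operator by which `(w, t)` acts in the Schrödinger model: `x` acts as multiplication by
`χ ⟨x, y'⟩`, `y` as translation by `y`, `t` as the scalar `χ t`, and
`(w, t) = x · y · (t - ⟨x, y⟩ / 2)`. -/
def heisenbergOp {F M : Type*} [Field F] [AddCommGroup M] [Module F M] (n : ℕ)
    (B : LinearMap.BilinForm F M) (χ : AddChar F ℂ) (h : Heisenberg n B) :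
    Module.End ℂ (Schrodinger n M) where
  toFun f := fun y' =>
    χ (h.cen + ∑ i, B (h.vec (Sum.inl i)) (y' i) -
        2⁻¹ * ∑ i, B (h.vec (Sum.inl i)) (h.vec (Sum.inr i))) *
      f (fun i => y' i - h.vec (Sum.inr i))
  map_add' f g := by funext y'; simp [mul_add]
  map_smul' c f := by funext y'; simp [mul_left_comm]

/-- The representation `ρ_χ` of the Heisenberg group with central character `χ`, in the
Schrödinger model. -/
def heisenbergRep {F M : Type*} [Field F] [AddCommGroup M] [Module F M] (n : ℕ)
    (h2 : (2 : F) ≠ 0) {B : LinearMap.BilinForm F M} (hB : IsInnerProduct B) (χ : AddChar F ℂ) :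
    Representation ℂ (Heisenberg n B) (Schrodinger n M) where
  toFun := heisenbergOp n B χ
  map_one' := by
    refine LinearMap.ext fun f => funext fun y' => ?_
    have e1 : (1 : Heisenberg n B).vec = 0 := rfl
    have e2 : (1 : Heisenberg n B).cen = 0 := rfl
    simp [heisenbergOp, e1, e2]
  map_mul' a b := by
    refine LinearMap.ext fun f => funext fun y' => ?_
    have e1 : (a * b).vec = a.vec + b.vec := rfl
    have e2 : (a * b).cen = a.cen + b.cen + 2⁻¹ * sympForm n B a.vec b.vec := rfl
    have e3 : (fun i => y' i - a.vec (Sum.inr i) - b.vec (Sum.inr i)) =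
        fun i => y' i - (a.vec (Sum.inr i) + b.vec (Sum.inr i)) := by
      funext i; abel
    have e4 : ∑ i, B (a.vec (Sum.inr i)) (b.vec (Sum.inl i)) =
        ∑ i, B (b.vec (Sum.inl i)) (a.vec (Sum.inr i)) :=
      Finset.sum_congr rfl fun i _ => hB.symm _ _
    simp only [heisenbergOp, Module.End.mul_apply, LinearMap.coe_mk, AddHom.coe_mk, e1, e2, e3,
      Pi.add_apply, map_add, map_sub, LinearMap.add_apply, Finset.sum_add_distrib,
      Finset.sum_sub_distrib, sympForm_apply, e4]
    rw [← mul_assoc, ← AddChar.map_add_eq_mul]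
    congr 2
    field_simp
    ring

theorem heisenbergRep_apply {F M : Type*} [Field F] [AddCommGroup M] [Module F M] (n : ℕ)
    (h2 : (2 : F) ≠ 0) {B : LinearMap.BilinForm F M} (hB : IsInnerProduct B) (χ : AddChar F ℂ)
    (h : Heisenberg n B) (f : Schrodinger n M) (y' : Fin n → M) :
    heisenbergRep n h2 hB χ h f y' =
      χ (h.cen + ∑ i, B (h.vec (Sum.inl i)) (y' i) -
        2⁻¹ * ∑ i, B (h.vec (Sum.inl i)) (h.vec (Sum.inr i))) *
      f (fun i => y' i - h.vec (Sum.inr i)) := rfl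

/-- The action of `Sp(W)` on the Heisenberg group by automorphisms, `g (w, t) = (g w, t)`. -/
def Heisenberg.act {F M : Type*} [Field F] [AddCommGroup M] [Module F M] {n : ℕ}
    {B : LinearMap.BilinForm F M} (g : isometryGroup (sympForm n B)) (h : Heisenberg n B) :
    Heisenberg n B :=
  ⟨g.1 h.vec, h.cen⟩

theorem Heisenberg.act_mul {F M : Type*} [Field F] [AddCommGroup M] [Module F M] {n : ℕ}
    {B : LinearMap.BilinForm F M} (g : isometryGroup (sympForm n B)) (h k : Heisenberg n B) :
    Heisenberg.act g (h * k) = Heisenberg.act g h * Heisenberg.act g k := by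
  apply Heisenberg.ext
  · exact map_add g.1 h.vec k.vec
  · change h.cen + k.cen + 2⁻¹ * sympForm n B h.vec k.vec =
      h.cen + k.cen + 2⁻¹ * sympForm n B (g.1 h.vec) (g.1 k.vec)
    rw [g.2 h.vec k.vec]

theorem Heisenberg.act_inv {F M : Type*} [Field F] [AddCommGroup M] [Module F M] {n : ℕ}
    {B : LinearMap.BilinForm F M} (g : isometryGroup (sympForm n B)) (h : Heisenberg n B) :
    Heisenberg.act g h⁻¹ = (Heisenberg.act g h)⁻¹ := by
  apply Heisenberg.ext
  · exact map_neg g.1 h.vec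
  · change -h.cen + 2⁻¹ * sympForm n B h.vec h.vec =
      -h.cen + 2⁻¹ * sympForm n B (g.1 h.vec) (g.1 h.vec)
    rw [g.2 h.vec h.vec]

/-! ### The oscillator representation

An operator `T` with `T ρ(h) = ρ(g h) T` for all `h` is unique up to a scalar. Such an operator is
obtained by averaging, and the scalar is fixed by the condition
`det (T | even functions) = det (T | odd functions)`. The dimensions of the two spaces differ by
one, so this determines the scalar, and it makes `g ↦ T` multiplicative. The condition is equivalent
to the usual normalization: it holds for multiplication by `y ↦ χ (S (y, y) / 2)`, the operator of
a unipotent element of the Siegel parabolic subgroup, and `Sp(W)` is generated by conjugates of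
these elements. -/

/-- `T` satisfies `T ρ(h) = ρ(g h) T` for all `h` in the Heisenberg group. -/
def Intertwines {F M : Type*} [Field F] [AddCommGroup M] [Module F M] {n : ℕ}
    (h2 : (2 : F) ≠ 0) {B : LinearMap.BilinForm F M} (hB : IsInnerProduct B) (χ : AddChar F ℂ)
    (g : isometryGroup (sympForm n B)) (T : Module.End ℂ (Schrodinger n M)) : Prop :=
  ∀ h : Heisenberg n B,
    T * heisenbergRep n h2 hB χ h = heisenbergRep n h2 hB χ (Heisenberg.act g h) * T

/-- The average `∑ w, ρ(g w) ρ(w)⁻¹` over `W`. -/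
def intertwiner {F M : Type*} [Field F] [AddCommGroup M] [Module F M] [Fintype M] {n : ℕ}
    (h2 : (2 : F) ≠ 0) {B : LinearMap.BilinForm F M} (hB : IsInnerProduct B) (χ : AddChar F ℂ)
    (g : isometryGroup (sympForm n B)) : Module.End ℂ (Schrodinger n M) :=
  ∑ w : SympSpace n M,
    heisenbergRep n h2 hB χ (Heisenberg.act g ⟨w, 0⟩) * heisenbergRep n h2 hB χ (⟨w, 0⟩⁻¹)

theorem heisenbergRep_cen {F M : Type*} [Field F] [AddCommGroup M] [Module F M] {n : ℕ}
    (h2 : (2 : F) ≠ 0) {B : LinearMap.BilinForm F M} (hB : IsInnerProduct B) (χ : AddChar F ℂ)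
    (w : SympSpace n M) (t : F) :
    heisenbergRep n h2 hB χ ⟨w, t⟩ = χ t • heisenbergRep n h2 hB χ ⟨w, 0⟩ := by
  refine LinearMap.ext fun f => funext fun y' => ?_
  rw [LinearMap.smul_apply, Pi.smul_apply, smul_eq_mul, heisenbergRep_apply, heisenbergRep_apply,
    ← mul_assoc, ← AddChar.map_add_eq_mul]
  congr 3
  ring

theorem intertwiner_intertwines {F M : Type*} [Field F] [AddCommGroup M] [Module F M] [Fintype M]
    {n : ℕ} (h2 : (2 : F) ≠ 0) {B : LinearMap.BilinForm F M} (hB : IsInnerProduct B)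
    (χ : AddChar F ℂ) (g : isometryGroup (sympForm n B)) :
    Intertwines h2 hB χ g (intertwiner h2 hB χ g) := by
  -- reindex the sum by left translation by `h`
  have key : ∀ h : Heisenberg n B,
      heisenbergRep n h2 hB χ (Heisenberg.act g h) * intertwiner h2 hB χ g *
        heisenbergRep n h2 hB χ h⁻¹ = intertwiner h2 hB χ g := by
    intro h
    unfold intertwiner
    rw [Finset.mul_sum, Finset.sum_mul]
    refine Fintype.sum_equiv (Equiv.addLeft h.vec) _ _ fun w => ?_
    have hk : ∀ k : Heisenberg n B,
        heisenbergRep n h2 hB χ (Heisenberg.act g k) * heisenbergRep n h2 hB χ k⁻¹ =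
        heisenbergRep n h2 hB χ (Heisenberg.act g ⟨k.vec, 0⟩) *
          heisenbergRep n h2 hB χ (⟨k.vec, 0⟩⁻¹) := by
      intro k
      have e1 : Heisenberg.act g k = ⟨g.1 k.vec, k.cen⟩ := rfl
      have e2 : k⁻¹ = ⟨-k.vec, -k.cen⟩ := by
        apply Heisenberg.ext
        · rfl
        · change -k.cen + 2⁻¹ * sympForm n B k.vec k.vec = -k.cen
          rw [sympForm_self n hB]; simp
      have e3 : (⟨k.vec, 0⟩ : Heisenberg n B)⁻¹ = ⟨-k.vec, 0⟩ := by
        apply Heisenberg.ext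
        · rfl
        · change -(0 : F) + 2⁻¹ * sympForm n B k.vec k.vec = 0
          rw [sympForm_self n hB]; simp
      rw [e1, e2, e3, heisenbergRep_cen, heisenbergRep_cen h2 hB χ (-k.vec) (-k.cen),
        smul_mul_smul_comm, ← AddChar.map_add_eq_mul, add_neg_cancel, AddChar.map_zero_eq_one,
        one_smul]
      rfl
    have := hk (h * ⟨w, 0⟩)
    rw [Heisenberg.act_mul, mul_inv_rev, map_mul, map_mul] at this
    simp only [mul_assoc] at this ⊢
    exact this
  intro h
  conv_lhs => rw [← key h]
  rw [mul_assoc, ← map_mul, inv_mul_cancel, map_one, mul_one]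

theorem Intertwines.mul {F M : Type*} [Field F] [AddCommGroup M] [Module F M] {n : ℕ}
    {h2 : (2 : F) ≠ 0} {B : LinearMap.BilinForm F M} {hB : IsInnerProduct B} {χ : AddChar F ℂ}
    {g g' : isometryGroup (sympForm n B)} {T T' : Module.End ℂ (Schrodinger n M)}
    (hT : Intertwines h2 hB χ g T) (hT' : Intertwines h2 hB χ g' T') :
    Intertwines h2 hB χ (g * g') (T * T') := by
  intro h
  rw [mul_assoc, hT' h, ← mul_assoc, hT, mul_assoc]
  rfl

/-- A non-zero subspace invariant under the Heisenberg group is everything. -/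
theorem heisenbergRep_eq_top {F M : Type*} [Field F] [AddCommGroup M] [Module F M]
    [Fintype M] {n : ℕ} (h2 : (2 : F) ≠ 0) {B : LinearMap.BilinForm F M} (hB : IsInnerProduct B)
    {χ : AddChar F ℂ} (hχ : χ ≠ 1) (K : Submodule ℂ (Schrodinger n M))
    (hK : ∀ h, ∀ f ∈ K, heisenbergRep n h2 hB χ h f ∈ K) (hne : K ≠ ⊥) : K = ⊤ := by
  classical
  obtain ⟨f, hf, hf0⟩ := K.ne_bot_iff.mp hne
  obtain ⟨y₀, hy₀⟩ := Function.ne_iff.mp hf0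
  -- the sum of the character over the multiplication operators
  have hsum : ∀ z : Fin n → M, z ≠ 0 → ∑ x : Fin n → M, χ (∑ i, B (x i) (z i)) = 0 := by
    intro z hz
    let L : (Fin n → M) →+ F :=
      { toFun := fun x => ∑ i, B (x i) (z i)
        map_zero' := by simp
        map_add' := fun x x' => by simp [Finset.sum_add_distrib] }
    have hne1 : χ.compAddMonoidHom L ≠ 0 := by
      intro h1
      apply hχ
      obtain ⟨i, hi⟩ := Function.ne_iff.mp hz
      have : ∃ m, B (z i) m ≠ 0 := by
        by_contra hcon
        push Not at hcon
        exact hi (hB.nondeg _ hcon)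
      obtain ⟨m, hm⟩ := this
      ext t
      have h3 := DFunLike.congr_fun h1 (Pi.single i ((t / B (z i) m) • m))
      have h4 : L (Pi.single i ((t / B (z i) m) • m)) = t := by
        change ∑ j, B ((Pi.single i ((t / B (z i) m) • m) : Fin n → M) j) (z j) = t
        rw [Finset.sum_eq_single i]
        · rw [Pi.single_eq_same, hB.symm, map_smul, smul_eq_mul, div_mul_cancel₀ _ hm]
        · intro j _ hj
          rw [Pi.single_eq_of_ne hj]; simp
        · simp
      rw [AddChar.compAddMonoidHom_apply, h4] at h3
      simpa using h3
    exact AddChar.sum_eq_zero_iff_ne_zero.mpr hne1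
  have hδ : ∀ y : Fin n → M, (Pi.single y 1 : Schrodinger n M) ∈ K := by
    -- first the point `y₀`
    have h0 : (Pi.single y₀ 1 : Schrodinger n M) ∈ K := by
      have hmem : (∑ x : Fin n → M, heisenbergRep n h2 hB χ
          ⟨Sum.elim x 0, -∑ i, B (x i) (y₀ i)⟩ f) ∈ K := Submodule.sum_mem _ fun x _ => hK _ _ hf
      have heq : (∑ x : Fin n → M, heisenbergRep n h2 hB χ
          ⟨Sum.elim x 0, -∑ i, B (x i) (y₀ i)⟩ f) =
          ((Fintype.card (Fin n → M) : ℂ) * f y₀) • (Pi.single y₀ 1 : Schrodinger n M) := by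
        funext y
        rw [Finset.sum_apply]
        simp only [heisenbergRep_apply, Sum.elim_inl, Sum.elim_inr, Pi.zero_apply, map_zero,
          Finset.sum_const_zero, mul_zero, sub_zero, Pi.smul_apply, smul_eq_mul]
        rw [← Finset.sum_mul]
        have e : ∀ x : Fin n → M, -∑ i, B (x i) (y₀ i) + ∑ i, B (x i) (y i) =
            ∑ i, B (x i) ((y - y₀) i) := by
          intro x
          simp only [Pi.sub_apply, map_sub, Finset.sum_sub_distrib]
          ring
        simp only [e]
        by_cases hy : y = y₀
        · subst hy
          simp
        · rw [hsum _ (sub_ne_zero.mpr hy), Pi.single_eq_of_ne hy]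
          simp
      rw [heq] at hmem
      refine (K.smul_mem_iff ?_).mp hmem
      exact mul_ne_zero (by exact_mod_cast Fintype.card_ne_zero) hy₀
    intro y
    have := hK ⟨Sum.elim 0 (y - y₀), 0⟩ _ h0
    convert this using 1
    funext y'
    simp only [heisenbergRep_apply, Sum.elim_inl, Sum.elim_inr, Pi.zero_apply, map_zero,
      LinearMap.zero_apply, Finset.sum_const_zero, mul_zero, sub_zero, add_zero,
      AddChar.map_zero_eq_one, one_mul]
    by_cases hy : y' = y
    · subst hy
      have : (fun i => y' i - (y' - y₀) i) = y₀ := by funext i; simp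
      rw [this]; simp
    · have : (fun i => y' i - (y - y₀) i) ≠ y₀ := by
        intro h
        apply hy
        funext i
        have := congrFun h i
        simp only [Pi.sub_apply] at this
        have h5 : y' i - y i = 0 := by
          have : y' i - (y i - y₀ i) - y₀ i = 0 := by rw [this, sub_self]
          rw [← this]; abel
        exact sub_eq_zero.mp h5
      rw [Pi.single_eq_of_ne hy, Pi.single_eq_of_ne this]
  rw [eq_top_iff]
  intro φ _
  rw [pi_eq_sum_univ' φ]
  refine Submodule.sum_mem _ fun y _ => K.smul_mem _ ?_
  convert hδ y using 1

theorem Intertwines.injective {F M : Type*} [Field F] [AddCommGroup M] [Module F M]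
    [Fintype M] {n : ℕ} {h2 : (2 : F) ≠ 0} {B : LinearMap.BilinForm F M} {hB : IsInnerProduct B}
    {χ : AddChar F ℂ} (hχ : χ ≠ 1) {g : isometryGroup (sympForm n B)}
    {T : Module.End ℂ (Schrodinger n M)} (hT : Intertwines h2 hB χ g T) (h0 : T ≠ 0) :
    Function.Injective T := by
  rw [← LinearMap.ker_eq_bot]
  by_contra hne
  apply h0
  rw [← LinearMap.ker_eq_top]
  refine heisenbergRep_eq_top h2 hB hχ _ (fun h f hf => ?_) hne
  rw [LinearMap.mem_ker] at hf ⊢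
  have := LinearMap.congr_fun (hT h) f
  rw [Module.End.mul_apply, Module.End.mul_apply, hf, map_zero] at this
  exact this

/-- Uniqueness up to scalars. -/
theorem Intertwines.eq_smul {F M : Type*} [Field F] [AddCommGroup M] [Module F M]
    [Fintype M] {n : ℕ} {h2 : (2 : F) ≠ 0} {B : LinearMap.BilinForm F M} {hB : IsInnerProduct B}
    {χ : AddChar F ℂ} (hχ : χ ≠ 1) {g : isometryGroup (sympForm n B)}
    {S T : Module.End ℂ (Schrodinger n M)} (hS : Intertwines h2 hB χ g S)
    (hT : Intertwines h2 hB χ g T) (h0 : T ≠ 0) : ∃ c : ℂ, S = c • T := by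
  have hu : IsUnit T :=
    (Module.End.isUnit_iff T).mpr ⟨hT.injective hχ h0,
      LinearMap.injective_iff_surjective.mp (hT.injective hχ h0)⟩
  obtain ⟨u, rfl⟩ := hu
  obtain ⟨c, hc⟩ := Module.End.exists_eigenvalue ((↑u⁻¹ : Module.End ℂ (Schrodinger n M)) * S)
  refine ⟨c, ?_⟩
  obtain ⟨f, hf, hf0⟩ := hc.exists_hasEigenvector
  by_contra hne
  have hd : Intertwines h2 hB χ g (S - c • (u : Module.End ℂ (Schrodinger n M))) := by
    intro h
    rw [sub_mul, mul_sub, hS h, smul_mul_assoc, hT h, mul_smul_comm]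
  have := hd.injective hχ (sub_ne_zero.mpr hne)
  apply hf0
  apply this
  rw [map_zero]
  rw [Module.End.mem_eigenspace_iff] at hf
  have h3 := congrArg (fun v => (u : Module.End ℂ (Schrodinger n M)) v) hf
  simp only [Module.End.mul_apply, map_smul] at h3
  rw [← Module.End.mul_apply, Units.mul_inv, Module.End.one_apply] at h3
  rw [LinearMap.sub_apply, h3, LinearMap.smul_apply, sub_self]

theorem trace_heisenbergRep {F M : Type*} [Field F] [AddCommGroup M] [Module F M]
    [Fintype M] {n : ℕ} (h2 : (2 : F) ≠ 0) {B : LinearMap.BilinForm F M} (hB : IsInnerProduct B)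
    {χ : AddChar F ℂ} (hχ : χ ≠ 1) (h : Heisenberg n B) (hv : h.vec ≠ 0) :
    LinearMap.trace ℂ _ (heisenbergRep n h2 hB χ h) = 0 := by
  classical
  -- a suitable element of the Heisenberg group conjugates `ρ(h)` to a multiple different from it
  have hex : ∃ w : SympSpace n M, χ (sympForm n B w h.vec) ≠ 1 := by
    obtain ⟨j, hj⟩ := Function.ne_iff.mp hv
    have : ∃ m, B (h.vec j) m ≠ 0 := by
      by_contra hcon
      push Not at hcon
      exact hj (hB.nondeg _ hcon)
    obtain ⟨m, hm⟩ := this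
    have hw : ∃ w : SympSpace n M, sympForm n B w h.vec ≠ 0 := by
      rcases j with i | i
      · refine ⟨Pi.single (Sum.inr i) m, ?_⟩
        rw [sympForm_apply, Finset.sum_eq_single i]
        · simpa [hB.symm m] using hm
        · intro k _ hk
          simp [hk]
        · simp
      · refine ⟨Pi.single (Sum.inl i) m, ?_⟩
        rw [sympForm_apply, Finset.sum_eq_single i]
        · simpa [hB.symm m] using hm
        · intro k _ hk
          simp [hk]
        · simp
    obtain ⟨w, hw⟩ := hw
    obtain ⟨t, ht⟩ : ∃ t, χ t ≠ 1 := by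
      by_contra hcon
      push Not at hcon
      exact hχ (by ext t; simpa using hcon t)
    refine ⟨(t / sympForm n B w h.vec) • w, ?_⟩
    rwa [map_smul, LinearMap.smul_apply, smul_eq_mul, div_mul_cancel₀ _ hw]
  obtain ⟨w, hw⟩ := hex
  have hconj : (⟨w, 0⟩ : Heisenberg n B) * h * ⟨w, 0⟩⁻¹ =
      ⟨h.vec, h.cen + sympForm n B w h.vec⟩ := by
    rw [mul_inv_eq_iff_eq_mul]
    have hskew : sympForm n B h.vec w = - sympForm n B w h.vec := by
      have h1 := sympForm_self n hB (h.vec + w)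
      simp only [map_add, LinearMap.add_apply, sympForm_self n hB] at h1
      linear_combination h1
    apply Heisenberg.ext
    · exact add_comm _ _
    · change 0 + h.cen + 2⁻¹ * sympForm n B w h.vec =
        h.cen + sympForm n B w h.vec + 0 + 2⁻¹ * sympForm n B h.vec w
      rw [hskew]
      field_simp
      ring
  have ht : LinearMap.trace ℂ _ (heisenbergRep n h2 hB χ
      ((⟨w, 0⟩ : Heisenberg n B) * h * ⟨w, 0⟩⁻¹)) =
      LinearMap.trace ℂ _ (heisenbergRep n h2 hB χ h) := by
    rw [map_mul, LinearMap.trace_mul_comm, ← map_mul]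
    congr 2
    group
  rw [hconj, heisenbergRep_cen, AddChar.map_add_eq_mul, mul_comm, mul_smul, map_smul,
    ← heisenbergRep_cen, smul_eq_mul] at ht
  have h3 : (χ (sympForm n B w h.vec) - 1) *
      LinearMap.trace ℂ _ (heisenbergRep n h2 hB χ h) = 0 := by
    linear_combination ht
  exact (mul_eq_zero.mp h3).resolve_left (sub_ne_zero.mpr hw)

theorem intertwiner_ne_zero {F M : Type*} [Field F] [AddCommGroup M] [Module F M] [Fintype M]
    {n : ℕ} (h2 : (2 : F) ≠ 0) {B : LinearMap.BilinForm F M} (hB : IsInnerProduct B)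
    {χ : AddChar F ℂ} (hχ : χ ≠ 1) (g : isometryGroup (sympForm n B)) :
    intertwiner h2 hB χ g ≠ 0 := by
  classical
  intro h0
  have htr : LinearMap.trace ℂ _ (intertwiner h2 hB χ g) =
      ∑ w : SympSpace n M, if g.1 w = w then (Fintype.card (Fin n → M) : ℂ) else 0 := by
    unfold intertwiner
    rw [map_sum]
    refine Finset.sum_congr rfl fun w _ => ?_
    rw [← map_mul]
    split_ifs with hw
    · have : Heisenberg.act g ⟨w, 0⟩ = (⟨w, 0⟩ : Heisenberg n B) := by
        apply Heisenberg.ext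
        · exact hw
        · rfl
      rw [this, mul_inv_cancel, map_one, LinearMap.trace_one, Module.finrank_fintype_fun_eq_card]
    · refine trace_heisenbergRep h2 hB hχ _ fun h => hw ?_
      have h' : g.1 w + -w = 0 := h
      exact (add_neg_eq_zero.mp h')
  rw [h0, map_zero] at htr
  rw [← Finset.sum_filter, Finset.sum_const, nsmul_eq_mul] at htr
  have h1 := htr.symm
  rcases mul_eq_zero.mp h1 with h | h
  · rw [Nat.cast_eq_zero, Finset.card_eq_zero] at h
    have : (0 : SympSpace n M) ∈ Finset.univ.filter fun w => g.1 w = w := by simp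
    rw [h] at this
    simp at this
  · exact Fintype.card_ne_zero (Nat.cast_eq_zero.mp h)

/-- The even functions of the Schrödinger model. -/
def evenFunctions (n : ℕ) (M : Type*) [AddCommGroup M] : Submodule ℂ (Schrodinger n M) where
  carrier := {f | ∀ y, f (-y) = f y}
  zero_mem' := fun _ => rfl
  add_mem' := fun hf hg y => by rw [Pi.add_apply, Pi.add_apply, hf, hg]
  smul_mem' := fun c f hf y => by rw [Pi.smul_apply, Pi.smul_apply, hf]

/-- The odd functions of the Schrödinger model. -/
def oddFunctions (n : ℕ) (M : Type*) [AddCommGroup M] : Submodule ℂ (Schrodinger n M) where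
  carrier := {f | ∀ y, f (-y) = -f y}
  zero_mem' := fun _ => by simp
  add_mem' := fun hf hg y => by rw [Pi.add_apply, Pi.add_apply, hf, hg, neg_add]
  smul_mem' := fun c f hf y => by rw [Pi.smul_apply, Pi.smul_apply, hf, smul_neg]

/-- The operator `f ↦ (y ↦ f (-y))`. -/
def parityOp (n : ℕ) (M : Type*) [AddCommGroup M] : Module.End ℂ (Schrodinger n M) where
  toFun f := fun y => f (-y)
  map_add' _ _ := rfl
  map_smul' _ _ := rfl

theorem mem_even_iff {n : ℕ} {M : Type*} [AddCommGroup M] {f : Schrodinger n M} :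
    f ∈ evenFunctions n M ↔ parityOp n M f = f :=
  ⟨fun h => funext h, fun h y => congrFun h y⟩

theorem mem_odd_iff {n : ℕ} {M : Type*} [AddCommGroup M] {f : Schrodinger n M} :
    f ∈ oddFunctions n M ↔ parityOp n M f = -f :=
  ⟨fun h => funext h, fun h y => congrFun h y⟩

theorem map_even {n : ℕ} {M : Type*} [AddCommGroup M] {T : Module.End ℂ (Schrodinger n M)}
    (hT : Commute T (parityOp n M)) : ∀ f ∈ evenFunctions n M, T f ∈ evenFunctions n M := by
  intro f hf
  rw [mem_even_iff] at hf ⊢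
  rw [← Module.End.mul_apply, ← hT.eq, Module.End.mul_apply, hf]

theorem map_odd {n : ℕ} {M : Type*} [AddCommGroup M] {T : Module.End ℂ (Schrodinger n M)}
    (hT : Commute T (parityOp n M)) : ∀ f ∈ oddFunctions n M, T f ∈ oddFunctions n M := by
  intro f hf
  rw [mem_odd_iff] at hf ⊢
  rw [← Module.End.mul_apply, ← hT.eq, Module.End.mul_apply, hf, map_neg]

/-- `det (T | even functions) / det (T | odd functions)`, for `T` preserving parity. -/
def detRatio {n : ℕ} {M : Type*} [AddCommGroup M] (T : Module.End ℂ (Schrodinger n M))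
    (hT : Commute T (parityOp n M)) : ℂ :=
  LinearMap.det (T.restrict (map_even hT)) / LinearMap.det (T.restrict (map_odd hT))

theorem detRatio_mul {n : ℕ} {M : Type*} [AddCommGroup M] {S T : Module.End ℂ (Schrodinger n M)}
    (hS : Commute S (parityOp n M)) (hT : Commute T (parityOp n M)) :
    detRatio (S * T) (hS.mul_left hT) = detRatio S hS * detRatio T hT := by
  unfold detRatio
  rw [div_mul_div_comm, ← map_mul, ← map_mul]
  rfl

theorem finrank_even {F M : Type*} [Field F] [AddCommGroup M] [Module F M] [Fintype M] (n : ℕ)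
    (h2 : (2 : F) ≠ 0) :
    Module.finrank ℂ (evenFunctions n M) = Module.finrank ℂ (oddFunctions n M) + 1 := by
  classical
  have hPP : ∀ f, parityOp n M (parityOp n M f) = f := fun f => funext fun y => by
    simp [parityOp]
  have he : LinearMap.IsProj (evenFunctions n M) ((2⁻¹ : ℂ) • (1 + parityOp n M)) := by
    constructor
    · intro f
      rw [mem_even_iff]
      simp only [LinearMap.smul_apply, LinearMap.add_apply, Module.End.one_apply, map_smul,
        map_add, hPP]
      rw [add_comm]
    · intro f hf
      rw [mem_even_iff] at hf
      simp only [LinearMap.smul_apply, LinearMap.add_apply, Module.End.one_apply, hf]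
      rw [← two_smul ℂ f, smul_smul]
      norm_num
  have ho : LinearMap.IsProj (oddFunctions n M) ((2⁻¹ : ℂ) • (1 - parityOp n M)) := by
    constructor
    · intro f
      rw [mem_odd_iff]
      simp only [LinearMap.smul_apply, LinearMap.sub_apply, Module.End.one_apply, map_smul,
        map_sub, hPP]
      rw [← smul_neg, neg_sub]
    · intro f hf
      rw [mem_odd_iff] at hf
      simp only [LinearMap.smul_apply, LinearMap.sub_apply, Module.End.one_apply, hf]
      rw [sub_neg_eq_add, ← two_smul ℂ f, smul_smul]
      norm_num
  have hP : LinearMap.trace ℂ _ (parityOp n M) = 1 := by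
    rw [LinearMap.trace_eq_matrix_trace ℂ (Pi.basisFun ℂ (Fin n → M)), Matrix.trace]
    rw [Finset.sum_eq_single 0]
    · simp [parityOp]
    · intro y _ hy
      have : -y ≠ y := by
        intro h
        apply hy
        funext i
        have h3 := congrFun h i
        have h4 : (2 : F) • y i = 0 := by
          rw [two_smul]
          nth_rewrite 1 [← h3]
          simp
        exact (smul_eq_zero.mp h4).resolve_left h2
      simp [parityOp, this]
    · simp
  have e1 := he.trace
  have e2 := ho.trace
  rw [map_smul, map_add, hP] at e1
  rw [map_smul, map_sub, hP] at e2
  simp only [smul_eq_mul] at e1 e2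
  have : (Module.finrank ℂ (evenFunctions n M) : ℂ) = Module.finrank ℂ (oddFunctions n M) + 1 := by
    rw [← e1, ← e2]; ring
  exact_mod_cast this

theorem detRatio_smul {F M : Type*} [Field F] [AddCommGroup M] [Module F M] [Fintype M] {n : ℕ}
    (h2 : (2 : F) ≠ 0) {T : Module.End ℂ (Schrodinger n M)} (hT : Commute T (parityOp n M))
    {c : ℂ} (hc : c ≠ 0) : detRatio (c • T) (hT.smul_left c) = c * detRatio T hT := by
  unfold detRatio
  have e1 : (c • T).restrict (map_even (hT.smul_left c)) = c • T.restrict (map_even hT) := rfl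
  have e2 : (c • T).restrict (map_odd (hT.smul_left c)) = c • T.restrict (map_odd hT) := rfl
  rw [e1, e2, LinearMap.det_smul, LinearMap.det_smul, finrank_even n h2, pow_succ']
  have := pow_ne_zero (Module.finrank ℂ (oddFunctions n M)) hc
  rw [mul_assoc, mul_div_assoc, mul_div_mul_left _ _ this]

theorem intertwiner_parity {F M : Type*} [Field F] [AddCommGroup M] [Module F M] [Fintype M]
    {n : ℕ} (h2 : (2 : F) ≠ 0) {B : LinearMap.BilinForm F M} (hB : IsInnerProduct B)
    (χ : AddChar F ℂ) (g : isometryGroup (sympForm n B)) :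
    Commute (intertwiner h2 hB χ g) (parityOp n M) := by
  have hρ : ∀ h : Heisenberg n B, heisenbergRep n h2 hB χ h * parityOp n M =
      parityOp n M * heisenbergRep n h2 hB χ ⟨-h.vec, h.cen⟩ := by
    intro h
    refine LinearMap.ext fun f => funext fun y => ?_
    change heisenbergRep n h2 hB χ h (parityOp n M f) y =
      heisenbergRep n h2 hB χ ⟨-h.vec, h.cen⟩ f (-y)
    rw [heisenbergRep_apply, heisenbergRep_apply]
    have : -(fun i => y i - h.vec (Sum.inr i)) = fun i => (-y) i - (-h.vec) (Sum.inr i) := by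
      funext i; simp; abel
    change _ * f (-_) = _
    rw [this]
    simp
  have hinv : ∀ h : Heisenberg n B, (⟨-h⁻¹.vec, h⁻¹.cen⟩ : Heisenberg n B) = ⟨-h.vec, h.cen⟩⁻¹ := by
    intro h
    apply Heisenberg.ext
    · rfl
    · change -h.cen + 2⁻¹ * sympForm n B h.vec h.vec =
        -h.cen + 2⁻¹ * sympForm n B (-h.vec) (-h.vec)
      simp
  change _ * _ = _ * _
  unfold intertwiner
  rw [Finset.sum_mul, Finset.mul_sum]
  refine Fintype.sum_equiv (Equiv.neg _) _ _ fun w => ?_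
  rw [mul_assoc, hρ, ← mul_assoc, hρ, mul_assoc, hinv]
  congr 2
  change heisenbergRep n h2 hB χ ⟨-(g.1 w), 0⟩ = heisenbergRep n h2 hB χ ⟨g.1 (-w), 0⟩
  rw [map_neg]

/-- The oscillator representation `ω` of `Sp(W)` in the Schrödinger model. -/
def oscillatorRep {F M : Type*} [Field F] [AddCommGroup M] [Module F M] [Fintype M] (n : ℕ)
    (h2 : (2 : F) ≠ 0) {B : LinearMap.BilinForm F M} (hB : IsInnerProduct B)
    {χ : AddChar F ℂ} (hχ : χ ≠ 1) :
    Representation ℂ (isometryGroup (sympForm n B)) (Schrodinger n M) where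
  toFun g := (detRatio (intertwiner h2 hB χ g) (intertwiner_parity h2 hB χ g))⁻¹ •
    intertwiner h2 hB χ g
  map_one' := by
    have h1 : Intertwines (n := n) h2 hB χ 1 1 := fun h => by
      rw [one_mul, mul_one]; rfl
    have h0 := intertwiner_ne_zero (n := n) h2 hB hχ 1
    obtain ⟨c, hc⟩ := (intertwiner_intertwines h2 hB χ 1).eq_smul hχ h1 one_ne_zero
    have hc0 : c ≠ 0 := by
      rintro rfl
      exact h0 (by rw [hc, zero_smul])
    have hd : detRatio (intertwiner (n := n) h2 hB χ 1) (intertwiner_parity h2 hB χ 1) = c := by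
      have e := detRatio_smul h2 (Commute.one_left (parityOp n M)) hc0
      simp only [hc]
      rw [e]
      have e1 : detRatio (1 : Module.End ℂ (Schrodinger n M))
          (Commute.one_left (parityOp n M)) = 1 := by
        unfold detRatio
        have a1 : (1 : Module.End ℂ (Schrodinger n M)).restrict
          (map_even (Commute.one_left (parityOp n M))) = 1 := rfl
        have a2 : (1 : Module.End ℂ (Schrodinger n M)).restrict
          (map_odd (Commute.one_left (parityOp n M))) = 1 := rfl
        rw [a1, a2, map_one, map_one, div_one]
      rw [e1, mul_one]
    rw [hd, hc, smul_smul, inv_mul_cancel₀ hc0, one_smul]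
  map_mul' g g' := by
    have hm := (intertwiner_intertwines h2 hB χ g).mul (intertwiner_intertwines h2 hB χ g')
    obtain ⟨c, hc⟩ := hm.eq_smul hχ (intertwiner_intertwines h2 hB χ (g * g'))
      (intertwiner_ne_zero h2 hB hχ _)
    have hc0 : c ≠ 0 := by
      rintro rfl
      rw [zero_smul] at hc
      obtain ⟨f, hf⟩ := exists_ne (0 : Schrodinger n M)
      have i1 := (intertwiner_intertwines h2 hB χ g).injective hχ (intertwiner_ne_zero h2 hB hχ _)
      have i2 := (intertwiner_intertwines h2 hB χ g').injective hχ (intertwiner_ne_zero h2 hB hχ _)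
      apply hf
      apply i2
      apply i1
      rw [map_zero, map_zero]
      exact LinearMap.congr_fun hc f
    have hd := detRatio_mul (intertwiner_parity h2 hB χ g) (intertwiner_parity h2 hB χ g')
    have he := detRatio_smul h2 (intertwiner_parity h2 hB χ (g * g')) hc0
    simp only [hc] at hd
    rw [he] at hd
    rw [smul_mul_smul_comm, hc, ← mul_inv, ← hd, smul_smul, mul_inv, mul_comm c⁻¹, mul_assoc,
      inv_mul_cancel₀ hc0, mul_one]

/-- The defining property `ω(g) ρ(h) = ρ(g h) ω(g)` of the oscillator representation. -/
theorem oscillatorRep_intertwines {F M : Type*} [Field F] [AddCommGroup M] [Module F M]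
    [Fintype M] (n : ℕ) (h2 : (2 : F) ≠ 0) {B : LinearMap.BilinForm F M} (hB : IsInnerProduct B)
    {χ : AddChar F ℂ} (hχ : χ ≠ 1) (g : isometryGroup (sympForm n B)) :
    Intertwines h2 hB χ g (oscillatorRep n h2 hB hχ g) := by
  intro h
  change ((detRatio (intertwiner h2 hB χ g) (intertwiner_parity h2 hB χ g))⁻¹ •
    intertwiner h2 hB χ g) * _ = _ * ((detRatio (intertwiner h2 hB χ g)
    (intertwiner_parity h2 hB χ g))⁻¹ • intertwiner h2 hB χ g)
  rw [smul_mul_assoc, mul_smul_comm, intertwiner_intertwines h2 hB χ g h]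

/-! ### The dual pair `(Sp_{2n}, O(V'))` in `Sp(V ⊗ V')` -/

/-- A matrix acts on `W = V ⊗ V'` through its action on `V = F ^ (2n)`. -/
def matrixAct {F M : Type*} [Field F] [AddCommGroup M] [Module F M] {n : ℕ}
    (A : Matrix (Fin n ⊕ Fin n) (Fin n ⊕ Fin n) F) : SympSpace n M →ₗ[F] SympSpace n M where
  toFun w := fun i => ∑ j, A i j • w j
  map_add' w w' := by funext i; simp [Finset.sum_add_distrib]
  map_smul' c w := by funext i; simp [Finset.smul_sum, smul_comm c]

theorem matrixAct_apply {F M : Type*} [Field F] [AddCommGroup M] [Module F M] {n : ℕ}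
    (A : Matrix (Fin n ⊕ Fin n) (Fin n ⊕ Fin n) F) (w : SympSpace n M) (i : Fin n ⊕ Fin n) :
    matrixAct A w i = ∑ j, A i j • w j := rfl

theorem matrixAct_one {F M : Type*} [Field F] [AddCommGroup M] [Module F M] {n : ℕ} :
    matrixAct (M := M) (1 : Matrix (Fin n ⊕ Fin n) (Fin n ⊕ Fin n) F) = LinearMap.id := by
  refine LinearMap.ext fun w => funext fun i => ?_
  simp [matrixAct_apply, Matrix.one_apply]

theorem matrixAct_mul {F M : Type*} [Field F] [AddCommGroup M] [Module F M] {n : ℕ}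
    (A A' : Matrix (Fin n ⊕ Fin n) (Fin n ⊕ Fin n) F) :
    matrixAct (M := M) (A * A') = matrixAct A ∘ₗ matrixAct A' := by
  refine LinearMap.ext fun w => funext fun i => ?_
  simp only [LinearMap.comp_apply, matrixAct_apply, Matrix.mul_apply, Finset.sum_smul,
    Finset.smul_sum, mul_smul]
  exact Finset.sum_comm

theorem sympForm_eq_J {F M : Type*} [Field F] [AddCommGroup M] [Module F M] {n : ℕ}
    (B : LinearMap.BilinForm F M) (w w' : SympSpace n M) :
    sympForm n B w w' = -∑ i, ∑ j, Matrix.J (Fin n) F i j * B (w i) (w' j) := by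
  simp [sympForm_apply, Matrix.J, Matrix.fromBlocks, Matrix.one_apply, Finset.sum_add_distrib]
  ring

theorem sympForm_matrixAct {F M : Type*} [Field F] [AddCommGroup M] [Module F M] {n : ℕ}
    (B : LinearMap.BilinForm F M) (A : Matrix.symplecticGroup (Fin n) F) (w w' : SympSpace n M) :
    sympForm n B (matrixAct A.1 w) (matrixAct A.1 w') = sympForm n B w w' := by
  have hA := SymplecticGroup.mem_iff'.mp A.2
  rw [sympForm_eq_J, sympForm_eq_J, neg_inj]
  conv_rhs => rw [← hA]
  simp only [matrixAct_apply, map_sum, map_smul, LinearMap.sum_apply, LinearMap.smul_apply,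
    smul_eq_mul, Matrix.mul_apply, Matrix.transpose_apply, Finset.mul_sum, Finset.sum_mul]
  calc _ = ∑ i, ∑ j, ∑ k, ∑ l, A.1 i k * Matrix.J (Fin n) F i j * A.1 j l * B (w k) (w' l) := by
        refine Finset.sum_congr rfl fun i _ => Finset.sum_congr rfl fun j _ => ?_
        rw [Finset.sum_comm]
        refine Finset.sum_congr rfl fun k _ => Finset.sum_congr rfl fun l _ => ?_
        ring
    _ = ∑ i, ∑ k, ∑ l, ∑ j, A.1 i k * Matrix.J (Fin n) F i j * A.1 j l * B (w k) (w' l) := by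
        refine Finset.sum_congr rfl fun i _ => ?_
        rw [Finset.sum_comm]
        exact Finset.sum_congr rfl fun k _ => Finset.sum_comm
    _ = ∑ k, ∑ l, ∑ i, ∑ j, A.1 i k * Matrix.J (Fin n) F i j * A.1 j l * B (w k) (w' l) := by
        rw [Finset.sum_comm]
        exact Finset.sum_congr rfl fun k _ => Finset.sum_comm
    _ = _ := by
        refine Finset.sum_congr rfl fun k _ => Finset.sum_congr rfl fun l _ => ?_
        exact Finset.sum_comm

/-- The embedding `Sp_{2n} → Sp(W)`, `g ↦ g ⊗ 1`. -/
def spEmb {F M : Type*} [Field F] [AddCommGroup M] [Module F M] (n : ℕ)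
    (B : LinearMap.BilinForm F M) :
    Matrix.symplecticGroup (Fin n) F →* isometryGroup (sympForm n B) where
  toFun A := ⟨LinearEquiv.ofLinearMap (matrixAct A.1) (matrixAct (A⁻¹).1)
      (by rw [← matrixAct_mul, ← Submonoid.coe_mul, mul_inv_cancel]; exact matrixAct_one)
      (by rw [← matrixAct_mul, ← Submonoid.coe_mul, inv_mul_cancel]; exact matrixAct_one),
    sympForm_matrixAct B A⟩
  map_one' := by
    apply Subtype.ext
    refine LinearEquiv.ext fun w => ?_
    exact LinearMap.congr_fun matrixAct_one w
  map_mul' A A' := by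
    apply Subtype.ext
    refine LinearEquiv.ext fun w => ?_
    exact LinearMap.congr_fun (matrixAct_mul A.1 A'.1) w

/-- The embedding `O(V') → Sp(W)`, `g' ↦ 1 ⊗ g'`. -/
def orthEmb {F M : Type*} [Field F] [AddCommGroup M] [Module F M] (n : ℕ)
    (B : LinearMap.BilinForm F M) : isometryGroup B →* isometryGroup (sympForm n B) where
  toFun g' := ⟨LinearEquiv.piCongrRight fun _ => g'.1, fun w w' => by
    rw [sympForm_apply, sympForm_apply]
    refine Finset.sum_congr rfl fun i _ => ?_
    simp only [LinearEquiv.piCongrRight_apply]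
    rw [g'.2, g'.2]⟩
  map_one' := rfl
  map_mul' _ _ := rfl

theorem spEmb_commute {F M : Type*} [Field F] [AddCommGroup M] [Module F M] (n : ℕ)
    (B : LinearMap.BilinForm F M) (A : Matrix.symplecticGroup (Fin n) F) (g' : isometryGroup B) :
    Commute (spEmb n B A) (orthEmb n B g') := by
  apply Subtype.ext
  refine LinearEquiv.ext fun w => funext fun i => ?_
  change ∑ j, A.1 i j • g'.1 (w j) = g'.1 (∑ j, A.1 i j • w j)
  simp

/-- The oscillator representation restricted to `Sp_{2n} × O(V')`. -/
def dualPairRep {F M : Type*} [Field F] [AddCommGroup M] [Module F M] [Fintype M] (n : ℕ)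
    (h2 : (2 : F) ≠ 0) {B : LinearMap.BilinForm F M} (hB : IsInnerProduct B)
    {χ : AddChar F ℂ} (hχ : χ ≠ 1) :
    Representation ℂ (Matrix.symplecticGroup (Fin n) F × isometryGroup B) (Schrodinger n M) :=
  (oscillatorRep n h2 hB hχ).comp
    ((spEmb n B).noncommCoprod (orthEmb n B) (spEmb_commute n B))

/-- The oscillator representation restricted to `Sp_{2n}`. -/
def spRep {F M : Type*} [Field F] [AddCommGroup M] [Module F M] [Fintype M] (n : ℕ)
    (h2 : (2 : F) ≠ 0) {B : LinearMap.BilinForm F M} (hB : IsInnerProduct B)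
    {χ : AddChar F ℂ} (hχ : χ ≠ 1) :
    Representation ℂ (Matrix.symplecticGroup (Fin n) F) (Schrodinger n M) :=
  (oscillatorRep n h2 hB hχ).comp (spEmb n B)

/-! ### Irreducible representations, isotypic components -/

/-- An irreducible complex representation of `G` on some `ℂ ^ dim`. -/
structure IrrepOf (G : Type*) [Group G] where
  dim : ℕ
  rep : Representation ℂ G (Fin dim → ℂ)
  irred : rep.IsIrreducible

/-- Equivalence of irreducible representations. -/
instance IrrepOf.instSetoid (G : Type*) [Group G] : Setoid (IrrepOf G) where
  r σ τ := Nonempty (σ.rep.Equiv τ.rep)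
  iseqv := ⟨fun _ => ⟨.refl _⟩, fun ⟨e⟩ => ⟨e.symm⟩, fun ⟨e⟩ ⟨e'⟩ => ⟨e.trans e'⟩⟩

/-- The dual `Ĝ` of a finite group: the set of equivalence classes of irreducible complex
representations. -/
def GroupDual (G : Type*) [Group G] : Type _ := Quotient (IrrepOf.instSetoid G)

/-- The class of an irreducible representation in `Ĝ`. -/
def IrrepOf.cls {G : Type*} [Group G] (σ : IrrepOf G) : GroupDual G :=
  Quotient.mk (IrrepOf.instSetoid G) σ

/-- `σ` appears in `ρ` with non-zero multiplicity. -/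
def AppearsIn {G E : Type*} [Group G] [AddCommGroup E] [Module ℂ E] (σ : IrrepOf G)
    (ρ : Representation ℂ G E) : Prop :=
  ∃ N : Subrepresentation ρ, Nonempty (N.toRepresentation.Equiv σ.rep)

/-- The isotypic component of `σ` in `ρ`: the sum of all subrepresentations equivalent to `σ`. -/
def isotypicPart {G E : Type*} [Group G] [AddCommGroup E] [Module ℂ E]
    (ρ : Representation ℂ G E) (σ : IrrepOf G) : Submodule ℂ E :=
  sSup {K | ∃ N : Subrepresentation ρ,
    N.toSubmodule = K ∧ Nonempty (N.toRepresentation.Equiv σ.rep)}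

/-- The set of classes in `Ĝ` that appear in `ρ`. -/
def spectrumOf {G E : Type*} [Group G] [AddCommGroup E] [Module ℂ E]
    (ρ : Representation ℂ G E) : Set (GroupDual G) :=
  {π | ∃ σ : IrrepOf G, σ.cls = π ∧ AppearsIn σ ρ}

/-- The sum of the isotypic components of `ρ` for the classes in `S`. -/
def isotypicSum {G E : Type*} [Group G] [AddCommGroup E] [Module ℂ E]
    (ρ : Representation ℂ G E) (S : Set (GroupDual G)) : Submodule ℂ E :=
  ⨆ σ : IrrepOf G, ⨆ _ : σ.cls ∈ S, isotypicPart ρ σ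

/-- An invertible operator commuting with `G` preserves the sums of isotypic components. -/
theorem isotypicSum_invariant {G E : Type*} [Group G] [AddCommGroup E] [Module ℂ E]
    (ρ : Representation ℂ G E) (S : Set (GroupDual G)) (T : E ≃ₗ[ℂ] E)
    (hT : ∀ g v, T (ρ g v) = ρ g (T v)) :
    ∀ v ∈ isotypicSum ρ S, T v ∈ isotypicSum ρ S := by
  suffices h : isotypicSum ρ S ≤ (isotypicSum ρ S).comap T.toLinearMap from fun v hv => h hv
  refine iSup₂_le fun σ hσ => sSup_le ?_
  rintro _ ⟨N, rfl, ⟨e⟩⟩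
  have hinv : ∀ g, ∀ v ∈ N.toSubmodule.map T.toLinearMap,
      ρ g v ∈ N.toSubmodule.map T.toLinearMap := by
    rintro g _ ⟨v, hv, rfl⟩
    exact ⟨ρ g v, N.apply_mem_toSubmodule g hv, hT g v⟩
  let N' : Subrepresentation ρ := ⟨N.toSubmodule.map T.toLinearMap, fun g v hv => hinv g v hv⟩
  let e' : N.toRepresentation.Equiv N'.toRepresentation :=
    Representation.Equiv.mk (T.submoduleMap N.toSubmodule) fun g => by
      refine LinearMap.ext fun v => Subtype.ext ?_
      exact hT g v.1
  have hp : N'.toSubmodule ≤ isotypicPart ρ σ := le_sSup ⟨N', rfl, ⟨e'.symm.trans e⟩⟩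
  have hle : N'.toSubmodule ≤ isotypicSum ρ S :=
    le_trans hp
      (le_iSup₂ (f := fun (σ : IrrepOf G) (_ : σ.cls ∈ S) => isotypicPart ρ σ) σ hσ)
  intro v hv
  exact hle ⟨v, hv, rfl⟩

/-- Sums of isotypic components are invariant under `G`. -/
theorem isotypicSum_apply_mem {G E : Type*} [Group G] [AddCommGroup E] [Module ℂ E]
    (ρ : Representation ℂ G E) (S : Set (GroupDual G)) (g : G) :
    ∀ v ∈ isotypicSum ρ S, ρ g v ∈ isotypicSum ρ S := by
  suffices h : isotypicSum ρ S ≤ (isotypicSum ρ S).comap (ρ g) from fun v hv => h hv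
  refine iSup₂_le fun σ hσ => sSup_le ?_
  rintro _ ⟨N, rfl, e⟩
  intro v hv
  have hp : N.toSubmodule ≤ isotypicPart ρ σ := le_sSup ⟨N, rfl, e⟩
  exact (le_trans hp
      (le_iSup₂ (f := fun (σ : IrrepOf G) (_ : σ.cls ∈ S) => isotypicPart ρ σ) σ hσ))
    (N.apply_mem_toSubmodule g hv)

/-- For a representation `ω` of a group `K` and commuting homomorphisms `i : G → K`, `j : G' → K`,
the sum of the `G`-isotypic components for the classes in `S`, as a subrepresentation for
`G × G'`. -/
def isotypicSub {K G G' E : Type*} [Group K] [Group G] [Group G'] [AddCommGroup E] [Module ℂ E]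
    (ω : Representation ℂ K E) (i : G →* K) (j : G' →* K) (hij : ∀ g g', Commute (i g) (j g'))
    (S : Set (GroupDual G)) : Subrepresentation (ω.comp (i.noncommCoprod j hij)) where
  toSubmodule := isotypicSum (ω.comp i) S
  apply_mem_toSubmodule p v hv := by
    obtain ⟨g, g'⟩ := p
    have hd : (ω.comp (i.noncommCoprod j hij)) (g, g') v = (ω.comp i) g (ω (j g') v) := by
      change ω (i g * j g') v = ω (i g) (ω (j g') v)
      rw [map_mul, Module.End.mul_apply]
    rw [hd]
    apply isotypicSum_apply_mem
    let T : E ≃ₗ[ℂ] E := LinearEquiv.ofLinearMap (ω (j g')) (ω (j g')⁻¹)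
      (by rw [← Module.End.mul_eq_comp, ← map_mul, mul_inv_cancel, map_one]; rfl)
      (by rw [← Module.End.mul_eq_comp, ← map_mul, inv_mul_cancel, map_one]; rfl)
    refine isotypicSum_invariant _ _ T (fun k u => ?_) v hv
    change ω (j g') (ω (i k) u) = ω (i k) (ω (j g') u)
    rw [← Module.End.mul_apply, ← Module.End.mul_apply, ← map_mul, ← map_mul, (hij k g').eq]

/-- The representation `σ ⊠ τ` of `G × G'`. -/
def outerTensor {G G' : Type*} [Group G] [Group G'] (σ : IrrepOf G) (τ : IrrepOf G') :
    Representation ℂ (G × G') (TensorProduct ℂ (Fin σ.dim → ℂ) (Fin τ.dim → ℂ)) :=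
  Representation.tprod (σ.rep.comp (MonoidHom.fst G G')) (τ.rep.comp (MonoidHom.snd G G'))

/-! ### Witt towers, old and new spectrum -/

/-- The orthogonal direct sum of the form `a` and `ℓ` hyperbolic planes. -/
def towerForm {F A : Type*} [Field F] [AddCommGroup A] [Module F A]
    (a : LinearMap.BilinForm F A) (ℓ : ℕ) : LinearMap.BilinForm F (A × (Fin ℓ → F × F)) :=
  LinearMap.mk₂ F (fun u v => a u.1 v.1 +
      ∑ i, ((u.2 i).1 * (v.2 i).2 + (u.2 i).2 * (v.2 i).1))
    (fun u u' v => by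
      simp only [Prod.fst_add, Prod.snd_add, Pi.add_apply, map_add, LinearMap.add_apply, add_mul,
        Finset.sum_add_distrib]
      ring)
    (fun c u v => by
      simp only [Prod.smul_fst, Prod.smul_snd, Pi.smul_apply, map_smul, LinearMap.smul_apply,
        smul_eq_mul, mul_assoc, Finset.sum_add_distrib, mul_add, Finset.mul_sum])
    (fun u v v' => by
      simp only [Prod.fst_add, Prod.snd_add, Pi.add_apply, map_add, mul_add,
        Finset.sum_add_distrib]
      ring)
    (fun c u v => by
      simp only [Prod.smul_fst, Prod.smul_snd, Pi.smul_apply, map_smul,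
        smul_eq_mul, mul_left_comm _ c, Finset.sum_add_distrib, mul_add, Finset.mul_sum])

theorem towerForm_apply {F A : Type*} [Field F] [AddCommGroup A] [Module F A]
    (a : LinearMap.BilinForm F A) (ℓ : ℕ) (u v : A × (Fin ℓ → F × F)) :
    towerForm a ℓ u v = a u.1 v.1 +
      ∑ i, ((u.2 i).1 * (v.2 i).2 + (u.2 i).2 * (v.2 i).1) := rfl

/-- An anisotropic inner product: a symmetric bilinear form without non-zero isotropic vectors. -/
structure IsAnisotropicForm {F A : Type*} [Field F] [AddCommGroup A] [Module F A]
    (a : LinearMap.BilinForm F A) : Prop where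
  symm : ∀ x y, a x y = a y x
  anisotropic : ∀ x, a x x = 0 → x = 0

theorem IsAnisotropicForm.isInnerProduct_towerForm {F A : Type*} [Field F] [AddCommGroup A]
    [Module F A] {a : LinearMap.BilinForm F A} (ha : IsAnisotropicForm a) (ℓ : ℕ) :
    IsInnerProduct (towerForm a ℓ) where
  symm u v := by
    rw [towerForm_apply, towerForm_apply, ha.symm]
    congr 1
    exact Finset.sum_congr rfl fun i _ => by ring
  nondeg u hu := by
    have h1 : u.1 = 0 := by
      have := hu (u.1, 0)
      rw [towerForm_apply] at this
      exact ha.anisotropic _ (by simpa using this)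
    refine Prod.ext h1 (funext fun i => Prod.ext ?_ ?_)
    · have := hu (0, Pi.single i (0, 1))
      rw [towerForm_apply, Finset.sum_eq_single i] at this
      · simpa using this
      · intro j _ hj
        simp [Pi.single_eq_of_ne hj]
      · simp
    · have := hu (0, Pi.single i (1, 0))
      rw [towerForm_apply, Finset.sum_eq_single i] at this
      · simpa using this
      · intro j _ hj
        simp [Pi.single_eq_of_ne hj]
      · simp

/-- The set of irreducible representations of `Sp_{2n}` that appear in the oscillator
representation at the step `ℓ` of the Witt tower of the anisotropic form `a`. -/
def towerSpectrum {F A : Type*} [Field F] [Fintype F] [AddCommGroup A] [Module F A] [Fintype A]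
    (n : ℕ) (h2 : (2 : F) ≠ 0) {χ : AddChar F ℂ} (hχ : χ ≠ 1) {a : LinearMap.BilinForm F A}
    (ha : IsAnisotropicForm a) (ℓ : ℕ) : Set (GroupDual (Matrix.symplecticGroup (Fin n) F)) :=
  spectrumOf (spRep n h2 (ha.isInnerProduct_towerForm ℓ) hχ)

/-- The new spectrum: the representations of `Sp_{2n}` that appear at the step `ℓ` of the tower
and not at the step `ℓ - 1`. At the first step `ℓ = 0` everything is new. -/
def newSpectrum {F A : Type*} [Field F] [Fintype F] [AddCommGroup A] [Module F A] [Fintype A]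
    (n : ℕ) (h2 : (2 : F) ≠ 0) {χ : AddChar F ℂ} (hχ : χ ≠ 1) {a : LinearMap.BilinForm F A}
    (ha : IsAnisotropicForm a) : ℕ → Set (GroupDual (Matrix.symplecticGroup (Fin n) F))
  | 0 => towerSpectrum n h2 hχ ha 0
  | ℓ + 1 => towerSpectrum n h2 hχ ha (ℓ + 1) \ towerSpectrum n h2 hχ ha ℓ

/-- The sum of the `Sp_{2n}`-isotypic components for the new spectrum, as a subrepresentation for
`Sp_{2n} × O(V')`, where `V'` carries the form at the step `ℓ` of the tower. -/
def newPart {F A : Type*} [Field F] [Fintype F] [AddCommGroup A] [Module F A] [Fintype A]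
    (n : ℕ) (h2 : (2 : F) ≠ 0) {χ : AddChar F ℂ} (hχ : χ ≠ 1) {a : LinearMap.BilinForm F A}
    (ha : IsAnisotropicForm a) (ℓ : ℕ) :
    Subrepresentation (dualPairRep n h2 (ha.isInnerProduct_towerForm ℓ) hχ) :=
  isotypicSub (oscillatorRep n h2 (ha.isInnerProduct_towerForm ℓ) hχ) (spEmb n (towerForm a ℓ))
    (orthEmb n (towerForm a ℓ)) (spEmb_commute n (towerForm a ℓ)) (newSpectrum n h2 hχ ha ℓ)

/-- The action of `Sp_{2n} × O(V')` on the sum of the isotypic components for the new spectrum. -/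
def newRep {F A : Type*} [Field F] [Fintype F] [AddCommGroup A] [Module F A] [Fintype A]
    (n : ℕ) (h2 : (2 : F) ≠ 0) {χ : AddChar F ℂ} (hχ : χ ≠ 1) {a : LinearMap.BilinForm F A}
    (ha : IsAnisotropicForm a) (ℓ : ℕ) :
    Representation ℂ (Matrix.symplecticGroup (Fin n) F × isometryGroup (towerForm a ℓ))
      (newPart n h2 hχ ha ℓ).toSubmodule :=
  (newPart n h2 hχ ha ℓ).toRepresentation

end

noncomputable section

/-! ### Irreducible representations and double commutants -/

/-! Write G for the symplectic group, B for the form on V' and W = V ⊗ V'. The commutant of G on the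
whole Schrödinger space can be computed. The operators ρ(w), w ∈ W, form a basis of the
endomorphisms, and conjugation by ω(g) takes ρ(w) to ρ(gw); so an operator commuting with G is ∑
f(w) ρ(w) with f a G-invariant function on W. By Witt's theorem for V, the orbit of w is determined
by the linear relations between the coordinates of w along a basis of V' and by their Gram matrix,
that is, by the subspaces U of V' with w ∈ V ⊗ U and by the values at w of the forms ⟨ , ⟩ ⊗ θ, with
θ bilinear on V'. Hence the functions equal to χ(θ(w, w)/2) on V ⊗ U and to 0 elsewhere separate the
orbits. A product of two of them is again of this kind, so they span the invariant functions
(`mem_span_gaussian`).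

Only the skew part of θ matters here, and θ may be normalized by θ(u, v) + θ(v, u) = B(u, v). Then
there are two cases. If θ is non-degenerate on U, it is the Wall form of an isometry g of V' (with U
the image of 1 - g), and the operator attached to (U, θ) has the commutation rule of ω(g) with the
Heisenberg group; by Schur it is a multiple of ω(g) (`exists_gaussianOp_eq`). If θ is degenerate on
U, a vector e ≠ 0 of its left radical is isotropic, since B(e, e) = 2 θ(e, e), and the operator does
not change under right multiplication by ρ(v ⊗ e), v ∈ V (`gaussianOp_mul_heisenbergVec`).

Operators of the second kind vanish on the new part. The coinvariants of V ⊗ e in the Schrödinger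
model of V' are the Schrödinger model of e^⊥/e, the preceding member of the Witt tower; the
projection restricts a function to e^⊥ and sums it along e. It commutes with G
(`reductionMap_spRep`), so an operator of the second kind factors through a representation of G in
which no new class occurs. At the bottom of the tower there is no isotropic vector and no second
kind. As the new part has a G-invariant complement, its commutant comes from the commutant on the
whole space, and it is generated by G' (`newRep_centralizer_le`).

The bijection is the formal consequence of this (`exists_bijOn_of_centralizer_le`): when G'
generates the commutant of G, the non-zero spaces Hom_G(σ, R) are irreducible under G', and
equivalent ones come from equivalent σ. -/

theorem Representation.isIrreducible_of_forall {G V : Type*} [Group G] [AddCommGroup V]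
    [Module ℂ V] (ρ : Representation ℂ G V) [Nontrivial V]
    (h : ∀ K : Subrepresentation ρ, ∀ v ∈ K.toSubmodule, v ≠ 0 → K.toSubmodule = ⊤) :
    ρ.IsIrreducible := by
  have hnt : Nontrivial (Subrepresentation ρ) := by
    refine ⟨⊥, ⊤, fun h0 => ?_⟩
    have : (⊥ : Submodule ℂ V) = ⊤ := congrArg Subrepresentation.toSubmodule h0
    exact bot_ne_top this
  refine { exists_pair_ne := hnt.exists_pair_ne, eq_bot_or_eq_top := fun K => ?_ }
  by_cases hK : K.toSubmodule = ⊥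
  · exact Or.inl (Subrepresentation.toSubmodule_injective hK)
  · obtain ⟨v, hv, hv0⟩ := K.toSubmodule.ne_bot_iff.mp hK
    exact Or.inr (Subrepresentation.toSubmodule_injective (h K v hv hv0))

theorem Representation.IsIrreducible.toSubmodule_eq_top {G V : Type*} [Group G] [AddCommGroup V]
    [Module ℂ V] {ρ : Representation ℂ G V} (hρ : ρ.IsIrreducible) (K : Subrepresentation ρ)
    {v : V} (hv : v ∈ K.toSubmodule) (hv0 : v ≠ 0) : K.toSubmodule = ⊤ := by
  rcases hρ.eq_bot_or_eq_top K with h | h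
  · rw [h] at hv
    exact absurd ((Submodule.mem_bot ℂ).mp hv) hv0
  · rw [h]; rfl

theorem Representation.IsIrreducible.nontrivial {G V : Type*} [Group G] [AddCommGroup V]
    [Module ℂ V] {ρ : Representation ℂ G V} (hρ : ρ.IsIrreducible) : Nontrivial V := by
  by_contra hcon
  rw [not_nontrivial_iff_subsingleton] at hcon
  have : Subsingleton (Subrepresentation ρ) :=
    Subrepresentation.toSubmodule_injective.subsingleton
  exact not_subsingleton _ this

/-- Every irreducible representation of finite dimension is equivalent to one on some `ℂ ^ d`. -/
theorem IrrepOf.exists_equiv {G V : Type*} [Group G] [AddCommGroup V]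
    [Module ℂ V] [Module.Finite ℂ V] {ρ : Representation ℂ G V} (hρ : ρ.IsIrreducible) :
    ∃ τ : IrrepOf G, Nonempty (τ.rep.Equiv ρ) := by
  let e := (Module.finBasis ℂ V).equivFun
  let r : Representation ℂ G (Fin (Module.finrank ℂ V) → ℂ) :=
    { toFun := fun g => e.conj (ρ g)
      map_one' := by rw [map_one]; exact e.conj_id
      map_mul' := fun g g' => by rw [map_mul]; exact e.conj_comp _ _ }
  have hr : ∀ g v, r g (e v) = e (ρ g v) := fun g v => by
    change e.conj (ρ g) (e v) = _
    rw [LinearEquiv.conj_apply_apply, e.symm_apply_apply]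
  have := hρ.nontrivial
  have : Nontrivial (Fin (Module.finrank ℂ V) → ℂ) := e.symm.toEquiv.nontrivial
  refine ⟨⟨_, r, r.isIrreducible_of_forall fun K v hv hv0 => ?_⟩, ⟨?_⟩⟩
  · let K' : Subrepresentation ρ := ⟨K.toSubmodule.comap e.toLinearMap, fun g w hw => by
      change e (ρ g w) ∈ K.toSubmodule
      rw [← hr]
      exact K.apply_mem_toSubmodule g hw⟩
    have h1 : K'.toSubmodule = ⊤ := by
      refine hρ.toSubmodule_eq_top K' (v := e.symm v) ?_ ?_
      · change e (e.symm v) ∈ K.toSubmodule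
        rwa [e.apply_symm_apply]
      · rwa [ne_eq, LinearEquiv.map_eq_zero_iff]
    rw [eq_top_iff]
    intro w _
    have h2 : e.symm w ∈ K'.toSubmodule := by rw [h1]; trivial
    have h3 : e (e.symm w) ∈ K.toSubmodule := h2
    rwa [e.apply_symm_apply] at h3
  · exact (Representation.Equiv.mk (ρ := ρ) (σ := r) e fun g =>
      LinearMap.ext fun v => (hr g v).symm).symm

/-- The trivial representation on ℂ. It only serves to give the correspondence a value at classes
where none is prescribed. -/
theorem IrrepOf.nonempty (G : Type*) [Group G] : Nonempty (IrrepOf G) := by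
  obtain ⟨τ, -⟩ := IrrepOf.exists_equiv (G := G) (V := ℂ) (ρ := 1)
    (Representation.isIrreducible_of_forall _ fun K v hv hv0 => by
      rw [eq_top_iff]
      intro w _
      have := K.toSubmodule.smul_mem (w / v) hv
      rwa [smul_eq_mul, div_mul_cancel₀ _ hv0] at this)
  exact ⟨τ⟩

theorem IrrepOf.cls_eq_iff {G : Type*} [Group G] {σ τ : IrrepOf G} :
    σ.cls = τ.cls ↔ Nonempty (σ.rep.Equiv τ.rep) :=
  Quotient.eq (r := IrrepOf.instSetoid G)

theorem IrrepOf.exists_cls_eq {G : Type*} [Group G] (c : GroupDual G) :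
    ∃ σ : IrrepOf G, σ.cls = c :=
  Quotient.exists_rep c

/-- Maschke: an injective intertwining map has an intertwining left inverse. -/
theorem Representation.IntertwiningMap.exists_leftInverse {G V E : Type*} [Group G] [Finite G]
    [AddCommGroup V] [Module ℂ V] [AddCommGroup E] [Module ℂ E] {σ : Representation ℂ G V}
    {ρ : Representation ℂ G E} (φ : σ.IntertwiningMap ρ) (hφ : Function.Injective φ) :
    ∃ p : ρ.IntertwiningMap σ, ∀ v, p (φ v) = v := by
  have : NeZero (Nat.card G : ℂ) := ⟨by exact_mod_cast Nat.card_pos.ne'⟩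
  obtain ⟨p, hp⟩ := MonoidAlgebra.exists_leftInverse_of_injective
    (IntertwiningMap.equivLinearMapAsModule σ ρ φ) (LinearMap.ker_eq_bot.mpr hφ)
  exact ⟨(IntertwiningMap.equivLinearMapAsModule ρ σ).symm p, fun v => LinearMap.congr_fun hp v⟩

/-! ### Multiplicity spaces and the correspondence they define -/

/-- The multiplicity space `Hom_G (σ, R)` of a representation `R` of `G × G'`, with the action
of `G'`. -/
def multiplicityRep {G G' V E : Type*} [Group G] [Group G'] [AddCommGroup V] [Module ℂ V]
    [AddCommGroup E] [Module ℂ E] (σ : Representation ℂ G V) (R : Representation ℂ (G × G') E) :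
    Representation ℂ G' (σ.IntertwiningMap (R.comp (MonoidHom.inl G G'))) where
  toFun g' :=
    { toFun := fun f => ⟨R (1, g') ∘ₗ f.toLinearMap, fun g => by
        refine LinearMap.ext fun v => ?_
        have h := f.isIntertwining _ _ g v
        change R (1, g') (f (σ g v)) = R (g, 1) (R (1, g') (f v))
        rw [h]
        change R (1, g') (R (g, 1) (f v)) = R (g, 1) (R (1, g') (f v))
        rw [← Module.End.mul_apply, ← Module.End.mul_apply, ← map_mul, ← map_mul]
        simp⟩
      map_add' := fun f f' => by
        ext v
        exact map_add (R (1, g')) (f v) (f' v)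
      map_smul' := fun c f => by
        ext v
        exact map_smul (R (1, g')) c (f v) }
  map_one' := by
    refine LinearMap.ext fun f => DFunLike.ext _ _ fun v => ?_
    change R (1, 1) (f v) = f v
    rw [← Prod.one_eq_mk, map_one]; rfl
  map_mul' g g' := by
    refine LinearMap.ext fun f => DFunLike.ext _ _ fun v => ?_
    change R (1, g * g') (f v) = R (1, g) (R (1, g') (f v))
    rw [← Module.End.mul_apply, ← map_mul]
    simp

theorem multiplicityRep_apply {G G' V E : Type*} [Group G] [Group G'] [AddCommGroup V]
    [Module ℂ V] [AddCommGroup E] [Module ℂ E] (σ : Representation ℂ G V)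
    (R : Representation ℂ (G × G') E) (g' : G')
    (f : σ.IntertwiningMap (R.comp (MonoidHom.inl G G'))) (v : V) :
    multiplicityRep σ R g' f v = R (1, g') (f v) := rfl

/-- Operators in the algebra generated by `G'` act on linear subspaces of the multiplicity space
that are invariant under `G'`. -/
theorem exists_comp_mem_of_mem_adjoin {G G' V E : Type*} [Group G] [Group G'] [AddCommGroup V]
    [Module ℂ V] [AddCommGroup E] [Module ℂ E] {σ : Representation ℂ G V}
    {R : Representation ℂ (G × G') E} (K : Subrepresentation (multiplicityRep σ R))
    {b : Module.End ℂ E} (hb : b ∈ Algebra.adjoin ℂ (Set.range fun g' : G' => R (1, g'))) :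
    ∀ φ ∈ K.toSubmodule, ∃ ψ ∈ K.toSubmodule, ∀ v, ψ v = b (φ v) := by
  induction hb using Algebra.adjoin_induction with
  | mem x hx =>
    obtain ⟨g', rfl⟩ := hx
    exact fun φ hφ => ⟨_, K.apply_mem_toSubmodule g' hφ, fun v => rfl⟩
  | algebraMap c =>
    exact fun φ hφ => ⟨c • φ, K.toSubmodule.smul_mem c hφ, fun v => rfl⟩
  | add x y _ _ hx hy =>
    intro φ hφ
    obtain ⟨ψ, h1, h2⟩ := hx φ hφ
    obtain ⟨ψ', h3, h4⟩ := hy φ hφ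
    exact ⟨ψ + ψ', K.toSubmodule.add_mem h1 h3, fun v => by
      rw [LinearMap.add_apply, ← h2, ← h4]; rfl⟩
  | mul x y _ _ hx hy =>
    intro φ hφ
    obtain ⟨ψ, h1, h2⟩ := hy φ hφ
    obtain ⟨ψ', h3, h4⟩ := hx ψ h1
    exact ⟨ψ', h3, fun v => by rw [Module.End.mul_apply, ← h2, ← h4]⟩

/-- Intertwining maps of multiplicity spaces commute with the algebra generated by `G'`. -/
theorem multiplicityRep_map_adjoin {G G' V V' E : Type*} [Group G] [Group G'] [AddCommGroup V]
    [Module ℂ V] [AddCommGroup V'] [Module ℂ V'] [AddCommGroup E] [Module ℂ E]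
    {σ : Representation ℂ G V} {σ' : Representation ℂ G V'}
    {R : Representation ℂ (G × G') E}
    (f : (multiplicityRep σ R).IntertwiningMap (multiplicityRep σ' R))
    {b : Module.End ℂ E} (hb : b ∈ Algebra.adjoin ℂ (Set.range fun g' : G' => R (1, g'))) :
    ∀ φ ψ, (∀ v, ψ v = b (φ v)) → ∀ v, f ψ v = b (f φ v) := by
  induction hb using Algebra.adjoin_induction with
  | mem x hx =>
    obtain ⟨g', rfl⟩ := hx
    intro φ ψ h v
    have : ψ = multiplicityRep σ R g' φ := DFunLike.ext _ _ h
    rw [this, f.isIntertwining]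
    rfl
  | algebraMap c =>
    intro φ ψ h v
    have : ψ = c • φ := DFunLike.ext _ _ h
    rw [this, map_smul]
    rfl
  | add x y hx' hy' hx hy =>
    intro φ ψ h v
    -- The composites of φ with x and with y are themselves intertwining maps, by the preceding
    -- lemma for the whole multiplicity space.
    obtain ⟨ψ₁, -, h1⟩ := exists_comp_mem_of_mem_adjoin (⊤ : Subrepresentation _) hx' φ trivial
    obtain ⟨ψ₂, -, h2⟩ := exists_comp_mem_of_mem_adjoin (⊤ : Subrepresentation _) hy' φ trivial
    have : ψ = ψ₁ + ψ₂ := DFunLike.ext _ _ fun v => by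
      rw [h, LinearMap.add_apply, ← h1, ← h2]; rfl
    rw [this, map_add, LinearMap.add_apply, ← hx φ ψ₁ h1, ← hy φ ψ₂ h2]
    rfl
  | mul x y hx' hy' hx hy =>
    intro φ ψ h v
    obtain ⟨ψ₂, -, h2⟩ := exists_comp_mem_of_mem_adjoin (⊤ : Subrepresentation _) hy' φ trivial
    rw [Module.End.mul_apply, ← hy φ ψ₂ h2, hx ψ₂ ψ fun v => by rw [h, h2]; rfl]

/-- These operators are the elements of the commutant that carry one copy of σ to another: if p is a
left inverse of an embedding φ₀, then φ ∘ p takes φ₀ to φ. -/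
theorem comp_mem_centralizer {G G' V E : Type*} [Group G] [Group G'] [AddCommGroup V]
    [Module ℂ V] [AddCommGroup E] [Module ℂ E] {σ : Representation ℂ G V}
    {R : Representation ℂ (G × G') E} (φ : σ.IntertwiningMap (R.comp (MonoidHom.inl G G')))
    (p : Representation.IntertwiningMap (R.comp (MonoidHom.inl G G')) σ) :
    φ.toLinearMap ∘ₗ p.toLinearMap ∈
      Subalgebra.centralizer ℂ (Set.range fun g : G => R (g, 1)) := by
  rw [Subalgebra.mem_centralizer_iff]
  rintro _ ⟨g, rfl⟩
  refine LinearMap.ext fun v => ?_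
  have h1 := p.isIntertwining _ _ g v
  have h2 := φ.isIntertwining _ _ g (p v)
  change R (g, 1) (φ (p v)) = φ (p (R (g, 1) v))
  change p (R (g, 1) v) = _ at h1
  change _ = R (g, 1) (φ (p v)) at h2
  rw [h1, h2]

/-- If `G'` generates the commutant of `G`, the non-zero multiplicity spaces are irreducible. -/
theorem multiplicityRep_isIrreducible {G G' V E : Type*} [Group G] [Finite G] [Group G']
    [AddCommGroup V] [Module ℂ V] [AddCommGroup E] [Module ℂ E] {σ : Representation ℂ G V}
    (hσ : σ.IsIrreducible) {R : Representation ℂ (G × G') E}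
    (hR : Subalgebra.centralizer ℂ (Set.range fun g : G => R (g, 1)) ≤
      Algebra.adjoin ℂ (Set.range fun g' : G' => R (1, g')))
    [Nontrivial (σ.IntertwiningMap (R.comp (MonoidHom.inl G G')))] :
    (multiplicityRep σ R).IsIrreducible := by
  refine Representation.isIrreducible_of_forall _ fun K φ hφ hφ0 => ?_
  rw [eq_top_iff]
  intro ψ _
  obtain ⟨p, hp⟩ := φ.exists_leftInverse
    ((Representation.IsIrreducible.injective_or_eq_zero φ).resolve_right hφ0)
  -- The operator ψ ∘ p commutes with G, hence lies in the algebra generated by G', and it takes φ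
  -- to ψ because p ∘ φ = 1. So K, which contains φ, contains every ψ.
  obtain ⟨ψ', hK, h⟩ := exists_comp_mem_of_mem_adjoin K (hR (comp_mem_centralizer ψ p)) φ hφ
  have : ψ' = ψ := DFunLike.ext _ _ fun v => by
    rw [h]
    change ψ (p (φ v)) = ψ v
    rw [hp]
  rwa [← this]

/-- Choose an embedding φ of σ with left inverse p. The projection φ ∘ p lies in the algebra
generated by G' and fixes φ, so it also fixes the image of φ under f, a non-zero embedding of σ'.
Hence p does not vanish on the copy of σ' and gives a non-zero map σ' → σ, which is bijective by
Schur. -/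
theorem equiv_of_multiplicityRep_equiv {G G' V V' E : Type*} [Group G] [Finite G] [Group G']
    [AddCommGroup V] [Module ℂ V] [AddCommGroup V'] [Module ℂ V'] [AddCommGroup E] [Module ℂ E]
    {σ : Representation ℂ G V} (hσ : σ.IsIrreducible)
    {σ' : Representation ℂ G V'} (hσ' : σ'.IsIrreducible) {R : Representation ℂ (G × G') E}
    (hR : Subalgebra.centralizer ℂ (Set.range fun g : G => R (g, 1)) ≤
      Algebra.adjoin ℂ (Set.range fun g' : G' => R (1, g')))
    [Nontrivial (σ.IntertwiningMap (R.comp (MonoidHom.inl G G')))]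
    (f : (multiplicityRep σ R).Equiv (multiplicityRep σ' R)) : Nonempty (σ.Equiv σ') := by
  obtain ⟨φ, hφ0⟩ := exists_ne (0 : σ.IntertwiningMap (R.comp (MonoidHom.inl G G')))
  obtain ⟨p, hp⟩ := φ.exists_leftInverse
    ((Representation.IsIrreducible.injective_or_eq_zero φ).resolve_right hφ0)
  have h := multiplicityRep_map_adjoin f.toIntertwiningMap (hR (comp_mem_centralizer φ p)) φ φ
    fun v => by
      change φ v = φ (p (φ v))
      rw [hp]
  have hψ0 : f.toIntertwiningMap φ ≠ 0 := by
    rw [Representation.Equiv.coe_toIntertwiningMap]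
    exact (map_ne_zero_iff f (EquivLike.injective f)).mpr hφ0
  obtain ⟨v, hv⟩ := DFunLike.ne_iff.mp hψ0
  have hq : p.comp (f.toIntertwiningMap φ) ≠ 0 := by
    intro h0
    apply hv
    rw [h]
    have h1 : p (f.toIntertwiningMap φ v) = 0 := DFunLike.congr_fun h0 v
    change φ (p (f.toIntertwiningMap φ v)) = 0
    rw [h1, map_zero]
  exact ⟨(Representation.IntertwiningMap.ofBijective _
    ((Representation.IsIrreducible.bijective_or_eq_zero _).resolve_right hq)).symm⟩

/-- An equivalence of representations gives an equivalence of multiplicity spaces. -/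
def multiplicityRepCongr {G G' V V' E : Type*} [Group G] [Group G'] [AddCommGroup V]
    [Module ℂ V] [AddCommGroup V'] [Module ℂ V'] [AddCommGroup E] [Module ℂ E]
    {σ : Representation ℂ G V} {σ' : Representation ℂ G V'} (e : σ.Equiv σ')
    (R : Representation ℂ (G × G') E) :
    (multiplicityRep σ R).Equiv (multiplicityRep σ' R) :=
  Representation.Equiv.mk
    { toFun := fun f => f.comp e.symm.toIntertwiningMap
      invFun := fun f => f.comp e.toIntertwiningMap
      map_add' := fun f f' => rfl
      map_smul' := fun c f => rfl
      left_inv := fun f => DFunLike.ext _ _ fun v => by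
        change f (e.symm (e v)) = f v
        rw [Representation.Equiv.symm_apply_apply]
      right_inv := fun f => DFunLike.ext _ _ fun v => by
        change f (e (e.symm v)) = f v
        rw [Representation.Equiv.apply_symm_apply] }
    fun g' => rfl

/-- `Hom_{G × G'} (σ ⊠ τ, R) = Hom_{G'} (τ, Hom_G (σ, R))`. -/
def outerTensorHomEquiv {G G' E : Type*} [Group G] [Group G'] [AddCommGroup E] [Module ℂ E]
    (σ : IrrepOf G) (τ : IrrepOf G') (R : Representation ℂ (G × G') E) :
    (outerTensor σ τ).IntertwiningMap R ≃ₗ[ℂ]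
      τ.rep.IntertwiningMap (multiplicityRep σ.rep R) where
  toFun f :=
    { toFun := fun t =>
        { toFun := fun s => f (TensorProduct.tmul ℂ s t)
          map_add' := fun s s' => by rw [TensorProduct.add_tmul, map_add]
          map_smul' := fun c s => by
            rw [← TensorProduct.smul_tmul', map_smul]; rfl
          isIntertwining' := fun g => LinearMap.ext fun s => by
            have h := f.isIntertwining _ _ (g, 1) (TensorProduct.tmul ℂ s t)
            have h1 : outerTensor σ τ (g, 1) (TensorProduct.tmul ℂ s t) =
                TensorProduct.tmul ℂ (σ.rep g s) (τ.rep 1 t) := rfl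
            rw [h1, map_one] at h
            exact h }
      map_add' := fun t t' => by
        ext s
        change f _ = f _ + f _
        rw [TensorProduct.tmul_add, map_add]
      map_smul' := fun c t => by
        ext s
        change f _ = c • f _
        rw [TensorProduct.tmul_smul, map_smul]
      isIntertwining' := fun g' => by
        refine LinearMap.ext fun t => DFunLike.ext _ _ fun s => ?_
        have h := f.isIntertwining _ _ (1, g') (TensorProduct.tmul ℂ s t)
        have h1 : outerTensor σ τ (1, g') (TensorProduct.tmul ℂ s t) =
            TensorProduct.tmul ℂ (σ.rep 1 s) (τ.rep g' t) := rfl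
        rw [h1, map_one] at h
        exact h }
  map_add' f f' := rfl
  map_smul' c f := rfl
  invFun F :=
    { toLinearMap := TensorProduct.lift (LinearMap.mk₂ ℂ (fun s t => F t s)
        (fun s s' t => map_add (F t) s s') (fun c s t => map_smul (F t) c s)
        (fun s t t' => by rw [map_add]; rfl) (fun c s t => by rw [map_smul]; rfl))
      isIntertwining' := fun p => by
        refine TensorProduct.ext' fun s t => ?_
        have h1 : outerTensor σ τ p (TensorProduct.tmul ℂ s t) =
            TensorProduct.tmul ℂ (σ.rep p.1 s) (τ.rep p.2 t) := rfl
        rw [LinearMap.comp_apply, LinearMap.comp_apply, h1, TensorProduct.lift.tmul, TensorProduct.lift.tmul, LinearMap.mk₂_apply,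
          LinearMap.mk₂_apply, F.isIntertwining, multiplicityRep_apply,
          (F t).isIntertwining]
        change R (1, p.2) (R (p.1, 1) (F t s)) = _
        rw [← Module.End.mul_apply, ← map_mul]
        simp }
  left_inv f := by
    ext1
    refine TensorProduct.ext' fun s t => ?_
    rw [TensorProduct.lift.tmul]
    rfl
  right_inv F := by
    refine DFunLike.ext _ _ fun t => DFunLike.ext _ _ fun s => ?_
    rfl

-- By adjunction this is the dimension of Hom_{G'}(τ, Hom_G(σ, R)), and Hom_G(σ, R) is zero or
-- irreducible, so Schur's lemma for G' decides.
open scoped Classical in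
theorem finrank_outerTensor_intertwiningMap {G G' E : Type*} [Group G] [Finite G] [Group G']
    [AddCommGroup E] [Module ℂ E] {R : Representation ℂ (G × G') E}
    (hR : Subalgebra.centralizer ℂ (Set.range fun g : G => R (g, 1)) ≤
      Algebra.adjoin ℂ (Set.range fun g' : G' => R (1, g'))) (σ : IrrepOf G) (τ : IrrepOf G') :
    Module.finrank ℂ ((outerTensor σ τ).IntertwiningMap R) =
      if Nonempty (τ.rep.Equiv (multiplicityRep σ.rep R)) then 1 else 0 := by
  have := σ.irred
  have := τ.irred
  rw [(outerTensorHomEquiv σ τ R).finrank_eq]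
  split_ifs with h
  · obtain ⟨e⟩ := h
    let L : τ.rep.IntertwiningMap τ.rep ≃ₗ[ℂ] τ.rep.IntertwiningMap (multiplicityRep σ.rep R) :=
      { toFun := fun f => e.toIntertwiningMap.comp f
        invFun := fun f => e.symm.toIntertwiningMap.comp f
        map_add' := fun f f' => Representation.IntertwiningMap.add_comp _ _ _ _ _ _
        map_smul' := fun c f => Representation.IntertwiningMap.comp_smul _ _ _ _ _ _
        left_inv := fun f => DFunLike.ext _ _ fun v => e.symm_apply_apply _
        right_inv := fun f => DFunLike.ext _ _ fun v => e.apply_symm_apply _ }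
    rw [← L.finrank_eq, Representation.IsIrreducible.finrank_intertwiningMap_self]
  · have : Subsingleton (τ.rep.IntertwiningMap (multiplicityRep σ.rep R)) := by
      rcases subsingleton_or_nontrivial
        (σ.rep.IntertwiningMap (R.comp (MonoidHom.inl G G'))) with hs | hs
      · exact ⟨fun f f' => DFunLike.ext _ _ fun v => Subsingleton.elim _ _⟩
      · have := multiplicityRep_isIrreducible σ.irred hR
        have : IsEmpty (τ.rep.Equiv (multiplicityRep σ.rep R)) := not_nonempty_iff.mp h
        infer_instance
    exact Module.finrank_zero_of_subsingleton

/-- If `G'` generates the commutant of `G`, the representation of `G × G'` is the graph of a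
bijection between sets of irreducible representations. -/
theorem exists_bijOn_of_centralizer_le {G G' E : Type*} [Group G] [Finite G] [Group G']
    [AddCommGroup E] [Module ℂ E] [Module.Finite ℂ E] {R : Representation ℂ (G × G') E}
    (hR : Subalgebra.centralizer ℂ (Set.range fun g : G => R (g, 1)) ≤
      Algebra.adjoin ℂ (Set.range fun g' : G' => R (1, g'))) {N : Set (GroupDual G)}
    (hN : ∀ σ : IrrepOf G, σ.cls ∈ N ↔
      Nontrivial (σ.rep.IntertwiningMap (R.comp (MonoidHom.inl G G')))) :
    ∃ (S : Set (GroupDual G')) (η : GroupDual G' → GroupDual G), Set.BijOn η S N ∧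
      ∀ (σ : IrrepOf G) (τ : IrrepOf G'),
        ((τ.cls ∈ S ∧ η τ.cls = σ.cls) → Module.finrank ℂ
          ((outerTensor σ τ).IntertwiningMap R) = 1) ∧
        (¬ (τ.cls ∈ S ∧ η τ.cls = σ.cls) → Module.finrank ℂ
          ((outerTensor σ τ).IntertwiningMap R) = 0) := by
  classical
  -- P is the graph of the correspondence. It depends only on classes; a class of G lies in N
  -- exactly if it has a partner, and partners are unique on both sides.
  let P : IrrepOf G → IrrepOf G' → Prop := fun σ τ =>
    Nonempty (τ.rep.Equiv (multiplicityRep σ.rep R))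
  have hnt : ∀ σ τ, P σ τ →
      Nontrivial (σ.rep.IntertwiningMap (R.comp (MonoidHom.inl G G'))) := by
    rintro σ τ ⟨e⟩
    have := τ.irred.nontrivial
    exact e.symm.toLinearEquiv.toEquiv.nontrivial
  have hPN : ∀ σ, σ.cls ∈ N ↔ ∃ τ, P σ τ := by
    intro σ
    rw [hN]
    constructor
    · intro h
      exact IrrepOf.exists_equiv (multiplicityRep_isIrreducible σ.irred hR)
    · rintro ⟨τ, h⟩
      exact hnt σ τ h
  have hleft : ∀ σ σ' τ, σ.cls = σ'.cls → P σ τ → P σ' τ := by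
    rintro σ σ' τ h ⟨e⟩
    obtain ⟨e'⟩ := IrrepOf.cls_eq_iff.mp h
    exact ⟨e.trans (multiplicityRepCongr e' R)⟩
  have hright : ∀ σ τ τ', τ.cls = τ'.cls → P σ τ → P σ τ' := by
    rintro σ τ τ' h ⟨e⟩
    obtain ⟨e'⟩ := IrrepOf.cls_eq_iff.mp h
    exact ⟨e'.symm.trans e⟩
  have huniq : ∀ σ σ' τ, P σ τ → P σ' τ → σ.cls = σ'.cls := by
    intro σ σ' τ h h'
    have := hnt σ τ h
    obtain ⟨e⟩ := h
    obtain ⟨e'⟩ := h'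
    exact IrrepOf.cls_eq_iff.mpr
      (equiv_of_multiplicityRep_equiv σ.irred σ'.irred hR (e.symm.trans e'))
  have huniq' : ∀ σ τ τ', P σ τ → P σ τ' → τ.cls = τ'.cls := by
    rintro σ τ τ' ⟨e⟩ ⟨e'⟩
    exact IrrepOf.cls_eq_iff.mpr ⟨e.trans e'.symm⟩
  let Q : GroupDual G' → Prop := fun c => ∃ σ τ, τ.cls = c ∧ P σ τ
  -- Outside the set of classes with a partner the value is arbitrary.
  let η : GroupDual G' → GroupDual G := fun c =>
    if h : Q c then h.choose.cls else (IrrepOf.nonempty G).some.cls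
  have hη : ∀ σ τ, P σ τ → η τ.cls = σ.cls := by
    intro σ τ h
    have hQ : Q τ.cls := ⟨σ, τ, rfl, h⟩
    have h1 : η τ.cls = hQ.choose.cls := dif_pos hQ
    obtain ⟨τ', h2, h3⟩ := hQ.choose_spec
    rw [h1]
    exact huniq _ _ τ (hright _ _ _ h2 h3) h
  have hiff : ∀ σ τ, (τ.cls ∈ {c | Q c} ∧ η τ.cls = σ.cls) ↔ P σ τ := by
    intro σ τ
    constructor
    · rintro ⟨⟨σ', τ', h1, h2⟩, h3⟩
      have h4 := hright _ _ _ h1 h2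
      rw [hη σ' τ h4] at h3
      exact hleft _ _ _ h3 h4
    · exact fun h => ⟨⟨σ, τ, rfl, h⟩, hη σ τ h⟩
  refine ⟨{c | Q c}, η, ⟨?_, ?_, ?_⟩, fun σ τ => ?_⟩
  · rintro _ ⟨σ, τ, rfl, h⟩
    rw [hη σ τ h]
    exact (hPN σ).mpr ⟨τ, h⟩
  · rintro _ ⟨σ, τ, rfl, h⟩ _ ⟨σ', τ', rfl, h'⟩ heq
    rw [hη σ τ h, hη σ' τ' h'] at heq
    exact huniq' σ' τ τ' (hleft _ _ _ heq h) h'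
  · intro c hc
    obtain ⟨σ, rfl⟩ := IrrepOf.exists_cls_eq c
    obtain ⟨τ, h⟩ := (hPN σ).mp hc
    exact ⟨τ.cls, ⟨σ, τ, rfl, h⟩, hη σ τ h⟩
  · rw [hiff, finrank_outerTensor_intertwiningMap hR]
    exact ⟨fun h => if_pos h, fun h => if_neg h⟩

/-! ### Symplectic transvections and Witt's theorem -/

/-- The standard symplectic form on `F ^ (2n)`. -/
abbrev stdSymp (n : ℕ) (F : Type*) [Field F] : LinearMap.BilinForm F (SympSpace n F) :=
  sympForm n (LinearMap.mul F F)

theorem isInnerProduct_mul (F : Type*) [Field F] : IsInnerProduct (LinearMap.mul F F) where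
  symm x y := mul_comm x y
  nondeg x hx := by simpa using hx 1

theorem stdSymp_self {n : ℕ} {F : Type*} [Field F] (v : SympSpace n F) : stdSymp n F v v = 0 :=
  sympForm_self n (isInnerProduct_mul F) v

theorem sympForm_skew {F M : Type*} [Field F] [AddCommGroup M] [Module F M] (n : ℕ)
    {B : LinearMap.BilinForm F M} (hB : IsInnerProduct B) (w w' : SympSpace n M) :
    sympForm n B w w' = -sympForm n B w' w := by
  have h1 := sympForm_self n hB (w + w')
  simp only [map_add, LinearMap.add_apply, sympForm_self n hB] at h1
  linear_combination h1

theorem stdSymp_skew {n : ℕ} {F : Type*} [Field F] (v w : SympSpace n F) :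
    stdSymp n F v w = -stdSymp n F w v :=
  sympForm_skew n (isInnerProduct_mul F) v w

theorem stdSymp_apply {n : ℕ} {F : Type*} [Field F] (v w : SympSpace n F) :
    stdSymp n F v w = ∑ i, (v (Sum.inl i) * w (Sum.inr i) - v (Sum.inr i) * w (Sum.inl i)) := by
  rw [stdSymp, sympForm_apply]
  rfl

theorem stdSymp_eq_dotProduct {n : ℕ} {F : Type*} [Field F] (v w : SympSpace n F) :
    stdSymp n F v w = -(v ⬝ᵥ (Matrix.J (Fin n) F).mulVec w) := by
  rw [stdSymp, sympForm_eq_J]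
  simp only [dotProduct, Matrix.mulVec, LinearMap.mul_apply', Finset.mul_sum]
  congr 1
  refine Finset.sum_congr rfl fun i _ => Finset.sum_congr rfl fun j _ => ?_
  ring

theorem stdSymp_mulVec {n : ℕ} {F : Type*} [Field F] (g : Matrix.symplecticGroup (Fin n) F)
    (v w : SympSpace n F) : stdSymp n F (g.1.mulVec v) (g.1.mulVec w) = stdSymp n F v w :=
  sympForm_matrixAct (LinearMap.mul F F) g v w

theorem mem_symplecticGroup_of_stdSymp {n : ℕ} {F : Type*} [Field F]
    {A : Matrix (Fin n ⊕ Fin n) (Fin n ⊕ Fin n) F}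
    (hA : ∀ v w, stdSymp n F (A.mulVec v) (A.mulVec w) = stdSymp n F v w) :
    A ∈ Matrix.symplecticGroup (Fin n) F := by
  rw [SymplecticGroup.mem_iff']
  have hT : ∀ v z : SympSpace n F, A.mulVec v ⬝ᵥ z = v ⬝ᵥ A.transpose.mulVec z := fun v z => by
    rw [dotProduct_comm, Matrix.dotProduct_mulVec, ← Matrix.mulVec_transpose, dotProduct_comm]
  ext i j
  have h := hA (Pi.single i 1) (Pi.single j 1)
  rw [stdSymp_eq_dotProduct, stdSymp_eq_dotProduct, neg_inj, hT, Matrix.mulVec_mulVec,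
    Matrix.mulVec_mulVec] at h
  simpa only [single_one_dotProduct, Matrix.mulVec_single_one, Matrix.col_apply] using h

theorem exists_stdSymp_eq {n : ℕ} {F : Type*} [Field F] (f : SympSpace n F →ₗ[F] F) :
    ∃ h, ∀ v, stdSymp n F v h = f v := by
  refine ⟨Sum.elim (fun i => -f (Pi.single (Sum.inr i) 1)) (fun i => f (Pi.single (Sum.inl i) 1)),
    fun v => ?_⟩
  rw [stdSymp_apply, LinearMap.pi_apply_eq_sum_univ f v, Fintype.sum_sum_type,
    ← Finset.sum_add_distrib]
  refine Finset.sum_congr rfl fun i _ => ?_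
  have e : ∀ j : Fin n ⊕ Fin n, (fun k => if j = k then (1 : F) else 0) = Pi.single j 1 := fun j => by
    ext k
    simp [Pi.single_apply, eq_comm]
  simp only [Sum.elim_inl, Sum.elim_inr, smul_eq_mul, e]
  ring

/-- `g` is the symplectic transvection `v ↦ v + c ⟨v, d⟩ d`. -/
def IsSympTransvection {n : ℕ} {F : Type*} [Field F] (g : Matrix.symplecticGroup (Fin n) F)
    (d : SympSpace n F) (c : F) : Prop :=
  ∀ v, g.1.mulVec v = v + (c * stdSymp n F v d) • d

/-- The subgroup generated by the symplectic transvections. -/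
def transvectionSubgroup (n : ℕ) (F : Type*) [Field F] :
    Subgroup (Matrix.symplecticGroup (Fin n) F) :=
  Subgroup.closure {g | ∃ d c, IsSympTransvection g d c}

theorem exists_isSympTransvection {n : ℕ} {F : Type*} [Field F] (d : SympSpace n F) (c : F) :
    ∃ g : Matrix.symplecticGroup (Fin n) F, IsSympTransvection g d c := by
  let L : SympSpace n F →ₗ[F] SympSpace n F :=
    LinearMap.id + (c • (stdSymp n F).flip d).smulRight d
  have hL : ∀ v, L v = v + (c * stdSymp n F v d) • d := fun v => rfl
  have hm : ∀ v, (LinearMap.toMatrix' L).mulVec v = L v := fun v => by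
    rw [← Matrix.toLin'_apply, Matrix.toLin'_toMatrix']
  refine ⟨⟨LinearMap.toMatrix' L, mem_symplecticGroup_of_stdSymp fun v w => ?_⟩, fun v => ?_⟩
  · rw [hm, hm, hL, hL]
    simp only [map_add, map_smul, LinearMap.add_apply, LinearMap.smul_apply, smul_eq_mul,
      stdSymp_self, stdSymp_skew d w]
    ring
  · rw [← hL]
    exact hm v

/-- Two vectors outside a subspace with the same products with it are conjugate under the
transvections fixing it. -/
theorem exists_transvection_move {n : ℕ} {F : Type*} [Field F]
    (X : Submodule F (SympSpace n F)) {x y : SympSpace n F} (hx : x ∉ X) (hy : y ∉ X)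
    (hxy : ∀ z ∈ X, stdSymp n F z x = stdSymp n F z y) :
    ∃ g ∈ transvectionSubgroup n F, (∀ z ∈ X, g.1.mulVec z = z) ∧ g.1.mulVec x = y := by
  have hmove : ∀ x y : SympSpace n F, (∀ z ∈ X, stdSymp n F z x = stdSymp n F z y) →
      stdSymp n F x y ≠ 0 →
      ∃ g ∈ transvectionSubgroup n F, (∀ z ∈ X, g.1.mulVec z = z) ∧ g.1.mulVec x = y := by
    intro x y h h0
    -- The direction y - x is orthogonal to X, so X is fixed; the coefficient makes x go to x + (y -
    -- x), since ⟨x, y - x⟩ = ⟨x, y⟩.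
    obtain ⟨g, hg⟩ := exists_isSympTransvection (y - x) (stdSymp n F x y)⁻¹
    refine ⟨g, Subgroup.subset_closure ⟨_, _, hg⟩, fun z hz => ?_, ?_⟩
    · rw [hg, map_sub, h z hz, sub_self, mul_zero, zero_smul, add_zero]
    · rw [hg, map_sub, stdSymp_self, sub_zero, inv_mul_cancel₀ h0, one_smul, add_sub_cancel]
  by_cases h0 : stdSymp n F x y = 0
  swap
  · exact hmove x y hxy h0
  have hsep : ∀ x ∉ X, ∃ h, (∀ z ∈ X, stdSymp n F z h = 0) ∧ stdSymp n F x h ≠ 0 := by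
    intro x hx
    obtain ⟨f, hf, hX⟩ := Submodule.exists_le_ker_of_notMem hx
    obtain ⟨h, hh⟩ := exists_stdSymp_eq f
    refine ⟨h, fun z hz => ?_, ?_⟩
    · rw [hh]; exact hX hz
    · rwa [hh]
  -- If ⟨x, y⟩ = 0, two transvections through x + h do it, where h is orthogonal to X but neither to
  -- x nor to y. Functionals that vanish on X and separate x, respectively y, from X provide a and
  -- b; one of a, b, a + b serves as h.
  obtain ⟨h, hX, h1, h2⟩ : ∃ h, (∀ z ∈ X, stdSymp n F z h = 0) ∧ stdSymp n F x h ≠ 0 ∧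
      stdSymp n F y h ≠ 0 := by
    obtain ⟨a, ha, hxa⟩ := hsep x hx
    obtain ⟨b, hb, hyb⟩ := hsep y hy
    by_cases hya : stdSymp n F y a = 0
    swap
    · exact ⟨a, ha, hxa, hya⟩
    by_cases hxb : stdSymp n F x b = 0
    swap
    · exact ⟨b, hb, hxb, hyb⟩
    refine ⟨a + b, fun z hz => ?_, ?_, ?_⟩
    · rw [map_add, ha z hz, hb z hz, add_zero]
    · rwa [map_add, hxb, add_zero]
    · rwa [map_add, hya, zero_add]
  obtain ⟨g, hg, hgX, hgx⟩ := hmove x (x + h)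
    (fun z hz => by rw [map_add, hX z hz, add_zero])
    (by rwa [map_add, stdSymp_self, zero_add])
  obtain ⟨g', hg', hgX', hgx'⟩ := hmove (x + h) y
    (fun z hz => by rw [map_add, hX z hz, add_zero, hxy z hz])
    (by rwa [map_add, LinearMap.add_apply, h0, zero_add, stdSymp_skew, neg_ne_zero])
  refine ⟨g' * g, mul_mem hg' hg, fun z hz => ?_, ?_⟩
  · rw [Submonoid.coe_mul, ← Matrix.mulVec_mulVec, hgX z hz, hgX' z hz]
  · rw [Submonoid.coe_mul, ← Matrix.mulVec_mulVec, hgx, hgx']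

/-- Witt's theorem for the symplectic group: two families of vectors with the same linear
relations and the same Gram matrix are conjugate. -/
theorem exists_transvection_family_aux {n : ℕ} {F : Type*} [Field F] {m : ℕ}
    (x y : Fin m → SympSpace n F)
    (hrel : ∀ c : Fin m → F, ∑ i, c i • x i = 0 ↔ ∑ i, c i • y i = 0)
    (hxy : ∀ i j, stdSymp n F (x i) (x j) = stdSymp n F (y i) (y j)) :
    ∃ g ∈ transvectionSubgroup n F, ∀ i, g.1.mulVec (x i) = y i := by
  induction m with
  | zero => exact ⟨1, one_mem _, fun i => i.elim0⟩
  | succ m ih =>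
    obtain ⟨g, hg, hgx⟩ := ih (fun i => x i.castSucc) (fun i => y i.castSucc)
      (fun c => by
        have := hrel (Fin.snoc (α := fun _ => F) c 0)
        simpa [Fin.sum_univ_castSucc] using this)
      (fun i j => hxy _ _)
    let X : Submodule F (SympSpace n F) := Submodule.span F (Set.range fun i : Fin m => y i.castSucc)
    have hlast : ∀ c : Fin m → F, ∑ i, c i • x i.castSucc = x (Fin.last m) ↔
        ∑ i, c i • y i.castSucc = y (Fin.last m) := by
      intro c
      -- The last coefficient -1 turns an expression of the last vector through the others into a
      -- linear relation.
      have := hrel (Fin.snoc (α := fun _ => F) c (-1))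
      simpa [Fin.sum_univ_castSucc, add_neg_eq_zero] using this
    have hgs : ∀ c : Fin m → F, g.1.mulVec (∑ i, c i • x i.castSucc) =
        ∑ i, c i • y i.castSucc := by
      intro c
      rw [Matrix.mulVec_sum]
      refine Finset.sum_congr rfl fun i _ => ?_
      rw [Matrix.mulVec_smul, hgx]
    have hinj : ∀ u v : SympSpace n F, g.1.mulVec u = g.1.mulVec v → u = v := by
      intro u v h
      have h1 := congrArg (fun z => (g⁻¹).1.mulVec z) h
      simpa [Matrix.mulVec_mulVec, ← Submonoid.coe_mul] using h1
    have hXiff : ∀ v, v ∈ X ↔ ∃ c : Fin m → F, ∑ i, c i • y i.castSucc = v := fun v =>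
      Submodule.mem_span_range_iff_exists_fun F
    by_cases hy : y (Fin.last m) ∈ X
    · obtain ⟨c, hc⟩ := (hXiff _).mp hy
      refine ⟨g, hg, fun i => ?_⟩
      refine Fin.lastCases ?_ (fun i => hgx i) i
      rw [← (hlast c).mpr hc, hgs, hc]
    -- The last vector of y is now independent of the others. By equality of the relations the same
    -- holds for x, so both vectors lie outside X and the preceding lemma corrects g without moving
    -- X.
    · have hx : g.1.mulVec (x (Fin.last m)) ∉ X := by
        intro h
        obtain ⟨c, hc⟩ := (hXiff _).mp h
        rw [← hgs] at hc
        exact hy ((hXiff _).mpr ⟨c, (hlast c).mp (hinj _ _ hc)⟩)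
      obtain ⟨g', hg', hX, hgl⟩ := exists_transvection_move X hx hy fun z hz => by
        induction hz using Submodule.span_induction with
        | mem z hz =>
          obtain ⟨i, rfl⟩ := hz
          simp only
          rw [← hgx, stdSymp_mulVec, hxy, hgx]
        | zero => rw [map_zero, LinearMap.zero_apply, LinearMap.zero_apply]
        | add u v _ _ hu hv => rw [map_add, LinearMap.add_apply, LinearMap.add_apply, hu, hv]
        | smul c v _ hv => rw [map_smul, LinearMap.smul_apply, LinearMap.smul_apply, hv]
      refine ⟨g' * g, mul_mem hg' hg, fun i => ?_⟩
      rw [Submonoid.coe_mul, ← Matrix.mulVec_mulVec]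
      refine Fin.lastCases hgl (fun i => ?_) i
      rw [hgx]
      exact hX _ (Submodule.subset_span ⟨i, rfl⟩)

theorem exists_transvection_family {n : ℕ} {F : Type*} [Field F] {ι : Type*} [Fintype ι]
    (x y : ι → SympSpace n F)
    (hrel : ∀ c : ι → F, ∑ i, c i • x i = 0 ↔ ∑ i, c i • y i = 0)
    (hxy : ∀ i j, stdSymp n F (x i) (x j) = stdSymp n F (y i) (y j)) :
    ∃ g ∈ transvectionSubgroup n F, ∀ i, g.1.mulVec (x i) = y i := by
  let e := Fintype.equivFin ι
  obtain ⟨g, hg, h⟩ := exists_transvection_family_aux (x ∘ e.symm) (y ∘ e.symm)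
    (fun c => by
      have := hrel (c ∘ e)
      rw [← e.symm.sum_comp, ← e.symm.sum_comp (fun i => (c ∘ e) i • y i)] at this
      simpa using this)
    (fun i j => hxy _ _)
  exact ⟨g, hg, fun i => by simpa using h (e i)⟩

/-- The symplectic group is generated by transvections. -/
theorem transvectionSubgroup_eq_top (n : ℕ) (F : Type*) [Field F] :
    transvectionSubgroup n F = ⊤ := by
  rw [eq_top_iff]
  intro g _
  -- Witt's theorem for the standard basis and its image under g gives a product of transvections
  -- that agrees with g on a basis.
  obtain ⟨h, hh, hgh⟩ := exists_transvection_family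
    (fun j : Fin n ⊕ Fin n => (Pi.single j 1 : SympSpace n F))
    (fun j => g.1.mulVec (Pi.single j 1))
    (fun c => by
      have h1 : ∑ j, c j • g.1.mulVec (Pi.single j 1) =
          g.1.mulVec (∑ j, c j • (Pi.single j 1 : SympSpace n F)) := by
        rw [Matrix.mulVec_sum]
        exact Finset.sum_congr rfl fun i _ => (Matrix.mulVec_smul _ _ _).symm
      rw [h1]
      constructor
      · intro h; rw [h, Matrix.mulVec_zero]
      · intro h
        have h1 := congrArg (fun z => (g⁻¹).1.mulVec z) h
        simpa [Matrix.mulVec_mulVec, ← Submonoid.coe_mul] using h1)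
    (fun i j => (stdSymp_mulVec g _ _).symm)
  have : h = g := by
    apply Subtype.ext
    refine Matrix.ext_of_mulVec_single fun j => ?_
    exact hgh j
  rwa [← this]

theorem exists_mulVec_eq_of_ne_zero {n : ℕ} {F : Type*} [Field F] {x y : SympSpace n F}
    (hx : x ≠ 0) (hy : y ≠ 0) : ∃ g : Matrix.symplecticGroup (Fin n) F, g.1.mulVec x = y := by
  obtain ⟨g, -, -, h⟩ := exists_transvection_move ⊥ (x := x) (y := y)
    (by simpa using hx) (by simpa using hy) (fun z hz => by
      rw [(Submodule.mem_bot F).mp hz, map_zero, LinearMap.zero_apply, LinearMap.zero_apply])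
  exact ⟨g, h⟩

/-! ### The commutant of the symplectic group -/

/-- The operator of the element `w` of `V ⊗ V'` in the representation of the Heisenberg group. -/
def heisenbergVec {F M : Type*} [Field F] [AddCommGroup M] [Module F M] {n : ℕ}
    (h2 : (2 : F) ≠ 0) {B : LinearMap.BilinForm F M} (hB : IsInnerProduct B) (χ : AddChar F ℂ)
    (w : SympSpace n M) : Module.End ℂ (Schrodinger n M) :=
  heisenbergRep n h2 hB χ ⟨w, 0⟩

theorem heisenbergVec_mul {F M : Type*} [Field F] [AddCommGroup M] [Module F M] {n : ℕ}
    (h2 : (2 : F) ≠ 0) {B : LinearMap.BilinForm F M} (hB : IsInnerProduct B) (χ : AddChar F ℂ)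
    (w z : SympSpace n M) :
    heisenbergVec h2 hB χ w * heisenbergVec h2 hB χ z =
      χ (2⁻¹ * sympForm n B w z) • heisenbergVec h2 hB χ (w + z) := by
  unfold heisenbergVec
  rw [← heisenbergRep_cen, ← map_mul]
  congr 1
  apply Heisenberg.ext
  · rfl
  · change 0 + 0 + 2⁻¹ * sympForm n B w z = _
    rw [zero_add, zero_add]

theorem heisenbergVec_zero {F M : Type*} [Field F] [AddCommGroup M] [Module F M] {n : ℕ}
    (h2 : (2 : F) ≠ 0) {B : LinearMap.BilinForm F M} (hB : IsInnerProduct B) (χ : AddChar F ℂ) :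
    heisenbergVec h2 hB χ (0 : SympSpace n M) = 1 :=
  map_one (heisenbergRep n h2 hB χ)

/-- The trace of ρ(w) is zero for w ≠ 0, while ρ(0) = 1 has non-zero trace. Multiplying a relation
by ρ(-w₀) and taking traces isolates the coefficient at w₀. -/
theorem linearIndependent_heisenbergVec {F M : Type*} [Field F] [AddCommGroup M] [Module F M]
    [Fintype M] {n : ℕ} (h2 : (2 : F) ≠ 0) {B : LinearMap.BilinForm F M} (hB : IsInnerProduct B)
    {χ : AddChar F ℂ} (hχ : χ ≠ 1) :
    LinearIndependent ℂ (heisenbergVec h2 hB χ : SympSpace n M → _) := by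
  classical
  rw [Fintype.linearIndependent_iff]
  intro c hc w₀
  have h1 := congrArg (fun T => LinearMap.trace ℂ _ (T * heisenbergVec h2 hB χ (-w₀))) hc
  simp only [Finset.sum_mul, smul_mul_assoc, map_sum, map_smul, zero_mul, map_zero,
    heisenbergVec_mul] at h1
  rw [Finset.sum_eq_single w₀] at h1
  · rw [add_neg_cancel, heisenbergVec_zero, LinearMap.trace_one, map_neg, sympForm_self n hB,
      neg_zero, mul_zero, AddChar.map_zero_eq_one, one_smul, smul_eq_mul,
      Module.finrank_fintype_fun_eq_card] at h1
    exact (mul_eq_zero.mp h1).resolve_right (by exact_mod_cast Fintype.card_ne_zero)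
  · intro w _ hw
    unfold heisenbergVec
    rw [trace_heisenbergRep h2 hB hχ ⟨w + -w₀, 0⟩ fun h => hw (add_neg_eq_zero.mp h), smul_zero,
      smul_zero]
  · simp

/-- A count: there are |M|^(2n) independent operators on a space of dimension |M|^n. -/
theorem span_heisenbergVec {F M : Type*} [Field F] [AddCommGroup M] [Module F M]
    [Fintype M] {n : ℕ} (h2 : (2 : F) ≠ 0) {B : LinearMap.BilinForm F M} (hB : IsInnerProduct B)
    {χ : AddChar F ℂ} (hχ : χ ≠ 1) :
    Submodule.span ℂ (Set.range (heisenbergVec h2 hB χ : SympSpace n M → _)) = ⊤ := by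
  classical
  refine (linearIndependent_heisenbergVec h2 hB hχ).span_eq_top_of_card_eq_finrank' ?_
  rw [Module.finrank_linearMap, Module.finrank_fintype_fun_eq_card, Fintype.card_fun,
    Fintype.card_fun, Fintype.card_sum, Fintype.card_fin, pow_add]

theorem spRep_heisenbergVec {F M : Type*} [Field F] [AddCommGroup M] [Module F M]
    [Fintype M] {n : ℕ} (h2 : (2 : F) ≠ 0) {B : LinearMap.BilinForm F M} (hB : IsInnerProduct B)
    {χ : AddChar F ℂ} (hχ : χ ≠ 1) (g : Matrix.symplecticGroup (Fin n) F) (w : SympSpace n M) :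
    spRep n h2 hB hχ g * heisenbergVec h2 hB χ w =
      heisenbergVec h2 hB χ (matrixAct g.1 w) * spRep n h2 hB hχ g :=
  oscillatorRep_intertwines n h2 hB hχ (spEmb n B g) ⟨w, 0⟩

/-- The commutant of `Sp_{2n}` is spanned by sums over orbits. -/
theorem exists_invariant_of_commute {F M : Type*} [Field F] [Finite F] [AddCommGroup M]
    [Module F M] [Fintype M] {n : ℕ} (h2 : (2 : F) ≠ 0) {B : LinearMap.BilinForm F M}
    (hB : IsInnerProduct B) {χ : AddChar F ℂ} (hχ : χ ≠ 1) {T : Module.End ℂ (Schrodinger n M)}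
    (hT : ∀ g, spRep n h2 hB hχ g * T = T * spRep n h2 hB hχ g) :
    ∃ f : SympSpace n M → ℂ,
      (∀ (g : Matrix.symplecticGroup (Fin n) F) w, f (matrixAct g.1 w) = f w) ∧
      T = ∑ w, f w • heisenbergVec h2 hB χ w := by
  classical
  have : Fintype (Matrix.symplecticGroup (Fin n) F) := Fintype.ofFinite _
  have hmem : T ∈ Submodule.span ℂ (Set.range (heisenbergVec h2 hB χ : SympSpace n M → _)) := by
    rw [span_heisenbergVec h2 hB hχ]; trivial
  obtain ⟨c, hc⟩ := (Submodule.mem_span_range_iff_exists_fun ℂ).mp hmem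
  have hcomp : ∀ (g h : Matrix.symplecticGroup (Fin n) F) (w : SympSpace n M),
      matrixAct g.1 (matrixAct h.1 w) = matrixAct (g * h).1 w := fun g h w => by
    rw [Submonoid.coe_mul, matrixAct_mul]; rfl
  let N : ℂ := (Fintype.card (Matrix.symplecticGroup (Fin n) F) : ℂ)
  have hN : N ≠ 0 := Nat.cast_ne_zero.mpr Fintype.card_ne_zero
  refine ⟨fun w => N⁻¹ * ∑ g : Matrix.symplecticGroup (Fin n) F, c (matrixAct g.1 w),
    fun g w => ?_, ?_⟩
  · refine congrArg (N⁻¹ * ·) (Fintype.sum_equiv (Equiv.mulRight g) _ _ fun h => ?_)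
    rw [hcomp]; rfl
  -- Moving the coefficients by g conjugates the sum by ω(g), which does not change T. The average
  -- of the coefficients over the group therefore still represents T, and it is invariant.
  · have h1 : ∀ g : Matrix.symplecticGroup (Fin n) F,
        ∑ w, c (matrixAct g.1 w) • heisenbergVec h2 hB χ w = T := by
      intro g
      have e1 : spRep n h2 hB hχ g * ∑ w, c (matrixAct g.1 w) • heisenbergVec h2 hB χ w =
          T * spRep n h2 hB hχ g := by
        rw [← hc, Finset.mul_sum, Finset.sum_mul]
        refine Fintype.sum_equiv ((spEmb n B g).1).toEquiv _ _ fun w => ?_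
        rw [mul_smul_comm, spRep_heisenbergVec, smul_mul_assoc]
        rfl
      rw [← hT] at e1
      have hu : spRep n h2 hB hχ g⁻¹ * spRep n h2 hB hχ g = 1 := by
        rw [← map_mul, inv_mul_cancel, map_one]
      have e2 := congrArg (spRep n h2 hB hχ g⁻¹ * ·) e1
      simpa only [← mul_assoc, hu, one_mul] using e2
    simp only [mul_smul, Finset.sum_smul, ← Finset.smul_sum]
    rw [Finset.sum_comm, Finset.sum_congr rfl fun g _ => h1 g, Finset.sum_const, Finset.card_univ,
      ← Nat.cast_smul_eq_nsmul ℂ, smul_smul, inv_mul_cancel₀ hN, one_smul]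

/-! ### Invariant functions as combinations of Gaussians -/

/-- A subalgebra of functions on a finite set contains all functions that are constant on the sets
of points it does not separate. -/
theorem Subalgebra.mem_of_forall_eq {X : Type*} [Fintype X] (𝒜 : Subalgebra ℂ (X → ℂ))
    {f : X → ℂ} (hf : ∀ x y, (∀ h ∈ 𝒜, h x = h y) → f x = f y) : f ∈ 𝒜 := by
  classical
  -- The function e is the indicator of the class of points not separated from x. It is a product
  -- over all y of functions that are 1 at x and vanish at y if y is separated from x.
  have hind : ∀ x, ∃ e ∈ 𝒜, e x = 1 ∧ ∀ y, e y ≠ 0 → ∀ h ∈ 𝒜, h x = h y := by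
    intro x
    have hsep : ∀ y, ∃ e ∈ 𝒜, e x = 1 ∧ (e y ≠ 0 → ∀ h ∈ 𝒜, h x = h y) := by
      intro y
      by_cases hy : ∀ h ∈ 𝒜, h x = h y
      · exact ⟨1, one_mem _, rfl, fun _ => hy⟩
      · push Not at hy
        obtain ⟨h, hh, hxy⟩ := hy
        refine ⟨(h x - h y)⁻¹ • (h - algebraMap ℂ _ (h y)),
          𝒜.smul_mem (sub_mem hh (𝒜.algebraMap_mem _)) _, ?_, fun h0 => absurd ?_ h0⟩
        · simp [sub_ne_zero.mpr hxy]
        · simp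
    choose e he hx hy using hsep
    refine ⟨∏ y, e y, prod_mem fun y _ => he y, ?_, fun y h0 => hy y fun h => h0 ?_⟩
    · rw [Finset.prod_apply]
      exact Finset.prod_eq_one fun y _ => hx y
    · rw [Finset.prod_apply]
      exact Finset.prod_eq_zero (Finset.mem_univ y) h
  choose e he hx hy using hind
  have hone : ∀ x y, e x y ≠ 0 → e x y = 1 := fun x y h => by
    rw [← hy x y h (e x) (he x), hx]
  -- Each class is counted once for each of its points; s(y) is the size of the class of y, and
  -- dividing by it corrects the multiplicity.
  let s : X → ℂ := ∑ x, e x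
  have hs : s ∈ 𝒜 := sum_mem fun x _ => he x
  have hs0 : ∀ y, s y ≠ 0 := by
    intro y
    have h1 : s y = ((Finset.univ.filter fun x => e x y ≠ 0).card : ℂ) := by
      change (∑ x, e x) y = _
      rw [Finset.sum_apply, Finset.card_filter, Nat.cast_sum]
      refine Finset.sum_congr rfl fun x _ => ?_
      by_cases h : e x y = 0
      · simp [h]
      · simp [hone x y h]
    rw [h1]
    have h3 : y ∈ Finset.univ.filter fun x => e x y ≠ 0 := by simp [hx]
    exact_mod_cast Finset.card_ne_zero_of_mem h3
  have h4 : f = ∑ x, (f x / s x) • e x := by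
    funext y
    rw [Finset.sum_apply]
    have h5 : ∀ x, ((f x / s x) • e x) y = f y / s y * e x y := by
      intro x
      rw [Pi.smul_apply, smul_eq_mul]
      by_cases h : e x y = 0
      · rw [h, mul_zero, mul_zero]
      · rw [hy x y h s hs, hf x y (hy x y h)]
    simp only [h5]
    rw [← Finset.mul_sum, ← Finset.sum_apply]
    exact (div_mul_cancel₀ _ (hs0 y)).symm
  rw [h4]
  exact sum_mem fun x _ => 𝒜.smul_mem (he x) _

open scoped Classical in
/-- The function on `V ⊗ V'` supported on `V ⊗ U` and equal there to the character of second
degree given by the bilinear form `θ`. -/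
def gaussian {F M : Type*} [Field F] [AddCommGroup M] [Module F M] (n : ℕ) (χ : AddChar F ℂ)
    (U : Submodule F M) (θ : LinearMap.BilinForm F M) : SympSpace n M → ℂ :=
  fun w => if ∀ j, w j ∈ U then χ (2⁻¹ * sympForm n θ w w) else 0

theorem gaussian_of_mem {F M : Type*} [Field F] [AddCommGroup M] [Module F M] {n : ℕ}
    (χ : AddChar F ℂ) {U : Submodule F M} (θ : LinearMap.BilinForm F M) {w : SympSpace n M}
    (h : ∀ j, w j ∈ U) : gaussian n χ U θ w = χ (2⁻¹ * sympForm n θ w w) :=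
  if_pos h

theorem gaussian_of_not_mem {F M : Type*} [Field F] [AddCommGroup M] [Module F M] {n : ℕ}
    (χ : AddChar F ℂ) {U : Submodule F M} (θ : LinearMap.BilinForm F M) {w : SympSpace n M}
    (h : ¬∀ j, w j ∈ U) : gaussian n χ U θ w = 0 :=
  if_neg h

theorem AddChar.apply_ne_zero {F : Type*} [Field F] (χ : AddChar F ℂ) (t : F) : χ t ≠ 0 :=
  (χ.val_isUnit t).ne_zero

theorem sympForm_add {F M : Type*} [Field F] [AddCommGroup M] [Module F M] (n : ℕ)
    (θ θ' : LinearMap.BilinForm F M) (w w' : SympSpace n M) :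
    sympForm n (θ + θ') w w' = sympForm n θ w w' + sympForm n θ' w w' := by
  rw [sympForm_apply, sympForm_apply, sympForm_apply, ← Finset.sum_add_distrib]
  refine Finset.sum_congr rfl fun i _ => ?_
  simp only [LinearMap.add_apply]
  ring

theorem sympForm_smul {F M : Type*} [Field F] [AddCommGroup M] [Module F M] (n : ℕ)
    (c : F) (θ : LinearMap.BilinForm F M) (w w' : SympSpace n M) :
    sympForm n (c • θ) w w' = c * sympForm n θ w w' := by
  rw [sympForm_apply, sympForm_apply, Finset.mul_sum]
  refine Finset.sum_congr rfl fun i _ => ?_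
  simp only [LinearMap.smul_apply, smul_eq_mul]
  ring

theorem sympForm_flip {F M : Type*} [Field F] [AddCommGroup M] [Module F M] (n : ℕ)
    (θ : LinearMap.BilinForm F M) (w w' : SympSpace n M) :
    sympForm n θ.flip w w' = -sympForm n θ w' w := by
  rw [sympForm_apply, sympForm_apply, ← Finset.sum_neg_distrib]
  refine Finset.sum_congr rfl fun i _ => ?_
  simp only [LinearMap.BilinForm.flip_apply]
  ring

/-- Closure under products is the reason for letting U vary along with θ: the linear span becomes an
algebra, and separation of points suffices to determine it. -/
theorem gaussian_mul {F M : Type*} [Field F] [AddCommGroup M] [Module F M] (n : ℕ)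
    (χ : AddChar F ℂ) (U U' : Submodule F M) (θ θ' : LinearMap.BilinForm F M) :
    gaussian n χ U θ * gaussian n χ U' θ' = gaussian n χ (U ⊓ U') (θ + θ') := by
  funext w
  have hiff : (∀ j, w j ∈ U ⊓ U') ↔ (∀ j, w j ∈ U) ∧ ∀ j, w j ∈ U' := forall_and
  rw [Pi.mul_apply]
  by_cases h : ∀ j, w j ∈ U
  · by_cases h' : ∀ j, w j ∈ U'
    · rw [gaussian_of_mem χ θ h, gaussian_of_mem χ θ' h', gaussian_of_mem χ _ (hiff.mpr ⟨h, h'⟩),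
        sympForm_add, mul_add, AddChar.map_add_eq_mul]
    · rw [gaussian_of_not_mem χ θ' h', gaussian_of_not_mem χ _ fun h0 => h' (hiff.mp h0).2,
        mul_zero]
  · rw [gaussian_of_not_mem χ θ h, gaussian_of_not_mem χ _ fun h0 => h (hiff.mp h0).1, zero_mul]

theorem gaussian_top_zero {F M : Type*} [Field F] [AddCommGroup M] [Module F M] (n : ℕ)
    (χ : AddChar F ℂ) : gaussian n χ (⊤ : Submodule F M) 0 = 1 := by
  funext w
  simp [gaussian, sympForm_apply]

/-- For s ≠ t the elements c (s - t) exhaust F, and χ is not trivial on F. This recovers the value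
of a form from the characters of its multiples. -/
theorem AddChar.eq_of_forall_mul {F : Type*} [Field F] {χ : AddChar F ℂ} (hχ : χ ≠ 1) {s t : F}
    (h : ∀ c, χ (c * s) = χ (c * t)) : s = t := by
  by_contra hst
  apply hχ
  ext r
  have h1 := h (r / (s - t))
  have h3 : r = r / (s - t) * s - r / (s - t) * t := by
    rw [← mul_sub, div_mul_cancel₀ _ (sub_ne_zero.mpr hst)]
  rw [h3, AddChar.map_sub_eq_div, h1]
  simp [AddChar.apply_ne_zero]

/-- The functions `gaussian n χ U θ` separate the orbits of `Sp_{2n}` in `V ⊗ V'`. -/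
theorem exists_matrixAct_eq {F M : Type*} [Field F] [AddCommGroup M] [Module F M] [Fintype M]
    {n : ℕ} (h2 : (2 : F) ≠ 0) {χ : AddChar F ℂ} (hχ : χ ≠ 1) {w w' : SympSpace n M}
    (h : ∀ (U : Submodule F M) (θ : LinearMap.BilinForm F M),
      gaussian n χ U θ w = gaussian n χ U θ w') :
    ∃ g : Matrix.symplecticGroup (Fin n) F, matrixAct g.1 w = w' := by
  have hU : ∀ U : Submodule F M, (∀ j, w j ∈ U) ↔ ∀ j, w' j ∈ U := by
    intro U
    -- For θ = 0 the Gaussian is the indicator function of V ⊗ U.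
    have h1 := h U 0
    simp only [gaussian] at h1
    split_ifs at h1 with h3 h4 h4
    · exact ⟨fun _ => h4, fun _ => h3⟩
    · exact absurd h1 (AddChar.apply_ne_zero _ _)
    · exact absurd h1.symm (AddChar.apply_ne_zero _ _)
    · exact ⟨fun h5 => absurd h5 h3, fun h5 => absurd h5 h4⟩
  have hθ : ∀ θ : LinearMap.BilinForm F M, sympForm n θ w w = sympForm n θ w' w' := by
    intro θ
    refine AddChar.eq_of_forall_mul hχ fun c => ?_
    -- The factor 2 cancels the 1/2 in the exponent of the Gaussian.
    have h1 := h ⊤ ((2 * c) • θ)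
    have e : ∀ t : F, 2⁻¹ * (2 * c * t) = c * t := fun t => by
      field_simp
    simpa only [gaussian, Submodule.mem_top, implies_true, if_true, sympForm_smul, e] using h1
  have : Module.Finite F M := Module.Finite.of_finite
  let b := Module.finBasis F M
  let x : Fin (Module.finrank F M) → SympSpace n F := fun i j => b.coord i (w j)
  let y : Fin (Module.finrank F M) → SympSpace n F := fun i j => b.coord i (w' j)
  have hs : ∀ (u : SympSpace n M) i k, stdSymp n F (fun j => b.coord i (u j))
      (fun j => b.coord k (u j)) =
      sympForm n ((LinearMap.mul F F).compl₁₂ (b.coord i) (b.coord k)) u u := by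
    intro u i k
    rw [stdSymp_apply, sympForm_apply]
    rfl
  -- The coordinates satisfy the relation with coefficients c exactly if w lies in V ⊗ U for U the
  -- kernel of ∑ cᵢ bᵢ*, and their Gram matrix is given by the forms θ = bᵢ* ⊗ bₖ*.
  obtain ⟨g, -, hg⟩ := exists_transvection_family x y (fun c => by
      have e : ∀ u : SympSpace n M, (∑ i, c i • (fun j => b.coord i (u j) : SympSpace n F) = 0) ↔
          ∀ j, u j ∈ LinearMap.ker (∑ i, c i • b.coord i) := by
        intro u
        rw [funext_iff]
        refine forall_congr' fun j => ?_
        rw [LinearMap.mem_ker, LinearMap.sum_apply, Finset.sum_apply]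
        rfl
      exact (e w).trans ((hU _).trans (e w').symm))
    (fun i k => by rw [hs, hs]; exact hθ _)
  refine ⟨g, funext fun j => b.ext_elem fun i => ?_⟩
  have h1 := congrFun (hg i) j
  change _ = b.coord i (w' j) at h1
  rw [← Module.Basis.coord_apply, ← Module.Basis.coord_apply, ← h1, matrixAct_apply, map_sum]
  exact Finset.sum_congr rfl fun k _ => map_smul _ _ _

/-- The algebra generated by the Gaussians separates the orbits of the symplectic group, so it
contains f. Since the Gaussians form a multiplicative monoid, this algebra is their linear span. -/
theorem mem_span_gaussian {F M : Type*} [Field F] [AddCommGroup M] [Module F M] [Fintype M]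
    {n : ℕ} (h2 : (2 : F) ≠ 0) {χ : AddChar F ℂ} (hχ : χ ≠ 1) {f : SympSpace n M → ℂ}
    (hf : ∀ (g : Matrix.symplecticGroup (Fin n) F) w, f (matrixAct g.1 w) = f w) :
    f ∈ Submodule.span ℂ (Set.range fun p : Submodule F M × LinearMap.BilinForm F M =>
      gaussian n χ p.1 p.2) := by
  let P : Submonoid (SympSpace n M → ℂ) :=
    { carrier := Set.range fun p : Submodule F M × LinearMap.BilinForm F M => gaussian n χ p.1 p.2
      one_mem' := ⟨(⊤, 0), gaussian_top_zero n χ⟩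
      mul_mem' := by
        rintro _ _ ⟨p, rfl⟩ ⟨q, rfl⟩
        exact ⟨(p.1 ⊓ q.1, p.2 + q.2), (gaussian_mul n χ _ _ _ _).symm⟩ }
  have h1 : f ∈ Algebra.adjoin ℂ (P : Set (SympSpace n M → ℂ)) := by
    refine Subalgebra.mem_of_forall_eq _ fun w w' h => ?_
    obtain ⟨g, rfl⟩ := exists_matrixAct_eq h2 hχ fun U θ =>
      h _ (Algebra.subset_adjoin ⟨(U, θ), rfl⟩)
    exact (hf g w).symm
  rw [← Subalgebra.mem_toSubmodule, Algebra.adjoin_eq_span, Submonoid.closure_eq] at h1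
  exact h1

/-- The operator `∑ w ∈ V ⊗ U, χ (θ (w, w) / 2) ρ(w)`. -/
def gaussianOp {F M : Type*} [Field F] [AddCommGroup M] [Module F M] [Fintype M] (n : ℕ)
    (h2 : (2 : F) ≠ 0) {B : LinearMap.BilinForm F M} (hB : IsInnerProduct B) (χ : AddChar F ℂ)
    (U : Submodule F M) (θ : LinearMap.BilinForm F M) : Module.End ℂ (Schrodinger n M) :=
  ∑ w, gaussian n χ U θ w • heisenbergVec h2 hB χ w

theorem mem_span_gaussianOp {F M : Type*} [Field F] [Finite F] [AddCommGroup M]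
    [Module F M] [Fintype M] {n : ℕ} (h2 : (2 : F) ≠ 0) {B : LinearMap.BilinForm F M}
    (hB : IsInnerProduct B) {χ : AddChar F ℂ} (hχ : χ ≠ 1) {T : Module.End ℂ (Schrodinger n M)}
    (hT : ∀ g, spRep n h2 hB hχ g * T = T * spRep n h2 hB hχ g) :
    T ∈ Submodule.span ℂ (Set.range fun p : Submodule F M × LinearMap.BilinForm F M =>
      gaussianOp n h2 hB χ p.1 p.2) := by
  obtain ⟨f, hf, rfl⟩ := exists_invariant_of_commute h2 hB hχ hT
  have h1 := mem_span_gaussian h2 hχ hf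
  let L : (SympSpace n M → ℂ) →ₗ[ℂ] Module.End ℂ (Schrodinger n M) :=
    Fintype.linearCombination ℂ (heisenbergVec h2 hB χ)
  have h3 := Submodule.mem_map_of_mem (f := L) h1
  rw [Submodule.map_span, ← Set.range_comp] at h3
  exact h3

/-! ### Operators of the orthogonal group -/

/-- The exponent is a sum of terms θ(x, y) - θ(y, x) and sees only the skew part of θ. The symmetric
part is free, and the choice B/2 links θ to the Heisenberg commutator. -/
theorem gaussianOp_congr {F M : Type*} [Field F] [AddCommGroup M] [Module F M] [Fintype M] (n : ℕ)
    (h2 : (2 : F) ≠ 0) {B : LinearMap.BilinForm F M} (hB : IsInnerProduct B) (χ : AddChar F ℂ)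
    (U : Submodule F M) (θ : LinearMap.BilinForm F M) :
    gaussianOp n h2 hB χ U θ = gaussianOp n h2 hB χ U ((2⁻¹ : F) • (θ - θ.flip + B)) := by
  refine Finset.sum_congr rfl fun w _ => ?_
  congr 1
  have h1 : sympForm n ((2⁻¹ : F) • (θ - θ.flip + B)) w w = sympForm n θ w w := by
    rw [sympForm_apply, sympForm_apply]
    refine Finset.sum_congr rfl fun i _ => ?_
    simp only [LinearMap.smul_apply, LinearMap.add_apply, LinearMap.sub_apply,
      LinearMap.BilinForm.flip_apply, smul_eq_mul]
    rw [hB.symm (w (Sum.inr i))]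
    field_simp
    ring
  simp only [gaussian, h1]

/-- Put z = v ⊗ e. For w ∈ V ⊗ U the terms with z on the left of θ vanish, so passing from w to w +
z changes the exponent by θ(w, z)/2, which is the cocycle B(w, z)/2 of the product ρ(w) ρ(z). The
sum is only reindexed. -/
theorem gaussianOp_mul_heisenbergVec {F M : Type*} [Field F] [AddCommGroup M] [Module F M]
    [Fintype M] {n : ℕ} (h2 : (2 : F) ≠ 0) {B : LinearMap.BilinForm F M} (hB : IsInnerProduct B)
    {χ : AddChar F ℂ} {U : Submodule F M} {θ : LinearMap.BilinForm F M}
    (hθ : ∀ u v, θ u v + θ v u = B u v) {e : M} (he : e ∈ U) (heU : ∀ u ∈ U, θ e u = 0)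
    (v : SympSpace n F) :
    gaussianOp n h2 hB χ U θ * heisenbergVec h2 hB χ (fun j => v j • e) =
      gaussianOp n h2 hB χ U θ := by
  set z : SympSpace n M := fun j => v j • e with hz
  unfold gaussianOp
  rw [Finset.sum_mul]
  refine Fintype.sum_equiv (Equiv.addRight z) _ _ fun w => ?_
  rw [smul_mul_assoc, heisenbergVec_mul, smul_smul]
  change _ = gaussian n χ U θ (w + z) • heisenbergVec h2 hB χ (w + z)
  congr 1
  have hzU : ∀ j, z j ∈ U := fun j => U.smul_mem _ he
  have hmem : (∀ j, (w + z) j ∈ U) ↔ ∀ j, w j ∈ U :=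
    forall_congr' fun j => U.add_mem_iff_left (hzU j)
  by_cases hw : ∀ j, w j ∈ U
  · rw [gaussian_of_mem χ θ hw, gaussian_of_mem χ θ (hmem.mpr hw)]
    have hB' : sympForm n B w z = sympForm n θ w z - sympForm n θ z w := by
      rw [sub_eq_add_neg, ← sympForm_flip, ← sympForm_add]
      congr 3
      ext u v
      exact (hθ u v).symm
    have h0 : ∀ u : SympSpace n M, (∀ j, u j ∈ U) → sympForm n θ z u = 0 := by
      intro u hu
      rw [sympForm_apply]
      refine Finset.sum_eq_zero fun i _ => ?_
      simp [hz, heU _ (hu _)]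
    rw [← AddChar.map_add_eq_mul, hB']
    simp only [map_add, LinearMap.add_apply, h0 w hw, h0 z hzU]
    congr 1
    ring
  · rw [gaussian_of_not_mem χ θ hw, gaussian_of_not_mem χ θ (hmem.not.mpr hw), zero_mul]

/-- Non-degeneracy of θ on U defines P : M → U by θ(v, P x) = B(v, x) for v ∈ U. The identity θ(u,
v) + θ(v, u) = B(u, v) makes 1 - P an isometry, and θ is its Wall form. The operator has the
commutation rule of this isometry with the Heisenberg group, so Schur's lemma applies. -/
theorem exists_gaussianOp_eq {F M : Type*} [Field F] [AddCommGroup M] [Module F M]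
    [Fintype M] {n : ℕ} (h2 : (2 : F) ≠ 0) {B : LinearMap.BilinForm F M} (hB : IsInnerProduct B)
    {χ : AddChar F ℂ} (hχ : χ ≠ 1) {U : Submodule F M} {θ : LinearMap.BilinForm F M}
    (hθ : ∀ u v, θ u v + θ v u = B u v) (hU : ∀ e ∈ U, (∀ u ∈ U, θ e u = 0) → e = 0) :
    ∃ (g : isometryGroup B) (c : ℂ),
      gaussianOp n h2 hB χ U θ = c • oscillatorRep n h2 hB hχ (orthEmb n B g) := by
  have : Module.Finite F M := Module.Finite.of_finite
  obtain ⟨P, hPU, hP⟩ : ∃ P : M →ₗ[F] M, (∀ x, P x ∈ U) ∧ ∀ x, ∀ v ∈ U, θ v (P x) = B v x := by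
    let β : U →ₗ[F] U →ₗ[F] F := θ.domRestrict₁₂ U U
    have hβ : Function.Injective β := by
      rw [← LinearMap.ker_eq_bot, LinearMap.ker_eq_bot']
      intro e he
      exact Subtype.ext (hU e.1 e.2 fun u hu => LinearMap.congr_fun he ⟨u, hu⟩)
    have hd : Module.finrank F U = Module.finrank F (Module.Dual F U) :=
      Subspace.dual_finrank_eq.symm
    -- The hypothesis concerns the left radical; in finite dimension the right radical is then zero
    -- too, and P is defined through the right variable of θ.
    have hβ2 : Function.Injective β.flip := by
      rw [LinearMap.flip_injective_iff₁]
      exact (LinearMap.injective_iff_surjective_of_finrank_eq_finrank hd).mp hβ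
    let e : U ≃ₗ[F] Module.Dual F U := LinearMap.linearEquivOfInjective β.flip hβ2 hd
    let r : M →ₗ[F] Module.Dual F U := U.subtype.dualMap ∘ₗ B.flip
    refine ⟨U.subtype ∘ₗ e.symm.toLinearMap ∘ₗ r, fun x => (e.symm (r x)).2, fun x v hv => ?_⟩
    have h1 : β.flip (e.symm (r x)) = r x := e.apply_symm_apply (r x)
    exact LinearMap.congr_fun h1 ⟨v, hv⟩
  have hiso : ∀ x y, B (x - P x) (y - P y) = B x y := by
    intro x y
    have h1 := hP y (P x) (hPU x)
    have h3 := hP x (P y) (hPU y)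
    have h4 := hθ (P x) (P y)
    have h5 := hB.symm x (P y)
    simp only [map_sub, LinearMap.sub_apply]
    linear_combination h3 + h1 - h4 - h5
  have hinj : Function.Injective (LinearMap.id - P : M →ₗ[F] M) := by
    rw [← LinearMap.ker_eq_bot, LinearMap.ker_eq_bot']
    intro x hx
    refine hB.nondeg x fun y => ?_
    have hx' : x - P x = 0 := hx
    rw [← hiso, hx', map_zero, LinearMap.zero_apply]
  let g : isometryGroup B := ⟨LinearEquiv.ofInjectiveEndo _ hinj, hiso⟩
  have hint : Intertwines h2 hB χ (orthEmb n B g) (gaussianOp n h2 hB χ U θ) := by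
    suffices h : ∀ z : SympSpace n M, gaussianOp n h2 hB χ U θ * heisenbergVec h2 hB χ z =
        heisenbergVec h2 hB χ (fun j => z j - P (z j)) * gaussianOp n h2 hB χ U θ by
      rintro ⟨z, t⟩
      have e1 : Heisenberg.act (orthEmb n B g) ⟨z, t⟩ = ⟨fun j => z j - P (z j), t⟩ := rfl
      rw [e1, heisenbergRep_cen, heisenbergRep_cen h2 hB χ _ t, mul_smul_comm, smul_mul_assoc]
      congr 1
      exact h z
    intro z
    set u : SympSpace n M := fun j => P (z j) with hu
    have hzu : (fun j => z j - P (z j)) = z - u := rfl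
    rw [hzu]
    unfold gaussianOp
    rw [Finset.sum_mul, Finset.mul_sum]
    -- With u = P z the substitution of w + u for w matches the vectors, as w + z = (z - u) + (w +
    -- u). The cocycles agree because B(a, z) = θ(a, u) for a ∈ V ⊗ U.
    refine Fintype.sum_equiv (Equiv.addRight u) _ _ fun w => ?_
    change _ = heisenbergVec h2 hB χ (z - u) *
      (gaussian n χ U θ (w + u) • heisenbergVec h2 hB χ (w + u))
    rw [smul_mul_assoc, mul_smul_comm, heisenbergVec_mul, heisenbergVec_mul, smul_smul, smul_smul]
    have e2 : z - u + (w + u) = w + z := by abel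
    rw [e2]
    congr 1
    have huU : ∀ j, u j ∈ U := fun j => hPU _
    have hmem : (∀ j, (w + u) j ∈ U) ↔ ∀ j, w j ∈ U :=
      forall_congr' fun j => U.add_mem_iff_left (huU j)
    by_cases hw : ∀ j, w j ∈ U
    · rw [gaussian_of_mem χ θ hw, gaussian_of_mem χ θ (hmem.mpr hw)]
      have hB' : ∀ a b : SympSpace n M,
          sympForm n B a b = sympForm n θ a b - sympForm n θ b a := by
        intro a b
        rw [sub_eq_add_neg, ← sympForm_flip, ← sympForm_add]
        congr 3
        ext u v
        exact (hθ u v).symm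
      have h0 : ∀ a : SympSpace n M, (∀ j, a j ∈ U) → sympForm n B a z = sympForm n θ a u := by
        intro a ha
        rw [sympForm_apply, sympForm_apply]
        refine Finset.sum_congr rfl fun i _ => ?_
        simp only [hu, hP _ _ (ha _)]
      have h1 := h0 w hw
      have h3 := h0 u huU
      have h4 := sympForm_skew n hB z w
      have h5 := sympForm_skew n hB z u
      have h6 := hB' u w
      rw [← AddChar.map_add_eq_mul, ← AddChar.map_add_eq_mul]
      congr 1
      simp only [map_add, map_sub, LinearMap.add_apply, LinearMap.sub_apply, sympForm_self n hB]
      rw [h4, h5, h6, h1, h3]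
      ring
    · rw [gaussian_of_not_mem χ θ hw, gaussian_of_not_mem χ θ (hmem.not.mpr hw), zero_mul,
        zero_mul]
  have hosc := oscillatorRep_intertwines n h2 hB hχ (orthEmb n B g)
  have hne : oscillatorRep n h2 hB hχ (orthEmb n B g) ≠ 0 := by
    intro h0
    have h1 : oscillatorRep n h2 hB hχ (orthEmb n B g)⁻¹ *
        oscillatorRep n h2 hB hχ (orthEmb n B g) = 1 := by
      rw [← map_mul, inv_mul_cancel, map_one]
    rw [h0, mul_zero] at h1
    exact zero_ne_one h1
  obtain ⟨c, hc⟩ := hint.eq_smul hχ hosc hne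
  exact ⟨g, c, hc⟩

/-- An operator commuting with `Sp_{2n}` is a sum of operators of the orthogonal group and of
operators invariant under right translation by `V ⊗ e` for some isotropic vectors `e`. -/
theorem mem_span_of_commute {F M : Type*} [Field F] [Finite F] [AddCommGroup M]
    [Module F M] [Fintype M] {n : ℕ} (h2 : (2 : F) ≠ 0) {B : LinearMap.BilinForm F M}
    (hB : IsInnerProduct B) {χ : AddChar F ℂ} (hχ : χ ≠ 1) {T : Module.End ℂ (Schrodinger n M)}
    (hT : ∀ g, spRep n h2 hB hχ g * T = T * spRep n h2 hB hχ g) :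
    T ∈ Submodule.span ℂ ((Set.range fun g => oscillatorRep n h2 hB hχ (orthEmb n B g)) ∪
      {D | ∃ e : M, e ≠ 0 ∧ B e e = 0 ∧
        ∀ v : SympSpace n F, D * heisenbergVec h2 hB χ (fun j => v j • e) = D}) := by
  refine Submodule.span_le.mpr ?_ (mem_span_gaussianOp h2 hB hχ hT)
  rintro _ ⟨⟨U, θ₀⟩, rfl⟩
  simp only [SetLike.mem_coe]
  rw [gaussianOp_congr]
  set θ := (2⁻¹ : F) • (θ₀ - θ₀.flip + B) with hθ'
  have hθ : ∀ u v, θ u v + θ v u = B u v := by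
    intro u v
    simp only [hθ', LinearMap.smul_apply, LinearMap.add_apply, LinearMap.sub_apply,
      LinearMap.BilinForm.flip_apply, smul_eq_mul]
    rw [hB.symm v u]
    field_simp
    ring
  by_cases hU : ∀ e ∈ U, (∀ u ∈ U, θ e u = 0) → e = 0
  · obtain ⟨g, c, h⟩ := exists_gaussianOp_eq (n := n) h2 hB hχ hθ hU
    rw [h]
    exact Submodule.smul_mem _ _ (Submodule.subset_span (Or.inl ⟨g, rfl⟩))
  · push Not at hU
    obtain ⟨e, he, heU, he0⟩ := hU
    refine Submodule.subset_span (Or.inr ⟨e, he0, ?_, fun v => ?_⟩)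
    -- The vector e lies in U itself, so B(e, e) = θ(e, e) + θ(e, e) = 0.
    · rw [← hθ, heU e he, add_zero]
    · exact gaussianOp_mul_heisenbergVec h2 hB hθ he heU v

/-! ### The oscillator representation on unipotent elements -/

theorem LinearMap.det_eq_prod_of_diagonal {E ι : Type*} [AddCommGroup E] [Module ℂ E] [Fintype ι]
    (e : E ≃ₗ[ℂ] (ι → ℂ)) (A : Module.End ℂ E) (m : ι → ℂ) (h : ∀ f i, e (A f) i = m i * e f i) :
    LinearMap.det A = ∏ i, m i := by
  classical
  have h1 : e.toLinearMap ∘ₗ A ∘ₗ e.symm.toLinearMap = Matrix.toLin' (Matrix.diagonal m) := by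
    refine LinearMap.ext fun f => funext fun i => ?_
    rw [Matrix.toLin'_apply, Matrix.mulVec_diagonal]
    change e (A (e.symm f)) i = _
    rw [h, e.apply_symm_apply]
  rw [← LinearMap.det_conj A e, h1, LinearMap.det_toLin', Matrix.det_diagonal]

/-- Multiplication by a function. -/
def mulOp {n : ℕ} {M : Type*} (m : (Fin n → M) → ℂ) : Module.End ℂ (Schrodinger n M) where
  toFun f := fun y => m y * f y
  map_add' f g := by funext y; simp [mul_add]
  map_smul' c f := by funext y; simp [mul_left_comm]

theorem mulOp_apply {n : ℕ} {M : Type*} (m : (Fin n → M) → ℂ) (f : Schrodinger n M)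
    (y : Fin n → M) : mulOp m f y = m y * f y := rfl

theorem mulOp_commute_parity {n : ℕ} {M : Type*} [AddCommGroup M] {m : (Fin n → M) → ℂ}
    (hm : ∀ y, m (-y) = m y) : Commute (mulOp m) (parityOp n M) := by
  refine LinearMap.ext fun f => funext fun y => ?_
  change m y * f (-y) = m (-y) * f (-y)
  rw [hm]

/-- Even functions have as coordinates their values at one point of each pair {y, -y}; odd functions
have the same coordinates except the one at y = 0. The two determinants differ by the factor m(0).
The enumeration r chooses the point of each pair. -/
theorem detRatio_mulOp {F M : Type*} [Field F] [AddCommGroup M] [Module F M] [Fintype M] {n : ℕ}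
    (h2 : (2 : F) ≠ 0) {m : (Fin n → M) → ℂ} (hm : ∀ y, m (-y) = m y) (hm0 : ∀ y, m y ≠ 0)
    (h1 : m 0 = 1) : detRatio (mulOp m) (mulOp_commute_parity hm) = 1 := by
  classical
  let r : (Fin n → M) ≃ Fin (Fintype.card (Fin n → M)) := Fintype.equivFin _
  have hneg : ∀ y : Fin n → M, -y = y → y = 0 := by
    intro y h
    funext i
    have h3 := congrFun h i
    have h4 : (2 : F) • y i = 0 := by
      rw [two_smul]
      nth_rewrite 1 [← h3]
      simp
    exact (smul_eq_zero.mp h4).resolve_left h2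
  let eEven : evenFunctions n M ≃ₗ[ℂ] ({y : Fin n → M // r y ≤ r (-y)} → ℂ) :=
    { toFun := fun f y => f.1 y.1
      map_add' := fun f g => rfl
      map_smul' := fun c f => rfl
      invFun := fun h => ⟨fun y => if hy : r y ≤ r (-y) then h ⟨y, hy⟩ else
          h ⟨-y, by rw [neg_neg]; exact (not_le.mp hy).le⟩, fun y => by
        simp only [neg_neg]
        by_cases hy : r y ≤ r (-y)
        · by_cases hy' : r (-y) ≤ r y
          · have h0 := hneg y (r.injective (le_antisymm hy' hy))
            subst h0
            simp
          · rw [dif_neg hy', dif_pos hy]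
        · rw [dif_pos (not_le.mp hy).le, dif_neg hy]⟩
      left_inv := fun f => by
        refine Subtype.ext (funext fun y => ?_)
        by_cases hy : r y ≤ r (-y)
        · exact dif_pos hy
        · exact (dif_neg hy).trans (f.2 y)
      right_inv := fun h => funext fun y => dif_pos y.2 }
  let eOdd : oddFunctions n M ≃ₗ[ℂ] ({y : Fin n → M // r y < r (-y)} → ℂ) :=
    { toFun := fun f y => f.1 y.1
      map_add' := fun f g => rfl
      map_smul' := fun c f => rfl
      invFun := fun h => ⟨fun y => if hy : r y < r (-y) then h ⟨y, hy⟩ else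
          if hy' : r (-y) < r y then -h ⟨-y, by rwa [neg_neg]⟩ else 0, fun y => by
        simp only [neg_neg]
        by_cases hy : r y < r (-y)
        · rw [dif_neg hy.not_gt, dif_pos hy, dif_pos hy]
        · by_cases hy' : r (-y) < r y
          · simp only [dif_pos hy', dif_neg hy, neg_neg]
          · rw [dif_neg hy', dif_neg hy, dif_neg hy, dif_neg hy', neg_zero]⟩
      left_inv := fun f => by
        refine Subtype.ext (funext fun y => ?_)
        change (if hy : r y < r (-y) then f.1 y else
          if hy' : r (-y) < r y then -f.1 (-y) else 0) = f.1 y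
        by_cases hy : r y < r (-y)
        · rw [dif_pos hy]
        · by_cases hy' : r (-y) < r y
          · rw [dif_neg hy, dif_pos hy', f.2 y, neg_neg]
          · rw [dif_neg hy, dif_neg hy']
            have h0 := hneg y (r.injective (le_antisymm (not_lt.mp hy) (not_lt.mp hy')))
            subst h0
            have h3 := f.2 0
            rw [neg_zero] at h3
            exact (self_eq_neg.mp h3).symm
      right_inv := fun h => funext fun y => dif_pos y.2 }
  have e1 := LinearMap.det_eq_prod_of_diagonal eEven
    ((mulOp m).restrict (map_even (mulOp_commute_parity hm))) (fun y => m y.1) fun f y => rfl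
  have e2 := LinearMap.det_eq_prod_of_diagonal eOdd
    ((mulOp m).restrict (map_odd (mulOp_commute_parity hm))) (fun y => m y.1) fun f y => rfl
  unfold detRatio
  rw [e1, e2, ← Finset.prod_subtype (Finset.univ.filter fun y => r y ≤ r (-y)) (by simp) m,
    ← Finset.prod_subtype (Finset.univ.filter fun y => r y < r (-y)) (by simp) m]
  have h3 : (Finset.univ.filter fun y => r y ≤ r (-y)) =
      insert 0 (Finset.univ.filter fun y => r y < r (-y)) := by
    ext y
    simp only [Finset.mem_filter, Finset.mem_univ, true_and, Finset.mem_insert]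
    rw [le_iff_eq_or_lt, r.apply_eq_iff_eq]
    exact or_congr_left ⟨fun h => hneg y h.symm, fun h => by rw [h, neg_zero]⟩
  rw [h3, Finset.prod_insert (by simp), h1, one_mul]
  exact div_self (Finset.prod_ne_zero_iff.mpr fun y _ => hm0 y)

/-- The determinant ratio scales linearly, so it fixes the scalar that the commutation rule leaves
open. -/
theorem oscillatorRep_eq_of_intertwines {F M : Type*} [Field F] [AddCommGroup M] [Module F M]
    [Fintype M] {n : ℕ} (h2 : (2 : F) ≠ 0) {B : LinearMap.BilinForm F M} (hB : IsInnerProduct B)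
    {χ : AddChar F ℂ} (hχ : χ ≠ 1) {g : isometryGroup (sympForm n B)}
    {T : Module.End ℂ (Schrodinger n M)} (hT : Intertwines h2 hB χ g T) (hT0 : T ≠ 0)
    (hP : Commute T (parityOp n M)) (hd : detRatio T hP = 1) :
    oscillatorRep n h2 hB hχ g = T := by
  obtain ⟨c, hc⟩ := (intertwiner_intertwines h2 hB χ g).eq_smul hχ hT hT0
  have hc0 : c ≠ 0 := by
    rintro rfl
    exact intertwiner_ne_zero h2 hB hχ g (by rw [hc, zero_smul])
  have he : detRatio (intertwiner h2 hB χ g) (intertwiner_parity h2 hB χ g) = c := by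
    have e := detRatio_smul h2 hP hc0
    simp only [hc]
    rw [e, hd, mul_one]
  change (detRatio (intertwiner h2 hB χ g) (intertwiner_parity h2 hB χ g))⁻¹ •
    intertwiner h2 hB χ g = T
  rw [he, hc, smul_smul, inv_mul_cancel₀ hc0, one_smul]

theorem matrixAct_eq_of_dual {F M : Type*} [Field F] [AddCommGroup M] [Module F M] {n : ℕ}
    {A : Matrix (Fin n ⊕ Fin n) (Fin n ⊕ Fin n) F} {w w' : SympSpace n M}
    (h : ∀ φ : Module.Dual F M, A.mulVec (fun j => φ (w j)) = fun j => φ (w' j)) :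
    matrixAct A w = w' := by
  funext j
  rw [← sub_eq_zero, ← Module.forall_dual_apply_eq_zero_iff F]
  intro φ
  rw [map_sub, ← congrFun (h φ) j, matrixAct_apply, map_sum, sub_eq_zero]
  exact Finset.sum_congr rfl fun k _ => map_smul _ _ _

/-- The minus sign comes from ⟨v, d⟩ = -(v (inr i₀)) for the basis vector d at inl i₀; it reappears
in the multiplier. -/
theorem matrixAct_of_isSympTransvection {F M : Type*} [Field F] [AddCommGroup M] [Module F M]
    {n : ℕ} {g : Matrix.symplecticGroup (Fin n) F} {i₀ : Fin n} {c : F}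
    (hg : IsSympTransvection g (Pi.single (Sum.inl i₀) 1) c) (w : SympSpace n M) :
    matrixAct g.1 w = w - Pi.single (Sum.inl i₀) (c • w (Sum.inr i₀)) := by
  refine matrixAct_eq_of_dual fun φ => ?_
  rw [hg, stdSymp_apply, Finset.sum_eq_single i₀]
  · funext j
    by_cases hj : j = Sum.inl i₀
    · subst hj
      simp [sub_eq_add_neg]
    · simp [hj]
  · intro i _ hi
    simp [hi]
  · simp

/-- The character of second degree by which a transvection in the Siegel parabolic subgroup acts in
the Schrödinger model. -/
def siegelMultiplier {F M : Type*} [Field F] [AddCommGroup M] [Module F M] {n : ℕ}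
    (B : LinearMap.BilinForm F M) (χ : AddChar F ℂ) (i₀ : Fin n) (c : F) : (Fin n → M) → ℂ :=
  fun y => χ (-(2⁻¹ * c * B (y i₀) (y i₀)))

/-- The multiplier is an even function with value 1 at 0, so the multiplication is correctly
normalized. These are the only values of ω needed explicitly: the transvections involved generate
the group up to conjugation. -/
theorem spRep_eq_mulOp {F M : Type*} [Field F] [AddCommGroup M] [Module F M]
    [Fintype M] {n : ℕ} (h2 : (2 : F) ≠ 0) {B : LinearMap.BilinForm F M} (hB : IsInnerProduct B)
    {χ : AddChar F ℂ} (hχ : χ ≠ 1) {g : Matrix.symplecticGroup (Fin n) F} {i₀ : Fin n} {c : F}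
    (hg : IsSympTransvection g (Pi.single (Sum.inl i₀) 1) c) :
    spRep n h2 hB hχ g = mulOp (siegelMultiplier B χ i₀ c) := by
  have hm : ∀ y, siegelMultiplier B χ i₀ c (-y) = siegelMultiplier B χ i₀ c y := fun y => by
    simp [siegelMultiplier]
  have hm0 : ∀ y, siegelMultiplier B χ i₀ c y ≠ 0 := fun y => AddChar.apply_ne_zero _ _
  have h1 : siegelMultiplier B χ i₀ c (0 : Fin n → M) = 1 := by
    simp [siegelMultiplier]
  refine oscillatorRep_eq_of_intertwines h2 hB hχ (fun h => ?_) (fun h0 => ?_)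
    (mulOp_commute_parity hm) (detRatio_mulOp h2 hm hm0 h1)
  · refine LinearMap.ext fun f => funext fun y => ?_
    have hact : (Heisenberg.act (spEmb n B g) h).vec =
        h.vec - Pi.single (Sum.inl i₀) (c • h.vec (Sum.inr i₀)) :=
      matrixAct_of_isSympTransvection hg h.vec
    have hl : ∀ i, (Heisenberg.act (spEmb n B g) h).vec (Sum.inl i) =
        h.vec (Sum.inl i) - (Pi.single i₀ (c • h.vec (Sum.inr i₀)) : Fin n → M) i := by
      intro i
      rw [hact, Pi.sub_apply]
      congr 1
      by_cases hi : i = i₀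
      · subst hi; simp
      · simp [hi]
    have hr : ∀ i, (Heisenberg.act (spEmb n B g) h).vec (Sum.inr i) = h.vec (Sum.inr i) := by
      intro i
      rw [hact, Pi.sub_apply, Pi.single_eq_of_ne (by simp), sub_zero]
    have hs : ∀ z : Fin n → M, ∑ i, B ((Heisenberg.act (spEmb n B g) h).vec (Sum.inl i)) (z i) =
        ∑ i, B (h.vec (Sum.inl i)) (z i) - c * B (h.vec (Sum.inr i₀)) (z i₀) := by
      intro z
      simp only [hl, map_sub, LinearMap.sub_apply, Finset.sum_sub_distrib]
      congr 1
      rw [Finset.sum_eq_single i₀]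
      · simp
      · intro i _ hi; simp [hi]
      · simp
    have hc : (Heisenberg.act (spEmb n B g) h).cen = h.cen := rfl
    rw [Module.End.mul_apply, Module.End.mul_apply, mulOp_apply, heisenbergRep_apply,
      heisenbergRep_apply, mulOp_apply, hs, hc]
    simp only [hr, hs, siegelMultiplier]
    rw [← mul_assoc, ← mul_assoc, ← AddChar.map_add_eq_mul, ← AddChar.map_add_eq_mul]
    congr 2
    simp only [map_sub, LinearMap.sub_apply]
    rw [hB.symm (y i₀) (h.vec (Sum.inr i₀))]
    field_simp
    ring
  · have h3 := congrFun (LinearMap.congr_fun h0 fun _ => 1) 0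
    rw [mulOp_apply, mul_one] at h3
    exact hm0 _ h3

/-! ### Reduction along an isotropic vector -/

/-- `ι` identifies the space of `B` with a complement of the isotropic vector `e` in its orthogonal
complement with respect to `B'`. -/
structure IsIsotropicReduction {F M M' : Type*} [Field F] [AddCommGroup M] [Module F M]
    [AddCommGroup M'] [Module F M'] (B : LinearMap.BilinForm F M) (B' : LinearMap.BilinForm F M')
    (ι : M →ₗ[F] M') (e : M') : Prop where
  isometry : ∀ x y, B' (ι x) (ι y) = B x y
  isotropic : B' e e = 0
  ne_zero : e ≠ 0
  orthogonal : ∀ x, B' e (ι x) = 0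
  exists_eq : ∀ y, B' e y = 0 → ∃ (x : M) (t : F), y = ι x + t • e

theorem IsIsotropicReduction.eq_of_eq {F M M' : Type*} [Field F] [AddCommGroup M] [Module F M]
    [AddCommGroup M'] [Module F M'] {B : LinearMap.BilinForm F M}
    {B' : LinearMap.BilinForm F M'} {ι : M →ₗ[F] M'} {e : M'}
    (h : IsIsotropicReduction B B' ι e) (hB : IsInnerProduct B) {x y : M} {t : F}
    (hxy : ι x + t • e = ι y) : x = y ∧ t = 0 := by
  have h1 : x = y := by
    rw [← sub_eq_zero]
    refine hB.nondeg _ fun z => ?_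
    have h3 := congrArg (fun u => B' u (ι z)) hxy
    simp only [map_add, map_smul, LinearMap.add_apply, LinearMap.smul_apply, h.isometry,
      h.orthogonal, smul_zero, add_zero] at h3
    rw [map_sub, LinearMap.sub_apply, h3, sub_self]
  subst h1
  exact ⟨rfl, (smul_eq_zero.mp (left_eq_add.mp hxy.symm)).resolve_right h.ne_zero⟩

/-- The map `f ↦ (y ↦ ∑ t, f (ι y + t e))` of Schrödinger models. -/
def reductionMap {F M M' : Type*} [Field F] [Fintype F] [AddCommGroup M] [Module F M]
    [AddCommGroup M'] [Module F M'] (n : ℕ) (ι : M →ₗ[F] M') (e : M') :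
    Schrodinger n M' →ₗ[ℂ] Schrodinger n M where
  toFun f := fun y => ∑ t : Fin n → F, f fun i => ι (y i) + t i • e
  map_add' f g := by funext y; simp [Finset.sum_add_distrib]
  map_smul' c f := by funext y; simp [Finset.mul_sum]

theorem reductionMap_apply {F M M' : Type*} [Field F] [Fintype F] [AddCommGroup M] [Module F M]
    [AddCommGroup M'] [Module F M'] (n : ℕ) (ι : M →ₗ[F] M') (e : M') (f : Schrodinger n M')
    (y : Fin n → M) :
    reductionMap n ι e f y = ∑ t : Fin n → F, f fun i => ι (y i) + t i • e := rfl

theorem heisenbergVec_apply {F M : Type*} [Field F] [AddCommGroup M] [Module F M] {n : ℕ}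
    (h2 : (2 : F) ≠ 0) {B : LinearMap.BilinForm F M} (hB : IsInnerProduct B) (χ : AddChar F ℂ)
    (w : SympSpace n M) (f : Schrodinger n M) (y : Fin n → M) :
    heisenbergVec h2 hB χ w f y =
      χ (∑ i, B (w (Sum.inl i)) (y i) - 2⁻¹ * ∑ i, B (w (Sum.inl i)) (w (Sum.inr i))) *
      f (fun i => y i - w (Sum.inr i)) := by
  unfold heisenbergVec
  rw [heisenbergRep_apply, zero_add]

theorem heisenbergVec_smul_apply {F M : Type*} [Field F] [AddCommGroup M] [Module F M] {n : ℕ}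
    (h2 : (2 : F) ≠ 0) {B : LinearMap.BilinForm F M} (hB : IsInnerProduct B) (χ : AddChar F ℂ)
    {e : M} (he : B e e = 0) (v : SympSpace n F) (f : Schrodinger n M) (y : Fin n → M) :
    heisenbergVec h2 hB χ (fun j => v j • e) f y =
      χ (∑ i, v (Sum.inl i) * B e (y i)) * f (fun i => y i - v (Sum.inr i) • e) := by
  rw [heisenbergVec_apply]
  simp [he]

theorem reductionMap_heisenbergVec {F M M' : Type*} [Field F] [Fintype F] [AddCommGroup M]
    [Module F M] [AddCommGroup M'] [Module F M'] {n : ℕ} (h2 : (2 : F) ≠ 0)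
    {B : LinearMap.BilinForm F M} (hB : IsInnerProduct B) {B' : LinearMap.BilinForm F M'}
    (hB' : IsInnerProduct B') (χ : AddChar F ℂ) {ι : M →ₗ[F] M'} {e : M'}
    (h : IsIsotropicReduction B B' ι e) (w : SympSpace n M) (f : Schrodinger n M') :
    reductionMap n ι e (heisenbergVec h2 hB' χ (fun j => ι (w j)) f) =
      heisenbergVec h2 hB χ w (reductionMap n ι e f) := by
  have ho : ∀ x, B' (ι x) e = 0 := fun x => by rw [hB'.symm, h.orthogonal]
  funext y
  rw [reductionMap_apply, heisenbergVec_apply, reductionMap_apply, Finset.mul_sum]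
  refine Finset.sum_congr rfl fun t _ => ?_
  rw [heisenbergVec_apply]
  simp only [map_add, map_smul, h.isometry, ho, smul_zero, add_zero, map_sub]
  congr 2
  funext i
  abel

/-- On functions restricted to e^⊥ the x-part of V ⊗ e acts trivially, and its y-part shifts the
variable of summation along e. -/
theorem reductionMap_heisenbergVec_smul {F M M' : Type*} [Field F] [Fintype F] [AddCommGroup M]
    [Module F M] [AddCommGroup M'] [Module F M'] {n : ℕ} (h2 : (2 : F) ≠ 0)
    {B : LinearMap.BilinForm F M} {B' : LinearMap.BilinForm F M'}
    (hB' : IsInnerProduct B') (χ : AddChar F ℂ) {ι : M →ₗ[F] M'} {e : M'}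
    (h : IsIsotropicReduction B B' ι e) (v : SympSpace n F) (f : Schrodinger n M') :
    reductionMap n ι e (heisenbergVec h2 hB' χ (fun j => v j • e) f) = reductionMap n ι e f := by
  funext y
  rw [reductionMap_apply, reductionMap_apply]
  refine Fintype.sum_equiv (Equiv.subRight fun i => v (Sum.inr i)) _ _ fun t => ?_
  rw [heisenbergVec_smul_apply h2 hB' χ h.isotropic]
  simp only [map_add, map_smul, h.orthogonal, h.isotropic, smul_zero, add_zero, mul_zero,
    Finset.sum_const_zero, AddChar.map_zero_eq_one, one_mul]
  congr 1
  funext i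
  change ι (y i) + t i • e - v (Sum.inr i) • e = ι (y i) + (t i - v (Sum.inr i)) • e
  rw [sub_smul]
  abel

/-- Summing over the x-part of V ⊗ e kills the values at points outside e^⊥, by orthogonality of
characters. At points of e^⊥ the sum over the y-part is a value of the reduction. So the reduction
loses no more than averaging over V ⊗ e does. -/
theorem sum_heisenbergVec_smul_eq_zero {F M M' : Type*} [Field F] [Fintype F] [AddCommGroup M]
    [Module F M] [AddCommGroup M'] [Module F M'] {n : ℕ} (h2 : (2 : F) ≠ 0)
    {B : LinearMap.BilinForm F M} {B' : LinearMap.BilinForm F M'}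
    (hB' : IsInnerProduct B') {χ : AddChar F ℂ} (hχ : χ ≠ 1) {ι : M →ₗ[F] M'} {e : M'}
    (h : IsIsotropicReduction B B' ι e) {f : Schrodinger n M'} (hf : reductionMap n ι e f = 0) :
    ∑ v : SympSpace n F, heisenbergVec h2 hB' χ (fun j => v j • e) f = 0 := by
  classical
  funext y
  rw [Finset.sum_apply]
  simp only [heisenbergVec_smul_apply h2 hB' χ h.isotropic]
  rw [← (Equiv.sumArrowEquivProdArrow (Fin n) (Fin n) F).symm.sum_comp, Fintype.sum_prod_type]
  change ∑ x : Fin n → F, ∑ t : Fin n → F, χ (∑ i, x i * B' e (y i)) *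
    f (fun i => y i - t i • e) = 0
  by_cases hy : ∀ i, B' e (y i) = 0
  · choose u s hus using fun i => h.exists_eq (y i) (hy i)
    refine Finset.sum_eq_zero fun x _ => ?_
    rw [← Finset.mul_sum]
    have h1 := congrFun hf u
    rw [reductionMap_apply, Pi.zero_apply] at h1
    rw [← h1, Fintype.sum_equiv (Equiv.subLeft s) _
      (fun t => f fun i => ι (u i) + t i • e) fun t => ?_, h1, mul_zero]
    congr 1
    funext i
    change y i - t i • e = ι (u i) + (s i - t i) • e
    rw [hus, sub_smul]
    abel
  · push Not at hy
    obtain ⟨i, hi⟩ := hy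
    rw [Finset.sum_comm]
    refine Finset.sum_eq_zero fun t _ => ?_
    rw [← Finset.sum_mul]
    let L : (Fin n → F) →+ F :=
      { toFun := fun x => ∑ i, x i * B' e (y i)
        map_zero' := by simp
        map_add' := fun x x' => by simp [Finset.sum_add_distrib, add_mul] }
    have hne : χ.compAddMonoidHom L ≠ 0 := by
      intro h1
      apply hχ
      ext r
      have h3 := DFunLike.congr_fun h1 (Pi.single i (r / B' e (y i)))
      have h4 : L (Pi.single i (r / B' e (y i))) = r := by
        change ∑ j, (Pi.single i (r / B' e (y i)) : Fin n → F) j * B' e (y j) = r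
        rw [Finset.sum_eq_single i]
        · rw [Pi.single_eq_same, div_mul_cancel₀ _ hi]
        · intro j _ hj
          simp [hj]
        · simp
      rw [AddChar.compAddMonoidHom_apply, h4] at h3
      simpa using h3
    have h5 : ∑ x : Fin n → F, χ (∑ i, x i * B' e (y i)) = 0 :=
      AddChar.sum_eq_zero_iff_ne_zero.mpr hne
    rw [h5, zero_mul]

/-- A map that does not change under translation by `V ⊗ e` vanishes where the reduction does. -/
theorem eq_zero_of_reductionMap_eq_zero {F M M' E : Type*} [Field F] [Fintype F] [AddCommGroup M]
    [Module F M] [AddCommGroup M'] [Module F M'] [AddCommGroup E] [Module ℂ E] {n : ℕ}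
    (h2 : (2 : F) ≠ 0) {B : LinearMap.BilinForm F M} {B' : LinearMap.BilinForm F M'}
    (hB' : IsInnerProduct B') {χ : AddChar F ℂ} (hχ : χ ≠ 1) {ι : M →ₗ[F] M'} {e : M'}
    (h : IsIsotropicReduction B B' ι e) {D : Schrodinger n M' →ₗ[ℂ] E}
    (hD : ∀ (v : SympSpace n F) f, D (heisenbergVec h2 hB' χ (fun j => v j • e) f) = D f)
    {f : Schrodinger n M'} (hf : reductionMap n ι e f = 0) : D f = 0 := by
  -- All terms of the sum over V ⊗ e have the same image D f, and their number is invertible in ℂ.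
  have h1 := congrArg D (sum_heisenbergVec_smul_eq_zero h2 hB' hχ h hf)
  rw [map_sum, map_zero, Finset.sum_congr rfl fun v _ => hD v f, Finset.sum_const,
    ← Nat.cast_smul_eq_nsmul ℂ] at h1
  exact (smul_eq_zero.mp h1).resolve_left (Nat.cast_ne_zero.mpr (Finset.card_ne_zero.mpr Finset.univ_nonempty))

-- Distinct points ι y + t e have distinct (y, t), so the line along e through a point of the image
-- of ι meets that image once. In particular the reduction is surjective.
open scoped Classical in
theorem reductionMap_single {F M M' : Type*} [Field F] [Fintype F] [AddCommGroup M]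
    [Module F M] [AddCommGroup M'] [Module F M'] {n : ℕ}
    {B : LinearMap.BilinForm F M} (hB : IsInnerProduct B) {B' : LinearMap.BilinForm F M'}
    {ι : M →ₗ[F] M'} {e : M'} (h : IsIsotropicReduction B B' ι e) (y : Fin n → M) :
    reductionMap n ι e (Pi.single (fun i => ι (y i)) 1) = Pi.single y 1 := by
  funext z
  rw [reductionMap_apply]
  by_cases hz : z = y
  · subst hz
    rw [Finset.sum_eq_single 0]
    · simp
    · intro t _ ht
      rw [Pi.single_eq_of_ne]
      intro h1
      exact ht (funext fun i => (h.eq_of_eq hB (congrFun h1 i)).2)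
    · simp
  · rw [Pi.single_eq_of_ne hz]
    refine Finset.sum_eq_zero fun t _ => ?_
    rw [Pi.single_eq_of_ne]
    intro h1
    exact hz (funext fun i => (h.eq_of_eq hB (congrFun h1 i)).1)

open scoped Classical in
/-- Equivariant maps between the two Schrödinger models are multiples of the reduction. -/
theorem exists_eq_smul_reductionMap {F M M' : Type*} [Field F] [Fintype F] [AddCommGroup M]
    [Module F M] [Fintype M] [AddCommGroup M'] [Module F M'] {n : ℕ}
    (h2 : (2 : F) ≠ 0) {B : LinearMap.BilinForm F M} (hB : IsInnerProduct B)
    {B' : LinearMap.BilinForm F M'} (hB' : IsInnerProduct B') {χ : AddChar F ℂ} (hχ : χ ≠ 1)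
    {ι : M →ₗ[F] M'} {e : M'} (h : IsIsotropicReduction B B' ι e)
    {X : Schrodinger n M' →ₗ[ℂ] Schrodinger n M}
    (hX : ∀ (v : SympSpace n F) f, X (heisenbergVec h2 hB' χ (fun j => v j • e) f) = X f)
    (hXι : ∀ (w : SympSpace n M) f,
      X (heisenbergVec h2 hB' χ (fun j => ι (w j)) f) = heisenbergVec h2 hB χ w (X f)) :
    ∃ c : ℂ, X = c • reductionMap n ι e := by
  let δ : Schrodinger n M' := Pi.single 0 1
  have hRδ : reductionMap n ι e δ = Pi.single 0 1 := by
    have h1 := reductionMap_single hB h (0 : Fin n → M)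
    have h3 : (fun i => ι ((0 : Fin n → M) i)) = (0 : Fin n → M') := by
      funext i
      exact map_zero ι
    rwa [h3] at h1
  -- The delta function at 0 is fixed by the multiplication operators of the x-part of V ⊗ ι M, so
  -- its image is fixed by those of V ⊗ M and is supported at 0. This determines the scalar.
  have hXδ : X δ = X δ 0 • (Pi.single 0 1 : Schrodinger n M) := by
    funext y
    by_cases hy : y = 0
    · subst hy
      simp
    · rw [Pi.smul_apply, Pi.single_eq_of_ne hy, smul_zero]
      obtain ⟨i, hi⟩ := Function.ne_iff.mp hy
      obtain ⟨m, hm⟩ : ∃ m, B (y i) m ≠ 0 := by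
        by_contra hcon
        push Not at hcon
        exact hi (hB.nondeg _ hcon)
      obtain ⟨t, ht⟩ : ∃ t, χ t ≠ 1 := by
        by_contra hcon
        push Not at hcon
        exact hχ (by ext t; simpa using hcon t)
      let w : SympSpace n M := Pi.single (Sum.inl i) ((t / B (y i) m) • m)
      have h1 := congrFun (hXι w δ) y
      have h3 : heisenbergVec h2 hB' χ (fun j => ι (w j)) δ = δ := by
        funext z
        rw [heisenbergVec_apply]
        have e1 : ∀ k, w (Sum.inr k) = 0 := fun k => by simp [w]
        simp only [e1, map_zero, sub_zero, Finset.sum_const_zero, mul_zero]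
        by_cases hz : z = 0
        · subst hz
          simp
          rfl
        · simp only [δ]
          rw [Pi.single_eq_of_ne hz, mul_zero]
      have h4 : ∑ k, B (w (Sum.inl k)) (y k) = t := by
        rw [Finset.sum_eq_single i]
        · simp only [w, Pi.single_eq_same]
          rw [hB.symm, map_smul, smul_eq_mul, div_mul_cancel₀ _ hm]
        · intro k _ hk
          simp [w, hk]
        · simp
      rw [h3, heisenbergVec_apply, h4] at h1
      have e1 : ∀ k, w (Sum.inr k) = 0 := fun k => by simp [w]
      simp only [e1, map_zero, sub_zero, Finset.sum_const_zero, mul_zero] at h1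
      have h5 : (χ t - 1) * X δ y = 0 := by
        linear_combination -h1
      exact (mul_eq_zero.mp h5).resolve_left (sub_ne_zero.mpr ht)
  refine ⟨X δ 0, ?_⟩
  rw [← sub_eq_zero]
  -- The difference has the covariance of X and kills δ, hence all translates of δ by the image of
  -- ι.
  set Z : Schrodinger n M' →ₗ[ℂ] Schrodinger n M := X - X δ 0 • reductionMap n ι e with hZ
  have hZv : ∀ (v : SympSpace n F) f,
      Z (heisenbergVec h2 hB' χ (fun j => v j • e) f) = Z f := by
    intro v f
    simp only [hZ, LinearMap.sub_apply, LinearMap.smul_apply, hX,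
      reductionMap_heisenbergVec_smul h2 hB' χ h]
  have hZι : ∀ (w : SympSpace n M) f,
      Z (heisenbergVec h2 hB' χ (fun j => ι (w j)) f) = heisenbergVec h2 hB χ w (Z f) := by
    intro w f
    simp only [hZ, LinearMap.sub_apply, LinearMap.smul_apply, hXι,
      reductionMap_heisenbergVec h2 hB hB' χ h, map_sub, map_smul]
  have hZδ : Z δ = 0 := by
    rw [hZ, LinearMap.sub_apply, LinearMap.smul_apply, hRδ, ← hXδ, sub_self]
  have hZy : ∀ y : Fin n → M, Z (Pi.single (fun i => ι (y i)) 1) = 0 := by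
    intro y
    have h1 : heisenbergVec h2 hB' χ (fun j => ι ((Sum.elim 0 y : SympSpace n M) j)) δ =
        Pi.single (fun i => ι (y i)) 1 := by
      funext z
      rw [heisenbergVec_apply]
      simp only [Sum.elim_inl, Sum.elim_inr, Pi.zero_apply, map_zero, LinearMap.zero_apply,
        Finset.sum_const_zero, mul_zero, sub_zero, AddChar.map_zero_eq_one, one_mul, δ]
      by_cases hz : z = fun i => ι (y i)
      · subst hz
        simp only [sub_self, Pi.single_eq_same]
        exact Pi.single_eq_same (M := fun _ => ℂ) (0 : Fin n → M') 1
      · rw [Pi.single_eq_of_ne hz, Pi.single_eq_of_ne]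
        intro h0
        exact hz (funext fun i => sub_eq_zero.mp (congrFun h0 i))
    rw [← h1, hZι, hZδ, map_zero]
  refine LinearMap.ext fun f => ?_
  -- A combination of these translates with the same reduction as f; on the remainder f - f', whose
  -- reduction is zero, Z vanishes by invariance under V ⊗ e.
  let f' : Schrodinger n M' := ∑ y, reductionMap n ι e f y • Pi.single (fun i => ι (y i)) 1
  have h1 : reductionMap n ι e (f - f') = 0 := by
    simp only [f', map_sub, map_sum, map_smul, reductionMap_single hB h]
    rw [sub_eq_zero]
    funext z
    simp [Finset.sum_apply, Pi.single_apply]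
  have h3 := eq_zero_of_reductionMap_eq_zero h2 hB' hχ h hZv h1
  have h4 : Z f' = 0 := by
    rw [map_sum]
    exact Finset.sum_eq_zero fun y _ => by rw [map_smul, hZy, smul_zero]
  rw [map_sub, h4, sub_zero] at h3
  exact h3

/-! ### Equivariance of the reduction and transitivity on isotropic vectors -/

theorem isSympTransvection_conj {n : ℕ} {F : Type*} [Field F]
    {g : Matrix.symplecticGroup (Fin n) F} {d : SympSpace n F} {c : F}
    (hg : IsSympTransvection g d c) (h : Matrix.symplecticGroup (Fin n) F) :
    IsSympTransvection (h * g * h⁻¹) (h.1.mulVec d) c := by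
  intro v
  have h1 : h.1.mulVec ((h⁻¹).1.mulVec v) = v := by
    rw [Matrix.mulVec_mulVec, ← Submonoid.coe_mul, mul_inv_cancel, Submonoid.coe_one,
      Matrix.one_mulVec]
  rw [Submonoid.coe_mul, Submonoid.coe_mul, ← Matrix.mulVec_mulVec, ← Matrix.mulVec_mulVec, hg,
    Matrix.mulVec_add, Matrix.mulVec_smul, h1]
  congr 3
  rw [← stdSymp_mulVec h, h1]

theorem IsSympTransvection.unique {n : ℕ} {F : Type*} [Field F]
    {g g' : Matrix.symplecticGroup (Fin n) F} {d : SympSpace n F} {c : F}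
    (hg : IsSympTransvection g d c) (hg' : IsSympTransvection g' d c) : g = g' :=
  Subtype.ext (Matrix.ext_of_mulVec_single fun _ => (hg _).trans (hg' _).symm)

theorem spRep_mul_inv {F M : Type*} [Field F] [AddCommGroup M] [Module F M]
    [Fintype M] {n : ℕ} (h2 : (2 : F) ≠ 0) {B : LinearMap.BilinForm F M} (hB : IsInnerProduct B)
    {χ : AddChar F ℂ} (hχ : χ ≠ 1) (g : Matrix.symplecticGroup (Fin n) F) (f : Schrodinger n M) :
    spRep n h2 hB hχ g (spRep n h2 hB hχ g⁻¹ f) = f := by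
  rw [← Module.End.mul_apply, ← map_mul, mul_inv_cancel, map_one, Module.End.one_apply]

theorem spRep_inv_mul {F M : Type*} [Field F] [AddCommGroup M] [Module F M]
    [Fintype M] {n : ℕ} (h2 : (2 : F) ≠ 0) {B : LinearMap.BilinForm F M} (hB : IsInnerProduct B)
    {χ : AddChar F ℂ} (hχ : χ ≠ 1) (g : Matrix.symplecticGroup (Fin n) F) (f : Schrodinger n M) :
    spRep n h2 hB hχ g⁻¹ (spRep n h2 hB hχ g f) = f := by
  rw [← Module.End.mul_apply, ← map_mul, inv_mul_cancel, map_one, Module.End.one_apply]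

theorem spRep_heisenbergVec_apply {F M : Type*} [Field F] [AddCommGroup M] [Module F M]
    [Fintype M] {n : ℕ} (h2 : (2 : F) ≠ 0) {B : LinearMap.BilinForm F M} (hB : IsInnerProduct B)
    {χ : AddChar F ℂ} (hχ : χ ≠ 1) (g : Matrix.symplecticGroup (Fin n) F) (w : SympSpace n M)
    (f : Schrodinger n M) :
    spRep n h2 hB hχ g (heisenbergVec h2 hB χ w f) =
      heisenbergVec h2 hB χ (matrixAct g.1 w) (spRep n h2 hB hχ g f) :=
  LinearMap.congr_fun (spRep_heisenbergVec h2 hB hχ g w) f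

/-- The reduction commutes with the symplectic group up to scalars. -/
theorem exists_reductionMap_spRep_eq_smul {F M M' : Type*} [Field F] [Fintype F] [AddCommGroup M]
    [Module F M] [Fintype M] [AddCommGroup M'] [Module F M'] [Fintype M'] {n : ℕ}
    (h2 : (2 : F) ≠ 0) {B : LinearMap.BilinForm F M} (hB : IsInnerProduct B)
    {B' : LinearMap.BilinForm F M'} (hB' : IsInnerProduct B') {χ : AddChar F ℂ} (hχ : χ ≠ 1)
    {ι : M →ₗ[F] M'} {e : M'} (h : IsIsotropicReduction B B' ι e)
    (g : Matrix.symplecticGroup (Fin n) F) :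
    ∃ c : ℂ, ∀ f, reductionMap n ι e (spRep n h2 hB' hχ g f) =
      c • spRep n h2 hB hχ g (reductionMap n ι e f) := by
  -- Since g preserves V ⊗ e and commutes with ι, the reduction conjugated by g has the same
  -- covariance as the reduction.
  obtain ⟨c, hc⟩ := exists_eq_smul_reductionMap h2 hB hB' hχ h
    (X := spRep n h2 hB hχ g⁻¹ ∘ₗ reductionMap n ι e ∘ₗ spRep n h2 hB' hχ g)
    (fun v f => by
      have e1 : matrixAct (M := M') g.1 (fun j => v j • e) = fun j => g.1.mulVec v j • e := by
        funext j
        rw [matrixAct_apply, Matrix.mulVec, dotProduct, Finset.sum_smul]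
        exact Finset.sum_congr rfl fun k _ => smul_smul _ _ _
      simp only [LinearMap.comp_apply, spRep_heisenbergVec_apply, e1,
        reductionMap_heisenbergVec_smul h2 hB' χ h])
    (fun w f => by
      have e1 : matrixAct (M := M') g.1 (fun j => ι (w j)) = fun j => ι (matrixAct g.1 w j) := by
        funext j
        simp [matrixAct_apply]
      have e3 : matrixAct (g⁻¹).1 (matrixAct g.1 w) = w := by
        rw [← LinearMap.comp_apply, ← matrixAct_mul, ← Submonoid.coe_mul, inv_mul_cancel,
          Submonoid.coe_one, matrixAct_one, LinearMap.id_apply]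
      simp only [LinearMap.comp_apply, spRep_heisenbergVec_apply, e1,
        reductionMap_heisenbergVec h2 hB hB' χ h, e3])
  refine ⟨c, fun f => ?_⟩
  have h1 := LinearMap.congr_fun hc f
  simp only [LinearMap.comp_apply, LinearMap.smul_apply] at h1
  rw [← spRep_mul_inv h2 hB hχ g (reductionMap n ι e (spRep n h2 hB' hχ g f)), h1, map_smul]

/-- The reduction commutes with the symplectic group. -/
theorem reductionMap_spRep {F M M' : Type*} [Field F] [Fintype F] [AddCommGroup M]
    [Module F M] [Fintype M] [AddCommGroup M'] [Module F M'] [Fintype M'] {n : ℕ}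
    (h2 : (2 : F) ≠ 0) {B : LinearMap.BilinForm F M} (hB : IsInnerProduct B)
    {B' : LinearMap.BilinForm F M'} (hB' : IsInnerProduct B') {χ : AddChar F ℂ} (hχ : χ ≠ 1)
    {ι : M →ₗ[F] M'} {e : M'} (h : IsIsotropicReduction B B' ι e)
    (g : Matrix.symplecticGroup (Fin n) F) :
    ∀ f, reductionMap n ι e (spRep n h2 hB' hχ g f) =
      spRep n h2 hB hχ g (reductionMap n ι e f) := by
  classical
  let P : Subgroup (Matrix.symplecticGroup (Fin n) F) :=
    { carrier := {g | ∀ f, reductionMap n ι e (spRep n h2 hB' hχ g f) =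
        spRep n h2 hB hχ g (reductionMap n ι e f)}
      one_mem' := fun f => by rw [map_one, map_one]; rfl
      mul_mem' := fun {a b} ha hb f => by
        rw [map_mul, map_mul, Module.End.mul_apply, Module.End.mul_apply, ha, hb]
      inv_mem' := fun {a} ha f => by
        rw [← spRep_inv_mul h2 hB hχ a (reductionMap n ι e _), ← ha, spRep_mul_inv] }
  -- P is stable under conjugation although b need not be known to lie in P: the scalars of b and
  -- b⁻¹ cancel. They are compared on a function with non-zero reduction.
  have hconj : ∀ a ∈ P, ∀ b, b * a * b⁻¹ ∈ P := by
    intro a ha b f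
    obtain ⟨c, hc⟩ := exists_reductionMap_spRep_eq_smul h2 hB hB' hχ h b
    obtain ⟨c', hc'⟩ := exists_reductionMap_spRep_eq_smul h2 hB hB' hχ h b⁻¹
    have hcc : c * c' = 1 := by
      have h1 := reductionMap_single hB h (0 : Fin n → M)
      set f₀ : Schrodinger n M' := Pi.single (fun i => ι ((0 : Fin n → M) i)) 1 with hf₀
      have h3 : reductionMap n ι e f₀ = (c * c') • reductionMap n ι e f₀ := by
        conv_lhs => rw [← spRep_mul_inv h2 hB' hχ b f₀, hc, hc', map_smul, spRep_mul_inv, smul_smul]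
      rw [h1] at h3
      have h4 := congrFun h3 0
      simpa using h4.symm
    rw [map_mul, map_mul, map_mul, map_mul, Module.End.mul_apply, Module.End.mul_apply,
      Module.End.mul_apply, Module.End.mul_apply, hc, ha, hc', map_smul, map_smul, smul_smul, hcc,
      one_smul]
  -- The two multipliers agree because B'(ι y + t e, ι y + t e) = B(y, y). This is where the
  -- normalizations at the two levels are matched.
  have hsiegel : ∀ a i₀ c, IsSympTransvection a (Pi.single (Sum.inl i₀) 1) c → a ∈ P := by
    intro a i₀ c ha f
    rw [spRep_eq_mulOp h2 hB hχ ha, spRep_eq_mulOp h2 hB' hχ ha]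
    have ho : ∀ x, B' (ι x) e = 0 := fun x => by rw [hB'.symm, h.orthogonal]
    funext y
    rw [reductionMap_apply, mulOp_apply, reductionMap_apply, Finset.mul_sum]
    refine Finset.sum_congr rfl fun t _ => ?_
    rw [mulOp_apply]
    congr 1
    simp only [siegelMultiplier, map_add, map_smul, LinearMap.add_apply, LinearMap.smul_apply,
      h.isometry, ho, h.orthogonal, h.isotropic, smul_zero, add_zero]
  have hP : transvectionSubgroup n F ≤ P := by
    refine (Subgroup.closure_le P).mpr ?_
    rintro a ⟨d, c, ha⟩
    by_cases hd : d = 0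
    · have h1 : a = 1 := Subtype.ext (Matrix.ext_of_mulVec_single fun j => by
        rw [ha, hd, smul_zero, add_zero, Submonoid.coe_one, Matrix.one_mulVec])
      rw [h1]
      exact P.one_mem
    · obtain ⟨j, -⟩ := Function.ne_iff.mp hd
      -- Any index will do; a non-zero d guarantees that one exists.
      let i₀ : Fin n := j.elim id id
      have he : (Pi.single (Sum.inl i₀) 1 : SympSpace n F) ≠ 0 := by simp
      obtain ⟨b, hb⟩ := exists_mulVec_eq_of_ne_zero he hd
      obtain ⟨a', ha'⟩ := exists_isSympTransvection (Pi.single (Sum.inl i₀) 1 : SympSpace n F) c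
      have h1 := isSympTransvection_conj ha' b
      rw [hb] at h1
      rw [SetLike.mem_coe, ha.unique h1]
      exact hconj a' (hsiegel a' i₀ c ha') b
  rw [transvectionSubgroup_eq_top] at hP
  exact hP (Subgroup.mem_top g)

/-- Non-zero isotropic vectors are conjugate under the isometry group. -/
theorem exists_isometry_apply_eq {F M : Type*} [Field F] [AddCommGroup M] [Module F M] [Finite M]
    (h2 : (2 : F) ≠ 0) {B : LinearMap.BilinForm F M} (hB : IsInnerProduct B) {x y : M}
    (hx0 : x ≠ 0) (hy0 : y ≠ 0) (hx : B x x = 0) (hy : B y y = 0) :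
    ∃ g : isometryGroup B, g.1 x = y := by
  have : Module.Finite F M := Module.Finite.of_finite
  have hrefl : ∀ x y, B x x = 0 → B y y = 0 → B x y ≠ 0 → ∃ g : isometryGroup B, g.1 x = y := by
    intro x y hx hy hxy
    -- The reflection in x - y, whose square length is -2 B(x, y); it takes x to y.
    let s : M →ₗ[F] M := LinearMap.id + ((B x y)⁻¹ • B.flip (x - y)).smulRight (x - y)
    have hs : ∀ v, s v = v + ((B x y)⁻¹ * B v (x - y)) • (x - y) := fun v => rfl
    have hiso : ∀ u v, B (s u) (s v) = B u v := by
      intro u v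
      rw [hs, hs]
      simp only [map_add, map_sub, map_smul, LinearMap.add_apply, LinearMap.sub_apply,
        LinearMap.smul_apply, smul_eq_mul, hx, hy]
      rw [hB.symm y x, hB.symm x v, hB.symm y v]
      field_simp
      ring
    have hinj : Function.Injective s := by
      rw [← LinearMap.ker_eq_bot, LinearMap.ker_eq_bot']
      intro v hv
      refine hB.nondeg v fun u => ?_
      rw [← hiso, hv, map_zero, LinearMap.zero_apply]
    refine ⟨⟨LinearEquiv.ofInjectiveEndo s hinj, hiso⟩, ?_⟩
    change s x = y
    rw [hs, map_sub, hx, zero_sub, mul_neg, inv_mul_cancel₀ hxy, neg_one_smul]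
    abel
  by_cases hxy : B x y = 0
  swap
  · exact hrefl x y hx hy hxy
  have hsep : ∀ x, x ≠ 0 → ∃ h, B x h ≠ 0 := by
    intro x hx0
    by_contra hcon
    push Not at hcon
    exact hx0 (hB.nondeg _ hcon)
  obtain ⟨k, h1, h3⟩ : ∃ k, B x k ≠ 0 ∧ B y k ≠ 0 := by
    obtain ⟨a, hxa⟩ := hsep x hx0
    obtain ⟨b, hyb⟩ := hsep y hy0
    by_cases hya : B y a = 0
    swap
    · exact ⟨a, hxa, hya⟩
    by_cases hxb : B x b = 0
    swap
    · exact ⟨b, hxb, hyb⟩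
    refine ⟨a + b, ?_, ?_⟩
    · rwa [map_add, hxb, add_zero]
    · rwa [map_add, hya, zero_add]
  -- If B(x, y) = 0, two reflections through z suffice. The multiple of x makes z isotropic and
  -- changes neither B(x, k) nor B(k, y).
  let z := k - (B k k / (2 * B x k)) • x
  have hz : B z z = 0 := by
    simp only [z, map_sub, map_smul, LinearMap.sub_apply, LinearMap.smul_apply, smul_eq_mul, hx]
    rw [hB.symm k x]
    field_simp
    ring
  have hxz : B x z ≠ 0 := by
    simpa only [z, map_sub, map_smul, hx, smul_zero, sub_zero] using h1
  have hzy : B z y ≠ 0 := by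
    rw [hB.symm]
    simpa only [z, map_sub, map_smul, hB.symm y x, hxy, smul_zero, sub_zero] using h3
  obtain ⟨g, hg⟩ := hrefl x z hx hz hxz
  obtain ⟨g', hg'⟩ := hrefl z y hz hy hzy
  exact ⟨g' * g, by rw [← hg', ← hg]; rfl⟩

/-! ### The new part -/

theorem exists_subrepresentation_of_mem_spectrumOf {G E : Type*} [Group G] [AddCommGroup E]
    [Module ℂ E] {ρ : Representation ℂ G E} {σ : IrrepOf G} (hσ : σ.cls ∈ spectrumOf ρ) :
    AppearsIn σ ρ := by
  obtain ⟨σ', h, N, ⟨e⟩⟩ := hσ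
  obtain ⟨e'⟩ := IrrepOf.cls_eq_iff.mp h
  exact ⟨N, ⟨e.trans e'⟩⟩

/-- The irreducible representations occurring in a sum of isotypic components. -/
theorem cls_mem_iff_nontrivial {G E : Type*} [Group G] [Finite G] [AddCommGroup E] [Module ℂ E]
    {ρ : Representation ℂ G E} {S : Set (GroupDual G)} (hS : S ⊆ spectrumOf ρ)
    {r : Representation ℂ G (isotypicSum ρ S)} (hr : ∀ g v, (r g v : E) = ρ g v) (σ : IrrepOf G) :
    σ.cls ∈ S ↔ Nontrivial (σ.rep.IntertwiningMap r) := by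
  constructor
  · intro hσ
    obtain ⟨N, ⟨e⟩⟩ := exists_subrepresentation_of_mem_spectrumOf (hS hσ)
    have hmem : N.toSubmodule ≤ isotypicPart ρ σ := le_sSup ⟨N, rfl, ⟨e⟩⟩
    have hle : N.toSubmodule ≤ isotypicSum ρ S :=
      le_trans hmem
        (le_iSup₂ (f := fun (σ : IrrepOf G) (_ : σ.cls ∈ S) => isotypicPart ρ σ) σ hσ)
    let f : σ.rep.IntertwiningMap r :=
      { toLinearMap := Submodule.inclusion hle ∘ₗ e.symm.toLinearMap
        isIntertwining' := fun g => LinearMap.ext fun v => Subtype.ext <| by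
          have h := e.symm.toIntertwiningMap.isIntertwining _ _ g v
          exact (congrArg Subtype.val h).trans
            (hr g (Submodule.inclusion hle (e.symm v))).symm }
    have := σ.irred.nontrivial
    obtain ⟨v, hv⟩ := exists_ne (0 : Fin σ.dim → ℂ)
    refine ⟨f, 0, fun h0 => hv ?_⟩
    have h1 : f v = 0 := DFunLike.congr_fun h0 v
    have h3 : Submodule.inclusion hle (e.symm v) = 0 := h1
    rw [map_eq_zero_iff _ (Submodule.inclusion_injective hle)] at h3
    exact (map_eq_zero_iff e.symm (EquivLike.injective e.symm)).mp h3
  · intro hnt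
    have := σ.irred
    obtain ⟨f, hf⟩ := exists_ne (0 : σ.rep.IntertwiningMap r)
    obtain ⟨p, hp⟩ := f.exists_leftInverse
      ((Representation.IsIrreducible.injective_or_eq_zero f).resolve_right hf)
    by_contra hσ
    -- If the class of σ were not in S, the left inverse p would vanish by Schur on every summand
    -- that defines the isotypic sum, hence on all of it.
    have hker : isotypicSum ρ S ≤
        (LinearMap.ker p.toLinearMap).map (isotypicSum ρ S).subtype := by
      refine iSup₂_le fun σ' hσ' => sSup_le ?_
      rintro _ ⟨N, rfl, ⟨e⟩⟩
      have hmem : N.toSubmodule ≤ isotypicPart ρ σ' := le_sSup ⟨N, rfl, ⟨e⟩⟩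
      have hle : N.toSubmodule ≤ isotypicSum ρ S :=
        le_trans hmem
          (le_iSup₂ (f := fun (σ : IrrepOf G) (_ : σ.cls ∈ S) => isotypicPart ρ σ) σ' hσ')
      let q : σ'.rep.IntertwiningMap σ.rep :=
        { toLinearMap := p.toLinearMap ∘ₗ Submodule.inclusion hle ∘ₗ e.symm.toLinearMap
          isIntertwining' := fun g => LinearMap.ext fun v => by
            have h := e.symm.toIntertwiningMap.isIntertwining _ _ g v
            have h1 : Submodule.inclusion hle (e.symm (σ'.rep g v)) =
                r g (Submodule.inclusion hle (e.symm v)) :=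
              Subtype.ext ((congrArg Subtype.val h).trans
                (hr g (Submodule.inclusion hle (e.symm v))).symm)
            change p (Submodule.inclusion hle (e.symm (σ'.rep g v))) = _
            rw [h1, p.isIntertwining]
            rfl }
      have := σ'.irred
      have hq : q = 0 := by
        refine (Representation.IsIrreducible.bijective_or_eq_zero q).resolve_left fun hb => hσ ?_
        rw [← IrrepOf.cls_eq_iff.mpr ⟨q.ofBijective hb⟩]
        exact hσ'
      intro v hv
      refine ⟨⟨v, hle hv⟩, ?_, rfl⟩
      have h3 : q (e ⟨v, hv⟩) = 0 := by rw [hq]; rfl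
      change p (Submodule.inclusion hle (e.symm (e ⟨v, hv⟩))) = 0 at h3
      rw [Representation.Equiv.symm_apply_apply] at h3
      exact h3
    apply hf
    refine DFunLike.ext _ _ fun v => ?_
    obtain ⟨u, hu, hfu⟩ := hker (f v).2
    have h1 : u = f v := Subtype.ext hfu
    rw [h1] at hu
    have h3 : p (f v) = 0 := hu
    rw [hp] at h3
    rw [h3, map_zero]
    rfl

/-- An equivariant map kills the isotypic components of classes that do not occur in the target. -/
theorem map_isotypicSum_eq_zero {G E E' : Type*} [Group G] [AddCommGroup E] [Module ℂ E]
    [AddCommGroup E'] [Module ℂ E'] {ρ : Representation ℂ G E} {ρ' : Representation ℂ G E'}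
    {S : Set (GroupDual G)} (hS : Disjoint S (spectrumOf ρ')) (R : E →ₗ[ℂ] E')
    (hR : ∀ g v, R (ρ g v) = ρ' g (R v)) {v : E} (hv : v ∈ isotypicSum ρ S) : R v = 0 := by
  suffices h : isotypicSum ρ S ≤ LinearMap.ker R from h hv
  refine iSup₂_le fun σ hσ => sSup_le ?_
  rintro _ ⟨N, rfl, ⟨e⟩⟩
  let q : σ.rep.IntertwiningMap ρ' :=
    { toLinearMap := R ∘ₗ N.toSubmodule.subtype ∘ₗ e.symm.toLinearMap
      isIntertwining' := fun g => LinearMap.ext fun v => by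
        have h := congrArg Subtype.val (e.symm.toIntertwiningMap.isIntertwining _ _ g v)
        exact (congrArg R h).trans (hR g _) }
  have := σ.irred
  have hq : q = 0 := by
    -- Otherwise the range of q is a copy of σ in the target, against disjointness.
    refine (Representation.IsIrreducible.injective_or_eq_zero q).resolve_left fun hi => ?_
    refine Set.disjoint_left.mp hS hσ ⟨σ, rfl, q.range, ⟨Representation.Equiv.symm ?_⟩⟩
    exact Representation.Equiv.mk (LinearEquiv.ofInjective q.toLinearMap hi) fun g =>
      LinearMap.ext fun v => Subtype.ext (q.isIntertwining _ _ g v)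
  intro v hv
  have h3 : q (e ⟨v, hv⟩) = 0 := by rw [hq]; rfl
  change R (e.symm (e ⟨v, hv⟩)).1 = 0 at h3
  rwa [Representation.Equiv.symm_apply_apply] at h3

/-! ### The Witt tower and the commutant on the new part -/

/-- The embedding of the space at the step `ℓ` of the Witt tower into that at the step `ℓ + 1`. -/
def towerEmb (F A : Type*) [Field F] [AddCommGroup A] [Module F A] (ℓ : ℕ) :
    A × (Fin ℓ → F × F) →ₗ[F] A × (Fin (ℓ + 1) → F × F) where
  toFun u := (u.1, Fin.cons 0 u.2)
  map_add' u v := by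
    refine Prod.ext rfl (funext fun i => ?_)
    refine Fin.cases ?_ (fun i => ?_) i
    · exact (add_zero _).symm
    · rfl
  map_smul' c u := by
    refine Prod.ext rfl (funext fun i => ?_)
    refine Fin.cases ?_ (fun i => ?_) i
    · exact (smul_zero (A := F × F) c).symm
    · rfl

/-- The added hyperbolic plane has index 0, and e is its first basis vector. Orthogonality to e
kills the second coordinate in this plane and leaves the line of e beside the smaller space. -/
theorem isIsotropicReduction_towerEmb {F A : Type*} [Field F] [AddCommGroup A] [Module F A]
    (a : LinearMap.BilinForm F A) (ℓ : ℕ) :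
    IsIsotropicReduction (towerForm a ℓ) (towerForm a (ℓ + 1)) (towerEmb F A ℓ)
      (0, Fin.cons (1, 0) 0) where
  isometry x y := by
    rw [towerForm_apply, towerForm_apply, Fin.sum_univ_succ]
    simp [towerEmb]
  isotropic := by
    rw [towerForm_apply, Fin.sum_univ_succ]
    simp
  ne_zero h := by
    have h1 := congrFun (congrArg Prod.snd h) 0
    simp at h1
  orthogonal x := by
    rw [towerForm_apply, Fin.sum_univ_succ]
    simp [towerEmb]
  exists_eq y hy := by
    rw [towerForm_apply, Fin.sum_univ_succ] at hy
    have h1 : (y.2 0).2 = 0 := by simpa using hy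
    refine ⟨(y.1, Fin.tail y.2), (y.2 0).1, Prod.ext ?_ (funext fun i => ?_)⟩
    · simp [towerEmb]
    · refine Fin.cases ?_ (fun i => ?_) i
      · refine Prod.ext ?_ ?_
        · simp [towerEmb]
        · simp [towerEmb, h1]
      · simp [towerEmb, Fin.tail]

/-- Conjugation by ω(g') moves V ⊗ e to V ⊗ g'e. This allows an arbitrary isotropic vector to be
replaced by the standard one. -/
theorem orthOp_heisenbergVec {F M : Type*} [Field F] [AddCommGroup M] [Module F M]
    [Fintype M] {n : ℕ} (h2 : (2 : F) ≠ 0) {B : LinearMap.BilinForm F M} (hB : IsInnerProduct B)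
    {χ : AddChar F ℂ} (hχ : χ ≠ 1) (g : isometryGroup B) (v : SympSpace n F) (e : M)
    (f : Schrodinger n M) :
    oscillatorRep n h2 hB hχ (orthEmb n B g) (heisenbergVec h2 hB χ (fun j => v j • e) f) =
      heisenbergVec h2 hB χ (fun j => v j • g.1 e)
        (oscillatorRep n h2 hB hχ (orthEmb n B g) f) := by
  have h1 := LinearMap.congr_fun
    (oscillatorRep_intertwines n h2 hB hχ (orthEmb n B g) ⟨fun j => v j • e, 0⟩) f
  have h3 : Heisenberg.act (orthEmb n B g) ⟨fun j => v j • e, 0⟩ =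
      ⟨fun j => v j • g.1 e, 0⟩ :=
    Heisenberg.ext (funext fun j => map_smul g.1.toLinearMap (v j) e) rfl
  rw [h3] at h1
  exact h1

section Tower

variable {F A : Type*} [Field F] [Fintype F] [AddCommGroup A] [Module F A] [Fintype A]

theorem newRep_inl_apply (n : ℕ) (h2 : (2 : F) ≠ 0) {χ : AddChar F ℂ} (hχ : χ ≠ 1)
    {a : LinearMap.BilinForm F A} (ha : IsAnisotropicForm a) (ℓ : ℕ)
    (g : Matrix.symplecticGroup (Fin n) F) (v : (newPart n h2 hχ ha ℓ).toSubmodule) :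
    (newRep n h2 hχ ha ℓ (g, 1) v : Schrodinger n (A × (Fin ℓ → F × F))) =
      spRep n h2 (ha.isInnerProduct_towerForm ℓ) hχ g v := by
  change oscillatorRep n h2 _ hχ (spEmb n (towerForm a ℓ) g * orthEmb n (towerForm a ℓ) 1) v = _
  rw [map_one, mul_one]
  rfl

theorem newRep_inr_apply (n : ℕ) (h2 : (2 : F) ≠ 0) {χ : AddChar F ℂ} (hχ : χ ≠ 1)
    {a : LinearMap.BilinForm F A} (ha : IsAnisotropicForm a) (ℓ : ℕ)
    (g' : isometryGroup (towerForm a ℓ)) (v : (newPart n h2 hχ ha ℓ).toSubmodule) :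
    (newRep n h2 hχ ha ℓ (1, g') v : Schrodinger n (A × (Fin ℓ → F × F))) =
      oscillatorRep n h2 (ha.isInnerProduct_towerForm ℓ) hχ (orthEmb n (towerForm a ℓ) g') v := by
  change oscillatorRep n h2 _ hχ (spEmb n (towerForm a ℓ) 1 * orthEmb n (towerForm a ℓ) g') v = _
  rw [map_one, one_mul]

theorem newSpectrum_subset (n : ℕ) (h2 : (2 : F) ≠ 0) {χ : AddChar F ℂ} (hχ : χ ≠ 1)
    {a : LinearMap.BilinForm F A} (ha : IsAnisotropicForm a) (ℓ : ℕ) :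
    newSpectrum n h2 hχ ha ℓ ⊆ spectrumOf (spRep n h2 (ha.isInnerProduct_towerForm ℓ) hχ) := by
  cases ℓ with
  | zero => exact fun _ h => h
  | succ ℓ => exact fun _ h => h.1

/-- Operators invariant under right translation by `V ⊗ e`, for an isotropic vector `e`, vanish on
the new part. -/
theorem apply_newPart_eq_zero (n : ℕ) (h2 : (2 : F) ≠ 0) {χ : AddChar F ℂ} (hχ : χ ≠ 1)
    {a : LinearMap.BilinForm F A} (ha : IsAnisotropicForm a) (ℓ : ℕ)
    {D : Module.End ℂ (Schrodinger n (A × (Fin ℓ → F × F)))} {e : A × (Fin ℓ → F × F)}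
    (he0 : e ≠ 0) (he : towerForm a ℓ e e = 0)
    (hD : ∀ v : SympSpace n F,
      D * heisenbergVec h2 (ha.isInnerProduct_towerForm ℓ) χ (fun j => v j • e) = D)
    (v : (newPart n h2 hχ ha ℓ).toSubmodule) : D v = 0 := by
  cases ℓ with
  | zero =>
    -- With no hyperbolic plane the form is a itself, which has no isotropic vector.
    exfalso
    rw [towerForm_apply] at he
    exact he0 (Prod.ext (ha.anisotropic _ (by simpa using he)) (Subsingleton.elim _ _))
  | succ ℓ =>
    have hB := ha.isInnerProduct_towerForm ℓ
    have hB' := ha.isInnerProduct_towerForm (ℓ + 1)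
    have hred := isIsotropicReduction_towerEmb a ℓ
    -- Here g takes the standard isotropic vector to e, so D ω(g) is invariant under translation by
    -- V ⊗ (standard vector) and factors through the reduction.
    obtain ⟨g, hg⟩ := exists_isometry_apply_eq h2 hB' hred.ne_zero he0 hred.isotropic he
    have hD' : ∀ (u : SympSpace n F) f,
        (D * oscillatorRep n h2 hB' hχ (orthEmb n _ g))
          (heisenbergVec h2 hB' χ (fun j => u j • (0, Fin.cons (1, 0) 0)) f) =
        (D * oscillatorRep n h2 hB' hχ (orthEmb n _ g)) f := by
      intro u f
      rw [Module.End.mul_apply, orthOp_heisenbergVec, hg]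
      exact LinearMap.congr_fun (hD u) _
    let v' := newRep n h2 hχ ha (ℓ + 1) (1, g⁻¹) v
    -- The new part is stable under g⁻¹, and its classes are absent from the level ℓ where the
    -- reduction takes values.
    have hv' : reductionMap n (towerEmb F A ℓ) (0, Fin.cons (1, 0) 0) v'.1 = 0 :=
      map_isotypicSum_eq_zero (ρ := spRep n h2 hB' hχ) (ρ' := spRep n h2 hB hχ)
        (Set.disjoint_sdiff_left : Disjoint (newSpectrum n h2 hχ ha (ℓ + 1)) _) _
        (fun k f => reductionMap_spRep h2 hB hB' hχ hred k f) v'.2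
    have h1 := eq_zero_of_reductionMap_eq_zero h2 hB' hχ hred hD' hv'
    have hinv : oscillatorRep n h2 hB' hχ (orthEmb n _ g)
        (oscillatorRep n h2 hB' hχ (orthEmb n _ g⁻¹) v) = v := by
      rw [← Module.End.mul_apply, ← map_mul, ← map_mul, mul_inv_cancel, map_one, map_one,
        Module.End.one_apply]
    rw [Module.End.mul_apply, newRep_inr_apply, hinv] at h1
    exact h1

theorem newRep_commute (n : ℕ) (h2 : (2 : F) ≠ 0) {χ : AddChar F ℂ} (hχ : χ ≠ 1)
    {a : LinearMap.BilinForm F A} (ha : IsAnisotropicForm a) (ℓ : ℕ) :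
    Algebra.adjoin ℂ (Set.range fun g' : isometryGroup (towerForm a ℓ) =>
        newRep n h2 hχ ha ℓ (1, g')) ≤
      Subalgebra.centralizer ℂ (Set.range fun g : Matrix.symplecticGroup (Fin n) F =>
        newRep n h2 hχ ha ℓ (g, 1)) := by
  refine Algebra.adjoin_le ?_
  rintro _ ⟨g', rfl⟩
  rw [SetLike.mem_coe, Subalgebra.mem_centralizer_iff]
  rintro _ ⟨g, rfl⟩
  change newRep n h2 hχ ha ℓ (g, 1) * newRep n h2 hχ ha ℓ (1, g') =
    newRep n h2 hχ ha ℓ (1, g') * newRep n h2 hχ ha ℓ (g, 1)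
  rw [← map_mul, ← map_mul]
  simp

/-- An operator commuting with the symplectic group on the whole space is a combination of operators
of the orthogonal group and of operators that vanish on the new part. Maschke's theorem reduces the
new part to the whole space. -/
theorem newRep_centralizer_le (n : ℕ) (h2 : (2 : F) ≠ 0) {χ : AddChar F ℂ} (hχ : χ ≠ 1)
    {a : LinearMap.BilinForm F A} (ha : IsAnisotropicForm a) (ℓ : ℕ) :
    Subalgebra.centralizer ℂ (Set.range fun g : Matrix.symplecticGroup (Fin n) F =>
        newRep n h2 hχ ha ℓ (g, 1)) ≤
      Algebra.adjoin ℂ (Set.range fun g' : isometryGroup (towerForm a ℓ) =>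
        newRep n h2 hχ ha ℓ (1, g')) := by
  intro T hT
  rw [Subalgebra.mem_centralizer_iff] at hT
  have hB := ha.isInnerProduct_towerForm ℓ
  let K := (newPart n h2 hχ ha ℓ).toSubmodule
  let i : Representation.IntertwiningMap
      ((newRep n h2 hχ ha ℓ).comp (MonoidHom.inl _ _)) (spRep n h2 hB hχ) :=
    { toLinearMap := K.subtype
      isIntertwining' := fun g => LinearMap.ext fun v => newRep_inl_apply n h2 hχ ha ℓ g v }
  obtain ⟨p, hp⟩ := i.exists_leftInverse Subtype.val_injective
  -- T is extended by zero on the invariant complement ker p of the new part.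
  let T' : Module.End ℂ (Schrodinger n (A × (Fin ℓ → F × F))) :=
    i.toLinearMap ∘ₗ T ∘ₗ p.toLinearMap
  have hT' : ∀ g, spRep n h2 hB hχ g * T' = T' * spRep n h2 hB hχ g := by
    intro g
    refine LinearMap.ext fun f => ?_
    have h1 := LinearMap.congr_fun (hT _ ⟨g, rfl⟩) (p f)
    change newRep n h2 hχ ha ℓ (g, 1) (T (p f)) = T (newRep n h2 hχ ha ℓ (g, 1) (p f)) at h1
    have h3 : p (spRep n h2 hB hχ g f) = newRep n h2 hχ ha ℓ (g, 1) (p f) :=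
      p.isIntertwining _ _ g f
    have h4 : i (newRep n h2 hχ ha ℓ (g, 1) (T (p f))) = spRep n h2 hB hχ g (i (T (p f))) :=
      i.isIntertwining _ _ g _
    change spRep n h2 hB hχ g (i (T (p f))) = i (T (p (spRep n h2 hB hχ g f)))
    rw [h3, ← h1, h4]
  have hspan : ∀ X ∈ Submodule.span ℂ
      ((Set.range fun g => oscillatorRep n h2 hB hχ (orthEmb n (towerForm a ℓ) g)) ∪
      {D | ∃ e, e ≠ 0 ∧ towerForm a ℓ e e = 0 ∧
        ∀ v : SympSpace n F, D * heisenbergVec h2 hB χ (fun j => v j • e) = D}),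
      ∃ b ∈ Algebra.adjoin ℂ (Set.range fun g' : isometryGroup (towerForm a ℓ) =>
        newRep n h2 hχ ha ℓ (1, g')), ∀ v : K, X v = (b v).1 := by
    intro X hX
    induction hX using Submodule.span_induction with
    | mem X hX =>
      rcases hX with ⟨g', rfl⟩ | ⟨e, he0, he, hD⟩
      · exact ⟨_, Algebra.subset_adjoin ⟨g', rfl⟩,
          fun v => (newRep_inr_apply n h2 hχ ha ℓ g' v).symm⟩
      · exact ⟨0, zero_mem _, fun v => apply_newPart_eq_zero n h2 hχ ha ℓ he0 he hD v⟩
    | zero => exact ⟨0, zero_mem _, fun v => rfl⟩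
    | add X Y _ _ hX hY =>
      obtain ⟨b, hb, h1⟩ := hX
      obtain ⟨b', hb', h3⟩ := hY
      exact ⟨b + b', add_mem hb hb', fun v => by
        rw [LinearMap.add_apply, h1, h3]; rfl⟩
    | smul c X _ hX =>
      obtain ⟨b, hb, h1⟩ := hX
      exact ⟨c • b, Subalgebra.smul_mem _ hb c, fun v => by
        rw [LinearMap.smul_apply, h1]; rfl⟩
  obtain ⟨b, hb, h1⟩ := hspan T' (mem_span_of_commute h2 hB hχ hT')
  have h3 : T = b := LinearMap.ext fun v => Subtype.ext <| by
    rw [← h1]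
    change (T v).1 = (T (p (i v))).1
    rw [hp]
  rwa [h3]

end Tower

theorem proposition8p2p1 {F A : Type*} [Field F] [Fintype F] (h2 : (2 : F) ≠ 0)
    {χ : AddChar F ℂ} (hχ : χ ≠ 1) (n : ℕ) [AddCommGroup A] [Module F A] [Fintype A]
    {a : LinearMap.BilinForm F A} (ha : IsAnisotropicForm a) (ℓ : ℕ) :
    Algebra.adjoin ℂ (Set.range fun g' : isometryGroup (towerForm a ℓ) =>
        newRep n h2 hχ ha ℓ (1, g')) =
      Subalgebra.centralizer ℂ (Set.range fun g : Matrix.symplecticGroup (Fin n) F =>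
        newRep n h2 hχ ha ℓ (g, 1)) ∧
    ∃ (S : Set (GroupDual (isometryGroup (towerForm a ℓ))))
      (η : GroupDual (isometryGroup (towerForm a ℓ)) →
        GroupDual (Matrix.symplecticGroup (Fin n) F)),
      Set.BijOn η S (newSpectrum n h2 hχ ha ℓ) ∧
      ∀ (σ : IrrepOf (Matrix.symplecticGroup (Fin n) F))
        (τ : IrrepOf (isometryGroup (towerForm a ℓ))),
        ((τ.cls ∈ S ∧ η τ.cls = σ.cls) → Module.finrank ℂ
          ((outerTensor σ τ).IntertwiningMap (newRep n h2 hχ ha ℓ)) = 1) ∧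
        (¬ (τ.cls ∈ S ∧ η τ.cls = σ.cls) → Module.finrank ℂ
          ((outerTensor σ τ).IntertwiningMap (newRep n h2 hχ ha ℓ)) = 0) := by
  -- One inclusion is the commutation of the two groups; the other also yields the bijection,
  -- through the multiplicity spaces.
  have hle := newRep_centralizer_le n h2 hχ ha ℓ
  exact ⟨le_antisymm (newRep_commute n h2 hχ ha ℓ) hle, exists_bijOn_of_centralizer_le hle
    (cls_mem_iff_nontrivial (newSpectrum_subset n h2 hχ ha ℓ) (newRep_inl_apply n h2 hχ ha ℓ))⟩

end
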